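/- **Setting.** Let $N\ge 2$, $\mathcal V=\{1,\dots,N\}$, and let $\mathcal A(k)=[a_{ij}(k)]\in\mathbb R^{N\times N}$, $k\ge 0$, be random matrices with zero diagonal, on a probability space; $\mathcal A(k)$ is the generalized weighted adjacency matrix of a random digraph $\mathcal G(k)$ on $\mathcal V$, with $(j,i)\in\mathcal E_{\mathcal G(k)}$ iff $a_{ij}(k)\neq 0$ (the weights may be negative). Put $N_i(k)=\{j: a_{ij}(k)\ne 0\}$, $L_{\mathcal G(k)}=\mathrm{diag}\big(\sum_j a_{1j}(k),\dots,\sum_j a_{Nj}(k)\big)-\mathcal A(k)$ and $\hat L_{\mathcal G(k)}=\tfrac12\big(L_{\mathcal G(k)}+L_{\mathcal G(k)}^T\big)$. Consider $$x_i(k+1)=x_i(k)+c(k)\sum_{j\in N_i(k)}a_{ij}(k)\big(y_{ji}(k)-x_i(k)\big),\qquad y_{ji}(k)=x_j(k)+f_{ji}\big(x_j(k)-x_i(k)\big)\,\xi_{ji}(k),$$ for $k\ge 0$, $i\in\mathcal V$, with deterministic initial states $x_i(0)\in\mathbb R$, gains $c(k)$, measurable functions $f_{ji}:\mathbb R\to\mathbb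 R$ and noises $\xi(k)=(\xi_{ji}(k))_{j,i}$. For a random sequence $\eta$ let $\mathcal F_\eta(k)=\sigma(\eta(0),\dots,\eta(k))$ and let $\mathcal F_\eta(-1)$ be trivial. Let $X(k)=(x_1(k),\dots,x_N(k))^T$, $\delta(k)=\big(I_N-\tfrac1N\mathbf 1\mathbf 1^T\big)X(k)$ and $V(k)=\|\delta(k)\|^2$. Matrix norms are 2-norms and $\lambda_2$ is the second smallest eigenvalue of a symmetric matrix. **Theorem 1.** Assume that the flow belongs to $\Gamma_1$, i.e. for every $k\ge0$, almost surely, $E[\mathcal A(k)\mid\mathcal F_{\mathcal A}(k-1)]$ has nonnegative entries and is balanced (its $i$-th row sum equals its $i$-th column sum for every $i$). Assume further: (a) (A1) there are positive constants $\sigma_{ji},b_{ji}$ with $|f_{ji}(x)|\le\sigma_{ji}|x|+b_{ji}$ for all $x\in\mathbb R$; (A2) $\{\xi(k),\mathcal F_\xi(k)\}$ is a martingale difference sequence, and there is a constant $\beta>0$ with $\sup_{k\ge0}E[\|\xi(k)\|^2\mid\mathcal F_\xi(k-1)]\le\beta$ a.s.; (A3) $c(k)>0$, $\sum_k c(k)=\infty$,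 $\sum_k c^2(k)<\infty$; (A4) $c(k)$ decreases to $0$, and $c(k)=O(c(k+h'))$ as $k\to\infty$ for every integer $h'>0$; (A5) the processes $\{\mathcal A(k)\}_{k\ge0}$ and $\{\xi(k)\}_{k\ge0}$ are independent; (b) there are a deterministic positive integer $h$ and constants $\theta,\rho_0>0$ such that (b.1) $\displaystyle\inf_{m\ge0}\lambda_2\Big(\sum_{i=mh}^{(m+1)h-1}E\big[\hat L_{\mathcal G(i)}\mid\mathcal F_{\mathcal A}(mh-1)\big]\Big)\ge\theta$ a.s., (b.2) $\displaystyle\sup_{k\ge0}\Big[E\big[\|L_{\mathcal G(k)}\|^{2^{\max\{h,2\}}}\mid\mathcal F_{\mathcal A}(k-1)\big]\Big]^{1/2^{\max\{h,2\}}}\le\rho_0$ a.s. Then $\lim_{k\to\infty}E[V(k)]=0$ and $\lim_{k\to\infty}V(k)=0$ a.s. There are constants $\rho_1,\rho_2$ such that, a.s., $$\sup_{k\ge0}E\Big[|\mathcal E_{\mathcal G(k)}|\max_{1\le i,j\le N}a_{ij}^2(k)\,\Big|\,\mathcal F_{\mathcal A}(k-1)\Big]\le\rho_1,\qquad \max_{1\le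 i\le N}\sup_{k\ge0}E\Big[\Big(\sum_{j=1}^N a_{ij}(k)-\sum_{j=1}^N a_{ji}(k)\Big)^2\Big|\,\mathcal F_{\mathcal A}(k-1)\Big]\le\rho_2 .\tag{$*$}$$ Moreover, there is a square-integrable random variable $x^*$ such that, for every $i\in\mathcal V$, $x_i(k)\to x^*$ as $k\to\infty$ in mean square and almost surely, $E(x^*)=\frac1N\sum_{j=1}^N x_j(0)$, and, for all constants $\rho_1,\rho_2$ satisfying $(*)$, $$\mathrm{Var}(x^*)\le\frac{4c\beta b^2\rho_1}{N^2}+\frac{8\tilde c\,\beta\sigma^2\rho_1}{N^2}+\frac{2c\rho_2q_x}{N},$$ where $c=\sum_{k\ge0}c^2(k)$, $\tilde c=\sum_{k\ge0}E[V(k)]\,c^2(k)<\infty$, $\sigma=\max_{i,j}\sigma_{ji}$, $b=\max_{i,j}b_{ji}$, $$q_x=e^{c\rho_0^2}\Big(\|X(0)\|^2+2c\beta\rho_1\big(2\sigma^2q_v+b^2\big)\Big),\qquad q_v=e^{c(\rho_0^2+4\rho_1\beta\sigma^2)}\Big(V(0)+2c\beta\rho_1b^2\Big).$$ -/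

import Mathlib

open MeasureTheory ProbabilityTheory Filter Topology

noncomputable section

namespace StochAvg

/-! ### Weighted digraphs on `Fin N`

A digraph is given by its generalized weighted adjacency matrix `A`, with real (possibly negative)
entries: `A i j ≠ 0` iff there is an edge from `j` to `i`. -/

/-- The neighbourhood of agent `i`: all `j` that send information to `i`. -/
def nbhd {N : ℕ} (A : Fin N → Fin N → ℝ) (i : Fin N) : Finset (Fin N) :=
  letI := Classical.decPred fun j => A i j ≠ 0
  Finset.univ.filter fun j => A i j ≠ 0

/-- The number of edges. -/
def edgeCount {N : ℕ} (A : Fin N → Fin N → ℝ) : ℕ :=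
  Nat.card {p : Fin N × Fin N // A p.1 p.2 ≠ 0}

def degIn {N : ℕ} (A : Fin N → Fin N → ℝ) (i : Fin N) : ℝ := ∑ j, A i j

def degOut {N : ℕ} (A : Fin N → Fin N → ℝ) (i : Fin N) : ℝ := ∑ j, A j i

def IsBalanced {N : ℕ} (A : Fin N → Fin N → ℝ) : Prop := ∀ i, degIn A i = degOut A i

/-- The generalized Laplacian `L = D - A`. -/
def lap {N : ℕ} (A : Fin N → Fin N → ℝ) : Matrix (Fin N) (Fin N) ℝ :=
  Matrix.diagonal (degIn A) - Matrix.of A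

/-- The symmetrized Laplacian `(L + Lᵀ) / 2`. -/
def symLap {N : ℕ} (A : Fin N → Fin N → ℝ) : Matrix (Fin N) (Fin N) ℝ :=
  (1 / 2 : ℝ) • (lap A + (lap A).transpose)

/-- The matrix 2-norm. -/
def norm2 {N : ℕ} (M : Matrix (Fin N) (Fin N) ℝ) : ℝ :=
  ‖Matrix.toEuclideanCLM (n := Fin N) (𝕜 := ℝ) M‖

/-- The second smallest eigenvalue (with multiplicity) of a real symmetric matrix of size at
least 2; `eigenvalues₀` lists the eigenvalues in decreasing order. -/
def lambda2 {N : ℕ} (M : Matrix (Fin N) (Fin N) ℝ) : ℝ :=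
  letI := Classical.propDecidable (M.IsHermitian ∧ 2 ≤ N)
  if h : M.IsHermitian ∧ 2 ≤ N then
    h.1.eigenvalues₀ ⟨N - 2, by have := h.2; rw [Fintype.card_fin]; omega⟩
  else 0

/-! ### Histories and conditional expectations -/

/-- The σ-algebra generated by `Z 0, …, Z (k - 1)`; it is trivial for `k = 0`. -/
@[reducible] def past {Ω E : Type*} [MeasurableSpace E] (Z : ℕ → Ω → E) (k : ℕ) : MeasurableSpace Ω :=
  ⨆ j : Fin k, MeasurableSpace.comap (Z j) inferInstance

/-- Entrywise conditional expectation of a random matrix. -/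
def condMat {Ω : Type*} [MeasurableSpace Ω] {N : ℕ} (μ : Measure Ω) (m : MeasurableSpace Ω)
    (M : Ω → Fin N → Fin N → ℝ) (ω : Ω) : Matrix (Fin N) (Fin N) ℝ :=
  Matrix.of fun i j => (μ[fun ω' => M ω' i j | m]) ω

/-- `E[f | m] ≤ r` a.s., for an integrable `f`. -/
def CondBound {Ω : Type*} [MeasurableSpace Ω] (μ : Measure Ω) (m : MeasurableSpace Ω)
    (f : Ω → ℝ) (r : ℝ) : Prop :=
  Integrable f μ ∧ ∀ᵐ ω ∂μ, (μ[f | m]) ω ≤ r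

/-! ### The algorithm -/

/-- The measurement of agent `j`'s state by agent `i`: state vector `x`, noise intensities `f`,
noises `ξ`. Here `f j i` and `ξ j i` belong to the channel from `j` to `i`. -/
def meas {N : ℕ} (f : Fin N → Fin N → ℝ → ℝ) (x : Fin N → ℝ) (ξ : Fin N → Fin N → ℝ)
    (j i : Fin N) : ℝ :=
  x j + f j i (x j - x i) * ξ j i

/-- The states `x_i(k)` of the averaging algorithm started at `x0`. -/
def state {Ω : Type*} {N : ℕ} (c : ℕ → ℝ) (f : Fin N → Fin N → ℝ → ℝ)
    (A ξ : ℕ → Ω → Fin N → Fin N → ℝ) (x0 : Fin N → ℝ) : ℕ → Ω → Fin N → ℝ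
  | 0, _, i => x0 i
  | k + 1, ω, i =>
    state c f A ξ x0 k ω i + c k * ∑ j ∈ nbhd (A k ω) i,
      A k ω i j * (meas f (state c f A ξ x0 k ω) (ξ k ω) j i - state c f A ξ x0 k ω i)

/-- The consensus error `δ = P x` of a state vector, where `P = I - (1/N) 1 1ᵀ`. -/
def consErr {N : ℕ} (x : Fin N → ℝ) : Fin N → ℝ :=
  ((1 : Matrix (Fin N) (Fin N) ℝ) - (1 / (N : ℝ)) • Matrix.of fun _ _ => (1 : ℝ)).mulVec x

/-- The squared Euclidean norm. -/
def sqNorm {N : ℕ} (x : Fin N → ℝ) : ℝ := ∑ i, x i ^ 2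

/-- The energy `V = ‖δ‖²` of a state vector. -/
def energy {N : ℕ} (x : Fin N → ℝ) : ℝ := sqNorm (consErr x)

/-! ### Assumptions -/

/-- Noise intensities of at most linear growth. -/
def A1 {N : ℕ} (f : Fin N → Fin N → ℝ → ℝ) (σ b : Fin N → Fin N → ℝ) : Prop :=
  ∀ j i, Measurable (f j i) ∧ 0 < σ j i ∧ 0 < b j i ∧ ∀ x, |f j i x| ≤ σ j i * |x| + b j i

/-- The noises are martingale differences with respect to their own history, with conditional
second moment at most `β`. -/
def A2 {Ω : Type*} [MeasurableSpace Ω] {N : ℕ} (μ : Measure Ω)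
    (ξ : ℕ → Ω → Fin N → Fin N → ℝ) (β : ℝ) : Prop :=
  ∀ k, Measurable (ξ k) ∧
    (∀ j i, Integrable (fun ω => ξ k ω j i) μ ∧
      μ[fun ω => ξ k ω j i | past ξ k] =ᵐ[μ] 0) ∧
    CondBound μ (past ξ k) (fun ω => ∑ j, ∑ i, ξ k ω j i ^ 2) β

/-- Gains that are positive, not summable, but square summable. -/
def A3 (c : ℕ → ℝ) : Prop :=
  (∀ k, 0 < c k) ∧ Tendsto (fun n => ∑ k ∈ Finset.range n, c k) atTop atTop ∧
    Summable fun k => c k ^ 2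

/-- Gains that decrease to zero, not too fast. -/
def A4 (c : ℕ → ℝ) : Prop :=
  Antitone c ∧ Tendsto c atTop (𝓝 0) ∧ ∀ h > 0, c =O[atTop] fun k => c (k + h)

/-- The graph flow and the noise process are independent. -/
def A5 {Ω : Type*} [MeasurableSpace Ω] {N : ℕ} (μ : Measure Ω)
    (A ξ : ℕ → Ω → Fin N → Fin N → ℝ) : Prop :=
  IndepFun (fun ω k => A k ω) (fun ω k => ξ k ω) μ

/-- Graph flows (random, integrable, without self-loops) whose conditional digraphs given the
past of the flow are nonnegative and balanced almost surely. -/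
def Gamma1 {Ω : Type*} [MeasurableSpace Ω] {N : ℕ} (μ : Measure Ω)
    (A : ℕ → Ω → Fin N → Fin N → ℝ) : Prop :=
  ∀ k, Measurable (A k) ∧ (∀ ω i, A k ω i i = 0) ∧
    (∀ i j, Integrable (fun ω => A k ω i j) μ) ∧
    ∀ᵐ ω ∂μ, (∀ i j, 0 ≤ condMat μ (past A k) (A k) ω i j) ∧
      IsBalanced (condMat μ (past A k) (A k) ω)

/-- `λ_k^h`: the second smallest eigenvalue of the sum over `k ≤ i < k + h` of the conditional
expectations of the symmetrized Laplacians, given the flow before time `k`. -/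
def condConn {Ω : Type*} [MeasurableSpace Ω] {N : ℕ} (μ : Measure Ω)
    (A : ℕ → Ω → Fin N → Fin N → ℝ) (h k : ℕ) (ω : Ω) : ℝ :=
  lambda2 (∑ i ∈ Finset.Ico k (k + h), condMat μ (past A k) (fun ω' => symLap (A i ω')) ω)

/-- Conditional moments of order `2 ^ max h 2` of the Laplacians, bounded by `ρ₀`. -/
def MomentBound {Ω : Type*} [MeasurableSpace Ω] {N : ℕ} (μ : Measure Ω)
    (A : ℕ → Ω → Fin N → Fin N → ℝ) (h : ℕ) (ρ₀ : ℝ) : Prop :=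
  ∀ k, Integrable (fun ω => norm2 (lap (A k ω)) ^ 2 ^ max h 2) μ ∧
    ∀ᵐ ω ∂μ, ((μ[fun ω' => norm2 (lap (A k ω')) ^ 2 ^ max h 2 | past A k]) ω) ^
      (1 / (2 : ℝ) ^ max h 2) ≤ ρ₀

/-- `ρ₁` bounds the conditional expectations of (number of edges) × (largest squared weight). -/
def IsRho1 {Ω : Type*} [MeasurableSpace Ω] {N : ℕ} (μ : Measure Ω)
    (A : ℕ → Ω → Fin N → Fin N → ℝ) (ρ₁ : ℝ) : Prop :=
  ∀ k, CondBound μ (past A k)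
    (fun ω => edgeCount (A k ω) * ⨆ p : Fin N × Fin N, A k ω p.1 p.2 ^ 2) ρ₁

/-- `ρ₂` bounds the conditional second moments of the imbalances of the nodes. -/
def IsRho2 {Ω : Type*} [MeasurableSpace Ω] {N : ℕ} (μ : Measure Ω)
    (A : ℕ → Ω → Fin N → Fin N → ℝ) (ρ₂ : ℝ) : Prop :=
  ∀ i k, CondBound μ (past A k) (fun ω => (degIn (A k ω) i - degOut (A k ω) i) ^ 2) ρ₂

/-! ### The constants of the variance bound -/

/-- The largest entry. -/
def maxEntry {N : ℕ} (s : Fin N → Fin N → ℝ) : ℝ := ⨆ p : Fin N × Fin N, s p.1 p.2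

/-- `q_v`; here `C = ∑ c(k)²` and `V0 = V(0)`. -/
def qv (C ρ₀ ρ₁ β σ b V0 : ℝ) : ℝ :=
  Real.exp (C * (ρ₀ ^ 2 + 4 * ρ₁ * β * σ ^ 2)) * (V0 + 2 * C * β * ρ₁ * b ^ 2)

/-- `q_x`; here moreover `X0 = ‖X(0)‖²`. -/
def qx (C ρ₀ ρ₁ β σ b V0 X0 : ℝ) : ℝ :=
  Real.exp (C * ρ₀ ^ 2) *
    (X0 + 2 * C * β * ρ₁ * (2 * σ ^ 2 * qv C ρ₀ ρ₁ β σ b V0 + b ^ 2))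

/-- The bound on the variance of the limit; here moreover `Ct = ∑ E[V(k)] c(k)²`. -/
def varBound (N : ℕ) (C Ct ρ₀ ρ₁ ρ₂ β σ b V0 X0 : ℝ) : ℝ :=
  4 * C * β * b ^ 2 * ρ₁ / (N : ℝ) ^ 2 + 8 * Ct * β * σ ^ 2 * ρ₁ / (N : ℝ) ^ 2 +
    2 * C * ρ₂ * qx C ρ₀ ρ₁ β σ b V0 X0 / N

end StochAvg

end

open StochAvg

/-! Split `X(k)` into its average and the consensus error `δ(k)`, and work with expectations
throughout. Single realizations of the weights may be negative and unbalanced, so `yᵀLy` has no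
sign. The conditional digraphs, however, are nonnegative and balanced, so `E[yᵀL(k)y] ≥ 0` for every
square-integrable `y` known before step `k`. This is the substitute for positive semidefiniteness
(`StepModel.integral_mul_lapForm_nonneg`).

Expanding one step, the cross terms with the noises vanish: by independence the noises stay
martingale differences when the whole flow is added to their past. The remaining quadratic terms
cost `O(c(k)²)`. This gives `E V(k+1) ≤ E V(k) - 2c(k) E[δᵀLδ] + O(c(k)²)(1 + E V(k))`, and a
discrete Grönwall argument bounds `E V` and `E‖X‖²` uniformly.

Connectivity is assumed only jointly over a block of `h` steps and conditionally on the start `t` of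
the block. Decay is therefore extracted per block (`integral_energy_block_le`). Within a block `δ`
moves by `O(c(t)²)` in mean square, so each form at `δ(t+n)` can be compared with the form at the
frozen vector `δ(t)`. The comparison uses the parallelogram law, because only the expectation of the
form is nonnegative. The forms at `δ(t)` add up to at least `θ E V(t)` by the bound on `λ₂`. Hence
`E V` contracts over block `m` by the factor `1 - θ c((m+1)h)` up to a summable error, and the
divergence of `∑ c` forces `E V → 0`. Almost sure convergence follows since `V` is a supermartingale
up to a summable perturbation.

The average is a martingale: its increments consist of noise and of conditionally centred
imbalances. Their mean squares are `O(c(k)²)`, so it converges in mean square and almost surely, and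
the sum of the mean squared increments bounds the variance of the limit
(`exists_limit_of_square_integrable_martingale`). Since `V → 0`, all states share this limit. -/

namespace StochAvg

/-! ### Conditional expectations: independence, truncation and Fatou. -/

section ConditionalExpectation

variable {Ω : Type*} {m0 : MeasurableSpace Ω} {μ : Measure Ω}

/-- Enlarging the conditioning σ-algebra by an independent one does not change the conditional
expectation. -/
theorem condExp_sup_of_indep [IsProbabilityMeasure μ] {m₁ m₁' m₂ : MeasurableSpace Ω}
    (h11 : m₁ ≤ m₁') (h1 : m₁' ≤ m0) (h2 : m₂ ≤ m0) (hind : Indep m₁' m₂ μ) {B : Ω → ℝ}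
    (hB : StronglyMeasurable[m₁'] B) (hBi : Integrable B μ) :
    μ[B | m₁ ⊔ m₂] =ᵐ[μ] μ[B | m₁] := by
  have hm1 : m₁ ≤ m0 := h11.trans h1
  -- Integrals over `s ∩ t` factor by independence. This is stated for a general `C` because it is
  -- needed both for `B` and for `μ[B | m₁]`.
  have key : ∀ (C : Ω → ℝ), StronglyMeasurable[m₁'] C → Integrable C μ →
      ∀ s t, MeasurableSet[m₁'] s → MeasurableSet[m₂] t →
      ∫ ω in s ∩ t, C ω ∂μ = μ.real t * ∫ ω in s, C ω ∂μ := by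
    intro C hC hCi s t hs ht
    have e1 : ∫ ω in s ∩ t, C ω ∂μ = ∫ ω in t, s.indicator C ω ∂μ := by
      rw [setIntegral_indicator (h1 _ hs), Set.inter_comm]
    have e2 := condExp_indep_eq h1 h2 (hC.indicator hs) hind
    have e3 := setIntegral_condExp (μ := μ) h2 (hCi.indicator (h1 _ hs)) ht
    rw [e1, ← e3, setIntegral_congr_ae (g := fun _ => μ[s.indicator C]) (h2 _ ht)
      (e2.mono fun ω hω _ => hω), setIntegral_const, smul_eq_mul, integral_indicator (h1 _ hs)]
  refine (ae_eq_condExp_of_forall_setIntegral_eq (sup_le hm1 h2) hBi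
    (fun s _ _ => integrable_condExp.integrableOn) ?_
    (stronglyMeasurable_condExp.mono le_sup_left).aestronglyMeasurable).symm
  intro s hs _
  -- The sets `s ∩ t` form a π-system generating `m₁ ⊔ m₂`, so the identity of integrals only has to
  -- be checked on them.
  have hgen : m₁ ⊔ m₂ = MeasurableSpace.generateFrom
      {u | ∃ s t, MeasurableSet[m₁] s ∧ MeasurableSet[m₂] t ∧ s ∩ t = u} := by
    apply le_antisymm
    · refine sup_le (fun s hs => MeasurableSpace.measurableSet_generateFrom
        ⟨s, Set.univ, hs, MeasurableSet.univ, Set.inter_univ s⟩)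
        (fun t ht => MeasurableSpace.measurableSet_generateFrom
        ⟨Set.univ, t, MeasurableSet.univ, ht, Set.univ_inter t⟩)
    · refine MeasurableSpace.generateFrom_le ?_
      rintro _ ⟨s, t, hs, ht, rfl⟩
      exact MeasurableSet.inter ((le_sup_left : m₁ ≤ m₁ ⊔ m₂) s hs)
        ((le_sup_right : m₂ ≤ m₁ ⊔ m₂) t ht)
  have hpi : IsPiSystem {u | ∃ s t, MeasurableSet[m₁] s ∧ MeasurableSet[m₂] t ∧ s ∩ t = u} := by
    rintro _ ⟨s, t, hs, ht, rfl⟩ _ ⟨s', t', hs', ht', rfl⟩ _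
    exact ⟨s ∩ s', t ∩ t', hs.inter hs', ht.inter ht', Set.inter_inter_inter_comm _ _ _ _⟩
  induction s, hs using MeasurableSpace.induction_on_inter hgen hpi with
  | empty => simp
  | basic u hu =>
    obtain ⟨s, t, hs, ht, rfl⟩ := hu
    rw [key _ (stronglyMeasurable_condExp.mono h11) integrable_condExp s t (h11 _ hs) ht,
      key B hB hBi s t (h11 _ hs) ht, setIntegral_condExp hm1 hBi hs]
  | compl t ht ih =>
    have ht0 := sup_le hm1 h2 _ ht
    have e1 := integral_add_compl (μ := μ) (f := μ[B | m₁]) ht0 integrable_condExp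
    have e2 := integral_add_compl (μ := μ) ht0 hBi
    have e3 := integral_condExp (μ := μ) (f := B) hm1
    have := ih (measure_lt_top _ _)
    linarith
  | iUnion f hd hf ih =>
    rw [integral_iUnion (fun i => sup_le hm1 h2 _ (hf i)) hd integrable_condExp.integrableOn,
      integral_iUnion (fun i => sup_le hm1 h2 _ (hf i)) hd hBi.integrableOn]
    exact tsum_congr fun i => ih i (measure_lt_top _ _)

/-- Fatou's lemma for nonnegative integrable functions with bounded integrals. -/
theorem integral_le_of_tendsto {F : ℕ → Ω → ℝ} {g : Ω → ℝ} {K : ℝ}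
    (hF : ∀ n, Integrable (F n) μ) (h0 : ∀ n, 0 ≤ᵐ[μ] F n) (hK : ∀ n, ∫ ω, F n ω ∂μ ≤ K)
    (hlim : ∀ᵐ ω ∂μ, Tendsto (fun n => F n ω) atTop (𝓝 (g ω))) :
    Integrable g μ ∧ ∫ ω, g ω ∂μ ≤ K := by
  have hmeas : AEStronglyMeasurable g μ :=
    aestronglyMeasurable_of_tendsto_ae atTop (fun n => (hF n).aestronglyMeasurable) hlim
  have hg0 : 0 ≤ᵐ[μ] g := by
    filter_upwards [hlim, ae_all_iff.2 h0] with ω h1 h2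
    exact ge_of_tendsto' h1 h2
  have hK0 : 0 ≤ K := (integral_nonneg_of_ae (h0 0)).trans (hK 0)
  have hlint : ∫⁻ ω, ENNReal.ofReal (g ω) ∂μ ≤ ENNReal.ofReal K := by
    calc ∫⁻ ω, ENNReal.ofReal (g ω) ∂μ
        = ∫⁻ ω, liminf (fun n => ENNReal.ofReal (F n ω)) atTop ∂μ := by
          refine lintegral_congr_ae ?_
          filter_upwards [hlim] with ω h
          exact ((ENNReal.continuous_ofReal.tendsto _).comp h).liminf_eq.symm
      _ ≤ liminf (fun n => ∫⁻ ω, ENNReal.ofReal (F n ω) ∂μ) atTop :=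
          lintegral_liminf_le' fun n => (hF n).aestronglyMeasurable.aemeasurable.ennreal_ofReal
      _ ≤ _ := by
          refine liminf_le_of_le (by isBoundedDefault) fun b hb => ?_
          obtain ⟨n, hn⟩ := hb.exists
          refine hn.trans ?_
          rw [← ofReal_integral_eq_lintegral_ofReal (hF n) (h0 n)]
          exact ENNReal.ofReal_le_ofReal (hK n)
  have hint : Integrable g μ := by
    refine ⟨hmeas, ?_⟩
    rw [hasFiniteIntegral_iff_ofReal hg0]
    exact hlint.trans_lt ENNReal.ofReal_lt_top
  refine ⟨hint, ?_⟩
  rw [← ofReal_integral_eq_lintegral_ofReal hint hg0] at hlint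
  exact (ENNReal.ofReal_le_ofReal_iff hK0).1 hlint

theorem integral_mul_condExp {m : MeasurableSpace Ω} (hm : m ≤ m0) [SigmaFinite (μ.trim hm)]
    {g B : Ω → ℝ}
    (hg : StronglyMeasurable[m] g) (hB : Integrable B μ) (hgB : Integrable (fun ω => g ω * B ω) μ) :
    ∫ ω, g ω * B ω ∂μ = ∫ ω, g ω * (μ[B | m]) ω ∂μ := by
  rw [← integral_condExp hm (f := fun ω => g ω * B ω)]
  exact integral_congr_ae (condExp_mul_of_stronglyMeasurable_left hg hgB hB)

theorem integrable_mul_condExp {m : MeasurableSpace Ω} {g B : Ω → ℝ}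
    (hg : StronglyMeasurable[m] g) (hB : Integrable B μ) (hgB : Integrable (fun ω => g ω * B ω) μ) :
    Integrable (fun ω => g ω * (μ[B | m]) ω) μ :=
  (integrable_congr (condExp_mul_of_stronglyMeasurable_left hg hgB hB)).1 integrable_condExp

theorem integral_mul_eq_zero_of_condExp {m : MeasurableSpace Ω} (hm : m ≤ m0)
    [SigmaFinite (μ.trim hm)] {g B : Ω → ℝ}
    (hg : StronglyMeasurable[m] g) (hB : Integrable B μ) (hgB : Integrable (fun ω => g ω * B ω) μ)
    (h0 : μ[B | m] =ᵐ[μ] 0) : ∫ ω, g ω * B ω ∂μ = 0 := by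
  rw [integral_mul_condExp hm hg hB hgB]
  refine integral_eq_zero_of_ae ?_
  filter_upwards [h0] with ω h
  simp [h]

/-- If `E[B | m] ≤ r` then `E[g B] ≤ r E[g]` for nonnegative `m`-measurable `g`. -/
theorem CondBound.mul [IsFiniteMeasure μ] {m : MeasurableSpace Ω} (hm : m ≤ m0)
    {g B : Ω → ℝ} {r : ℝ} (hB : @CondBound Ω m0 μ m B r) (hB0 : ∀ ω, 0 ≤ B ω) (hg0 : ∀ ω, 0 ≤ g ω)
    (hg : StronglyMeasurable[m] g) (hgi : Integrable g μ) :
    Integrable (fun ω => g ω * B ω) μ ∧ ∫ ω, g ω * B ω ∂μ ≤ r * ∫ ω, g ω ∂μ := by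
  obtain ⟨hBi, hBr⟩ := hB
  -- Integrability of `g B` is part of the claim, so the pull-out property is applied to bounded
  -- truncations of `g`, followed by Fatou.
  set gn : ℕ → Ω → ℝ := fun n ω => min (g ω) n with hgn
  have hgnm : ∀ n, StronglyMeasurable[m] (gn n) := fun n => hg.inf stronglyMeasurable_const
  have hgn0 : ∀ n ω, 0 ≤ gn n ω := fun n ω => le_min (hg0 ω) n.cast_nonneg
  have hgnB : ∀ n, Integrable (fun ω => gn n ω * B ω) μ := by
    intro n
    refine (hBi.const_mul (n : ℝ)).mono' (((hgnm n).mono hm).aestronglyMeasurable.mul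
      hBi.aestronglyMeasurable) (ae_of_all _ fun ω => ?_)
    rw [Real.norm_eq_abs, abs_of_nonneg (mul_nonneg (hgn0 n ω) (hB0 ω))]
    exact mul_le_mul_of_nonneg_right (min_le_right _ _) (hB0 ω)
  have hgni : ∀ n, Integrable (gn n) μ := fun n =>
    hgi.mono' ((hgnm n).mono hm).aestronglyMeasurable (ae_of_all _ fun ω => by
      rw [Real.norm_eq_abs, abs_of_nonneg (hgn0 n ω)]; exact min_le_left _ _)
  -- The sign of `r` is needed to replace `gn n * r` by `g * r`.
  have hr : (0:ℝ) ≤ r ∨ μ = 0 := by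
    by_cases hμ : μ = 0
    · exact Or.inr hμ
    · left
      have : NeZero μ := ⟨hμ⟩
      have h0 : 0 ≤ᵐ[μ] μ[B | m] := condExp_nonneg (ae_of_all _ hB0)
      obtain ⟨ω, h1, h2⟩ := (h0.and hBr).exists
      exact h1.trans h2
  rcases hr with hr | rfl
  swap
  · simp
  have hbd : ∀ n, ∫ ω, gn n ω * B ω ∂μ ≤ r * ∫ ω, g ω ∂μ := by
    intro n
    rw [integral_mul_condExp hm (hgnm n) hBi (hgnB n), ← integral_const_mul]
    refine integral_mono_ae (integrable_mul_condExp (hgnm n) hBi (hgnB n)) (hgi.const_mul r) ?_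
    filter_upwards [hBr] with ω h
    calc gn n ω * (μ[B | m]) ω ≤ gn n ω * r := mul_le_mul_of_nonneg_left h (hgn0 n ω)
      _ ≤ r * g ω := by rw [mul_comm]; exact mul_le_mul_of_nonneg_left (min_le_left _ _) hr
  have hlim : ∀ ω, Tendsto (fun n => gn n ω * B ω) atTop (𝓝 (g ω * B ω)) := by
    intro ω
    refine Tendsto.mul_const _ (tendsto_const_nhds.congr' ?_)
    filter_upwards [eventually_ge_atTop ⌈g ω⌉₊] with n hn
    exact (min_eq_left ((Nat.le_ceil _).trans (by exact_mod_cast hn))).symm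
  exact integral_le_of_tendsto hgnB (fun n => ae_of_all _ fun ω => mul_nonneg (hgn0 n ω) (hB0 ω))
    hbd (ae_of_all _ hlim)

end ConditionalExpectation

/-! ### Deterministic recursions with summable perturbations. -/

section Sequences

/-- Subtracting the partial sums of `e` turns `u` into a decreasing sequence that is bounded below.
-/
theorem tendsto_of_le_add_summable {u e : ℕ → ℝ} (hu : ∀ k, 0 ≤ u k) (he : ∀ k, 0 ≤ e k)
    (hes : Summable e) (h : ∀ k, u (k + 1) ≤ u k + e k) :
    ∃ l, 0 ≤ l ∧ Tendsto u atTop (𝓝 l) := by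
  set w : ℕ → ℝ := fun k => u k - ∑ j ∈ Finset.range k, e j with hw
  have hanti : Antitone w := antitone_nat_of_succ_le fun k => by
    simp only [hw, Finset.sum_range_succ]; linarith [h k]
  have hbdd : BddBelow (Set.range w) := ⟨-∑' j, e j, by
    rintro _ ⟨k, rfl⟩
    have := hes.sum_le_tsum (Finset.range k) (fun j _ => he j)
    simp only [hw]; linarith [hu k]⟩
  have h1 := (tendsto_atTop_ciInf hanti hbdd).add hes.hasSum.tendsto_sum_nat
  have h2 : (fun k => w k + ∑ j ∈ Finset.range k, e j) = u := by
    funext k; simp [hw]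
  rw [h2] at h1
  exact ⟨_, ge_of_tendsto' h1 hu, h1⟩

/-- The single-step inequality makes the whole sequence converge, so it suffices to identify the
limit along multiples of `h`. Telescoping the block inequality makes `∑ a m * u (m * h)` finite; a
positive limit would then make `a` summable. -/
theorem tendsto_zero_of_block_decay {u e a e' : ℕ → ℝ} {h : ℕ} (hh : 0 < h) (hu : ∀ k, 0 ≤ u k)
    (he : ∀ k, 0 ≤ e k) (hes : Summable e) (hstep : ∀ k, u (k + 1) ≤ u k + e k)
    (ha : ∀ m, 0 ≤ a m) (has : ¬ Summable a) (he' : ∀ m, 0 ≤ e' m) (hes' : Summable e')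
    (hblock : ∀ m, u ((m + 1) * h) ≤ u (m * h) - a m * u (m * h) + e' m) :
    Tendsto u atTop (𝓝 0) := by
  obtain ⟨l, hl0, hl⟩ := tendsto_of_le_add_summable hu he hes hstep
  rcases hl0.eq_or_lt with rfl | hlpos
  · exact hl
  exfalso
  have hsub : Tendsto (fun m => u (m * h)) atTop (𝓝 l) :=
    hl.comp (tendsto_id.atTop_mul_const' hh)
  have hsum : ∀ n, ∑ m ∈ Finset.range n, a m * u (m * h) ≤ u 0 + ∑' m, e' m := by
    intro n
    have h1 : ∑ m ∈ Finset.range n, a m * u (m * h) + u (n * h)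
        ≤ u 0 + ∑ m ∈ Finset.range n, e' m := by
      induction n with
      | zero => simp
      | succ n ih => rw [Finset.sum_range_succ, Finset.sum_range_succ]; linarith [hblock n]
    have h2 := hes'.sum_le_tsum (Finset.range n) (fun j _ => he' j)
    linarith [hu (n * h)]
  have hs : Summable fun m => a m * u (m * h) :=
    summable_of_sum_range_le (fun m => mul_nonneg (ha m) (hu _)) hsum
  -- Eventually `u (m * h) > l / 2`, which explains the factor `2 / l`.
  refine has ((hs.mul_left (2 / l)).of_norm_bounded_eventually_nat ?_)
  filter_upwards [hsub.eventually (lt_mem_nhds (half_lt_self hlpos))] with m hm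
  rw [Real.norm_eq_abs, abs_of_nonneg (ha m)]
  calc a m = 2 / l * (a m * (l / 2)) := by field_simp
    _ ≤ _ := by have := ha m; gcongr

/-- By monotonicity the sum of `c` over a block of length `h` is at most `h` times its first term.
The index `m + 1` matches the gain at the end of a block, which governs the contraction there; a
shift by one does not affect summability. -/
theorem not_summable_block {c : ℕ → ℝ} (hpos : ∀ k, 0 < c k) (hanti : Antitone c)
    (hdiv : Tendsto (fun n => ∑ k ∈ Finset.range n, c k) atTop atTop) {h : ℕ} (hh : 0 < h) :
    ¬ Summable fun m => c ((m + 1) * h) := by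
  intro hs
  have hs' : Summable fun m => c (m * h) := (summable_nat_add_iff 1).1 hs
  have hb : ∀ n, ∑ k ∈ Finset.range (n * h), c k ≤ h * ∑' m, c (m * h) := by
    intro n
    have : ∑ k ∈ Finset.range (n * h), c k ≤ h * ∑ m ∈ Finset.range n, c (m * h) := by
      induction n with
      | zero => simp
      | succ n ih =>
        rw [Nat.succ_mul, Finset.sum_range_add, Finset.sum_range_succ, mul_add]
        refine add_le_add ih ?_
        calc ∑ k ∈ Finset.range h, c (n * h + k) ≤ ∑ _k ∈ Finset.range h, c (n * h) :=
              Finset.sum_le_sum fun k _ => hanti (Nat.le_add_right _ _)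
          _ = h * c (n * h) := by simp
    refine this.trans (mul_le_mul_of_nonneg_left ?_ h.cast_nonneg)
    exact hs'.sum_le_tsum _ fun m _ => (hpos _).le
  obtain ⟨n, hn⟩ := (hdiv.eventually_gt_atTop (h * ∑' m, c (m * h))).exists
  have h1 : ∑ k ∈ Finset.range n, c k ≤ ∑ k ∈ Finset.range (n * h), c k :=
    Finset.sum_le_sum_of_subset_of_nonneg
      (Finset.range_subset_range.2 (Nat.le_mul_of_pos_right n hh)) fun k _ _ => (hpos k).le
  linarith [hb n]

theorem discrete_gronwall {u g : ℕ → ℝ} {p q : ℝ} (hg : ∀ k, 0 ≤ g k) (hgs : Summable g)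
    (hp : 0 ≤ p) (hq : 0 ≤ q) (hu : 0 ≤ u 0)
    (h : ∀ k, u (k + 1) ≤ (1 + g k * p) * u k + g k * q) (k : ℕ) :
    u k ≤ Real.exp ((∑' k, g k) * p) * (u 0 + (∑' k, g k) * q) := by
  have h1 : u k ≤ Real.exp ((∑ j ∈ Finset.range k, g j) * p) *
      (u 0 + (∑ j ∈ Finset.range k, g j) * q) := by
    induction k with
    | zero => simp
    | succ k ih =>
      rw [Finset.sum_range_succ]
      set S := ∑ j ∈ Finset.range k, g j with hS
      have hS0 : 0 ≤ S := Finset.sum_nonneg fun j _ => hg j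
      have hgp : 0 ≤ g k * p := mul_nonneg (hg k) hp
      have hgq : 0 ≤ g k * q := mul_nonneg (hg k) hq
      have e1 : 1 + g k * p ≤ Real.exp (g k * p) := by linarith [Real.add_one_le_exp (g k * p)]
      have e2 : 1 ≤ Real.exp ((S + g k) * p) := Real.one_le_exp (by
        have := hg k; positivity)
      calc u (k + 1) ≤ (1 + g k * p) * u k + g k * q := h k
        _ ≤ (1 + g k * p) * (Real.exp (S * p) * (u 0 + S * q)) + g k * q := by gcongr
        -- The additive term is multiplied by an exponential that is at least 1, so that a common
        -- exponential factors out.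
        _ ≤ Real.exp (g k * p) * (Real.exp (S * p) * (u 0 + S * q))
            + Real.exp ((S + g k) * p) * (g k * q) := by
          refine add_le_add (mul_le_mul_of_nonneg_right e1 (by positivity)) ?_
          exact le_mul_of_one_le_left hgq e2
        _ = _ := by rw [add_mul, Real.exp_add]; ring
  refine h1.trans ?_
  have h2 := hgs.sum_le_tsum (Finset.range k) (fun j _ => hg j)
  have h3 : 0 ≤ ∑ j ∈ Finset.range k, g j := Finset.sum_nonneg fun j _ => hg j
  gcongr

end Sequences

/-! ### Almost supermartingales and square-integrable martingales. -/

section Martingales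

variable {Ω : Type*} {m0 : MeasurableSpace Ω} {μ : Measure Ω}

theorem integral_tsum_ae_summable {r : ℕ → Ω → ℝ} (hr : ∀ k, Integrable (r k) μ)
    (hr0 : ∀ k ω, 0 ≤ r k ω) (hs : Summable fun k => ∫ ω, r k ω ∂μ) :
    ∀ᵐ ω ∂μ, Summable fun k => r k ω := by
  have h1 : ∫⁻ ω, ∑' k, ENNReal.ofReal (r k ω) ∂μ ≠ ⊤ := by
    rw [lintegral_tsum fun k => (hr k).aestronglyMeasurable.aemeasurable.ennreal_ofReal]
    simp_rw [fun k => (ofReal_integral_eq_lintegral_ofReal (hr k) (ae_of_all _ (hr0 k))).symm]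
    rw [← ENNReal.ofReal_tsum_of_nonneg (fun k => integral_nonneg (hr0 k)) hs]
    exact ENNReal.ofReal_ne_top
  have h2 := ae_lt_top' (AEMeasurable.tsum fun k =>
    (hr k).aestronglyMeasurable.aemeasurable.ennreal_ofReal) h1
  filter_upwards [h2] with ω hω
  have := ENNReal.summable_toReal hω.ne
  exact this.congr fun k => ENNReal.toReal_ofReal (hr0 k ω)

/-- A nonnegative process that is a supermartingale up to summable nonnegative perturbations, and
whose means vanish, tends to zero almost surely. -/
theorem ae_tendsto_zero_of_almost_supermartingale [IsFiniteMeasure μ] (F : Filtration ℕ m0)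
    {V r : ℕ → Ω → ℝ} (hV : ∀ k, StronglyMeasurable[F k] (V k)) (hVi : ∀ k, Integrable (V k) μ)
    (hV0 : ∀ k ω, 0 ≤ V k ω) (hr : ∀ k, StronglyMeasurable[F k] (r k))
    (hri : ∀ k, Integrable (r k) μ) (hr0 : ∀ k ω, 0 ≤ r k ω)
    (hrs : Summable fun k => ∫ ω, r k ω ∂μ)
    (hstep : ∀ k s, MeasurableSet[F k] s →
      ∫ ω in s, V (k + 1) ω ∂μ ≤ ∫ ω in s, V k ω ∂μ + ∫ ω in s, r k ω ∂μ)
    (hlim : Tendsto (fun k => ∫ ω, V k ω ∂μ) atTop (𝓝 0)) :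
    ∀ᵐ ω ∂μ, Tendsto (fun k => V k ω) atTop (𝓝 0) := by
  -- Compensating by the accumulated perturbations gives an exact submartingale. It is bounded in
  -- `L¹` by `∑ E r + sup E V`, so Doob's theorem applies, and since `∑ r` converges almost surely,
  -- so does `V`.
  set U : ℕ → Ω → ℝ := fun k ω => ∑ j ∈ Finset.range k, r j ω - V k ω with hU
  have hsumi : ∀ k, Integrable (fun ω => ∑ j ∈ Finset.range k, r j ω) μ := fun k =>
    integrable_finsetSum _ fun j _ => hri j
  have hUi : ∀ k, Integrable (U k) μ := fun k => (hsumi k).sub (hVi k)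
  have hsub : Submartingale U F μ := by
    refine submartingale_of_setIntegral_le_succ (fun k => ?_) hUi fun k s hs => ?_
    · refine StronglyMeasurable.sub ?_ (hV k)
      refine Finset.stronglyMeasurable_fun_sum _ fun j hj => ?_
      exact (hr j).mono (F.mono (Finset.mem_range.1 hj).le)
    · simp only [hU]
      rw [integral_sub (hsumi k).integrableOn (hVi k).integrableOn,
        integral_sub (hsumi (k + 1)).integrableOn (hVi (k + 1)).integrableOn]
      simp_rw [Finset.sum_range_succ]
      rw [integral_add (hsumi k).integrableOn (hri k).integrableOn]
      linarith [hstep k s hs]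
  obtain ⟨M, hM⟩ := hlim.bddAbove_range
  have hbdd : ∀ k, eLpNorm (U k) 1 μ ≤ (Real.toNNReal (∑' j, ∫ ω, r j ω ∂μ + M) : NNReal) := by
    intro k
    rw [eLpNorm_one_eq_lintegral_enorm, ← ofReal_integral_norm_eq_lintegral_enorm (hUi k)]
    refine ENNReal.ofReal_le_ofReal ?_
    calc ∫ ω, ‖U k ω‖ ∂μ ≤ ∫ ω, (∑ j ∈ Finset.range k, r j ω + V k ω) ∂μ := by
          refine integral_mono (hUi k).norm ((hsumi k).add (hVi k)) fun ω => ?_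
          simp only [hU, Real.norm_eq_abs]
          have := Finset.sum_nonneg fun j (_ : j ∈ Finset.range k) => hr0 j ω
          rw [abs_le]; constructor <;> linarith [hV0 k ω]
      _ = ∑ j ∈ Finset.range k, ∫ ω, r j ω ∂μ + ∫ ω, V k ω ∂μ := by
          rw [integral_add (hsumi k) (hVi k), integral_finsetSum _ fun j _ => hri j]
      _ ≤ _ := add_le_add (hrs.sum_le_tsum _ fun j _ => integral_nonneg (hr0 j))
          (hM ⟨k, rfl⟩)
  have hVlim : ∀ᵐ ω ∂μ, ∃ l, Tendsto (fun k => V k ω) atTop (𝓝 l) := by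
    filter_upwards [hsub.ae_tendsto_limitProcess hbdd, integral_tsum_ae_summable hri hr0 hrs]
      with ω h1 h2
    refine ⟨_, (h2.hasSum.tendsto_sum_nat.sub h1).congr fun k => ?_⟩
    simp [hU]
  have hW : ∀ᵐ ω ∂μ, Tendsto (fun k => V k ω) atTop (𝓝 (limUnder atTop fun k => V k ω)) := by
    filter_upwards [hVlim] with ω h using tendsto_nhds_limUnder h
  -- Fatou along a tail on which `E V < ε`: the nonnegative limit has mean zero and thus vanishes
  -- almost surely.
  have hfat : ∀ ε > 0, ∫ ω, (limUnder atTop fun k => V k ω) ∂μ ≤ ε := by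
    intro ε hε
    obtain ⟨K, hK⟩ := (hlim.eventually (gt_mem_nhds hε)).exists_forall_of_atTop
    refine (integral_le_of_tendsto (F := fun n => V (n + K)) (fun n => hVi _)
      (fun n => ae_of_all _ (hV0 _)) (fun n => (hK _ (Nat.le_add_left _ _)).le) ?_).2
    filter_upwards [hW] with ω h using h.comp (tendsto_add_atTop_nat K)
  have hL0 : 0 ≤ᵐ[μ] fun ω => limUnder atTop fun k => V k ω := by
    filter_upwards [hW] with ω h using ge_of_tendsto' h fun k => hV0 k ω
  obtain ⟨K, hK⟩ := (hlim.eventually (gt_mem_nhds one_pos)).exists_forall_of_atTop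
  have hLi : Integrable (fun ω => limUnder atTop fun k => V k ω) μ :=
    (integral_le_of_tendsto (F := fun n => V (n + K)) (fun n => hVi _)
      (fun n => ae_of_all _ (hV0 _)) (fun n => (hK _ (Nat.le_add_left _ _)).le) (by
        filter_upwards [hW] with ω h using h.comp (tendsto_add_atTop_nat K))).1
  have hzero : ∫ ω, (limUnder atTop fun k => V k ω) ∂μ = 0 :=
    le_antisymm (le_of_forall_pos_le_add fun ε hε => by simpa using hfat ε hε)
      (integral_nonneg_of_ae hL0)
  have := (integral_eq_zero_iff_of_nonneg_ae hL0 hLi).1 hzero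
  filter_upwards [hW, this] with ω h1 h2
  simpa [h2] using h1

/-- Convergence of a square-integrable martingale with summable mean squared increments, together
with the resulting bound on the variance of its limit. -/
theorem exists_limit_of_square_integrable_martingale [IsProbabilityMeasure μ] (F : Filtration ℕ m0)
    {M : ℕ → Ω → ℝ} {v : ℕ → ℝ} {a : ℝ} (hM : ∀ k, StronglyMeasurable[F k] (M k))
    (hM0 : ∀ ω, M 0 ω = a) (hM2 : ∀ k, MemLp (M k) 2 μ)
    (horth : ∀ k (Z : Ω → ℝ), StronglyMeasurable[F k] Z → MemLp Z 2 μ →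
      ∫ ω, Z ω * (M (k + 1) ω - M k ω) ∂μ = 0)
    (hv : ∀ k, ∫ ω, (M (k + 1) ω - M k ω) ^ 2 ∂μ ≤ v k) (hvs : Summable v) :
    ∃ X : Ω → ℝ, Measurable X ∧ MemLp X 2 μ ∧
      (∀ᵐ ω ∂μ, Tendsto (fun k => M k ω) atTop (𝓝 (X ω))) ∧
      Tendsto (fun k => ∫ ω, (M k ω - X ω) ^ 2 ∂μ) atTop (𝓝 0) ∧
      ∫ ω, X ω ∂μ = a ∧ variance X μ ≤ ∑' k, v k := by
  have hv0 : ∀ k, 0 ≤ v k := fun k => (integral_nonneg fun ω => sq_nonneg _).trans (hv k)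
  have hd2 : ∀ k l, MemLp (fun ω => M k ω - M l ω) 2 μ := fun k l => (hM2 k).sub (hM2 l)
  have hMi : ∀ k, Integrable (M k) μ := fun k => (hM2 k).integrable one_le_two
  have hsub : Submartingale M F μ := by
    refine submartingale_of_setIntegral_le_succ hM hMi fun k s hs => ?_
    have h1 := horth k (s.indicator fun _ => 1) (stronglyMeasurable_const.indicator hs)
      ((memLp_const 1).indicator (F.le k _ hs))
    have h2 : (fun ω => s.indicator (fun _ => (1:ℝ)) ω * (M (k + 1) ω - M k ω))
        = s.indicator fun ω => M (k + 1) ω - M k ω := by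
      funext ω; by_cases h : ω ∈ s <;> simp [h]
    rw [h2, integral_indicator (F.le k _ hs), integral_sub (hMi _).integrableOn
      (hMi _).integrableOn] at h1
    linarith
  -- Pythagoras: each increment is orthogonal to the square-integrable past.
  have hinc : ∀ k n, ∫ ω, (M (k + n) ω - M k ω) ^ 2 ∂μ ≤ ∑ j ∈ Finset.range n, v (k + j) := by
    intro k n
    induction n with
    | zero => simp
    | succ n ih =>
      have e : ∀ ω, (M (k + (n + 1)) ω - M k ω) ^ 2 = ((M (k + n) ω - M k ω) ^ 2
          + 2 * ((M (k + n) ω - M k ω) * (M (k + n + 1) ω - M (k + n) ω)))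
          + (M (k + n + 1) ω - M (k + n) ω) ^ 2 := fun ω => by
        rw [← add_assoc]; ring
      simp_rw [e]
      have i1 := (hd2 (k + n) k).integrable_sq
      have i2 := ((hd2 (k + n) k).integrable_mul (hd2 (k + n + 1) (k + n))).const_mul 2
      have i3 := (hd2 (k + n + 1) (k + n)).integrable_sq
      have i4 := horth (k + n) (fun ω => M (k + n) ω - M k ω)
        ((hM _).sub ((hM k).mono (F.mono (Nat.le_add_right _ _)))) (hd2 _ _)
      rw [integral_add (by exact i1.add i2) i3, integral_add i1 (by exact i2),
        integral_const_mul, i4,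
        Finset.sum_range_succ]
      linarith [hv (k + n)]
  have hinc' : ∀ k n, ∫ ω, (M (n + k) ω - M k ω) ^ 2 ∂μ ≤ ∑' j, v (k + j) := fun k n => by
    rw [add_comm n k]
    refine (hinc k n).trans (Summable.sum_le_tsum _ (fun j _ => hv0 _) ?_)
    simpa [add_comm] using (summable_nat_add_iff k).2 hvs
  -- The constant comes from `|x| ≤ 1 + x² ≤ 1 + 2 (a² + (x - a)²)`.
  have hbdd : ∀ k, eLpNorm (M k) 1 μ ≤ (Real.toNNReal (1 + 2 * (a ^ 2 + ∑' j, v j)) : NNReal) := by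
    intro k
    rw [eLpNorm_one_eq_lintegral_enorm, ← ofReal_integral_norm_eq_lintegral_enorm (hMi k)]
    refine ENNReal.ofReal_le_ofReal ?_
    have i1 : Integrable (fun ω => 1 + 2 * (a ^ 2 + (M (k + 0) ω - M 0 ω) ^ 2)) μ :=
      (integrable_const _).add (((integrable_const _).add (hd2 _ _).integrable_sq).const_mul 2)
    calc ∫ ω, ‖M k ω‖ ∂μ ≤ ∫ ω, (1 + 2 * (a ^ 2 + (M (k + 0) ω - M 0 ω) ^ 2)) ∂μ := by
          refine integral_mono (hMi k).norm i1 fun ω => ?_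
          simp only [hM0, add_zero, Real.norm_eq_abs]
          rw [abs_le]
          constructor <;> nlinarith [sq_nonneg (M k ω - 2 * a), sq_nonneg (M k ω - 1),
            sq_nonneg (M k ω + 1)]
      _ = 1 + 2 * (a ^ 2 + ∫ ω, (M (k + 0) ω - M 0 ω) ^ 2 ∂μ) := by
          rw [integral_add (integrable_const _)
            (by exact ((integrable_const _).add (hd2 _ _).integrable_sq).const_mul 2),
            integral_const_mul,
            integral_add (integrable_const _) (hd2 _ _).integrable_sq]
          simp
      _ ≤ _ := by
          have := hinc' 0 k
          simp only [zero_add, add_zero] at this ⊢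
          linarith
  set X := Filtration.limitProcess M F μ with hX
  have hXm : Measurable X := Filtration.stronglyMeasurable_limit_process'.measurable
  have hlim := hsub.ae_tendsto_limitProcess hbdd
  -- Fatou transfers the increment bound to the limit. The tails of `∑ v` give mean square
  -- convergence, and `k = 0` gives the variance bound because `M 0` is the constant `a = E X`.
  have hfat : ∀ k, Integrable (fun ω => (X ω - M k ω) ^ 2) μ ∧
      ∫ ω, (X ω - M k ω) ^ 2 ∂μ ≤ ∑' j, v (k + j) := fun k => by
    refine integral_le_of_tendsto (F := fun n ω => (M (n + k) ω - M k ω) ^ 2)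
      (fun n => (hd2 _ _).integrable_sq) (fun n => ae_of_all _ fun ω => sq_nonneg _)
      (hinc' k) ?_
    filter_upwards [hlim] with ω h
    exact ((h.comp (tendsto_add_atTop_nat k)).sub_const _).pow 2
  have hX2 : MemLp X 2 μ := by
    have h1 : MemLp (fun ω => X ω - M 0 ω) 2 μ :=
      (memLp_two_iff_integrable_sq (hXm.aestronglyMeasurable.sub
        (hM2 0).aestronglyMeasurable)).2 (hfat 0).1
    exact (h1.add (hM2 0)).congr_norm hXm.aestronglyMeasurable (ae_of_all _ fun ω => by simp)
  have hL2 : Tendsto (fun k => ∫ ω, (M k ω - X ω) ^ 2 ∂μ) atTop (𝓝 0) := by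
    refine squeeze_zero (fun k => integral_nonneg fun ω => sq_nonneg _) (fun k => ?_)
      (tendsto_sum_nat_add v)
    have := (hfat k).2
    simp_rw [fun ω => sub_sq_comm (M k ω) (X ω), fun j => add_comm j k]
    exact this
  have hXi := hX2.integrable one_le_two
  have hEM : ∀ k, ∫ ω, M k ω ∂μ = a := by
    intro k
    induction k with
    | zero => simp [hM0]
    | succ k ih =>
      have := horth k (fun _ => 1) stronglyMeasurable_const (memLp_const 1)
      simp only [one_mul] at this
      rw [integral_sub (hMi _) (hMi _)] at this
      linarith
  have hEX : ∫ ω, X ω ∂μ = a := by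
    -- Nonnegativity of the variance of `M k - X`, whose mean is `a - E X`.
    have hb : ∀ k, (∫ ω, X ω ∂μ - a) ^ 2 ≤ ∫ ω, (M k ω - X ω) ^ 2 ∂μ := by
      intro k
      have h1 := variance_nonneg (M k - X) μ
      rw [variance_eq_sub ((hM2 k).sub hX2)] at h1
      have h2 : ∫ ω, (M k ω - X ω) ∂μ = a - ∫ ω, X ω ∂μ := by
        rw [integral_sub (hMi k) hXi, hEM]
      simp only [Pi.pow_apply, Pi.sub_apply, h2] at h1
      linarith [sub_sq_comm a (∫ ω, X ω ∂μ)]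
    have h0 : (∫ ω, X ω ∂μ - a) ^ 2 ≤ 0 := ge_of_tendsto' hL2 hb
    have := pow_eq_zero_iff (two_ne_zero) |>.1 (le_antisymm h0 (sq_nonneg _))
    linarith
  refine ⟨X, hXm, hX2, hlim, hL2, hEX, ?_⟩
  rw [variance_eq_integral hXm.aemeasurable, hEX]
  have := (hfat 0).2
  simpa [hM0] using this

end Martingales

/-! ### Pathwise algebra and inequalities. -/

section Algebra

variable {N : ℕ}

theorem sqNorm_nonneg (x : Fin N → ℝ) : 0 ≤ sqNorm x := Finset.sum_nonneg fun _ _ => sq_nonneg _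

theorem sq_le_sqNorm (x : Fin N → ℝ) (i : Fin N) : x i ^ 2 ≤ sqNorm x :=
  Finset.single_le_sum (f := fun i => x i ^ 2) (fun _ _ => sq_nonneg _) (Finset.mem_univ i)

theorem sqNorm_eq_norm_sq (x : Fin N → ℝ) : sqNorm x = ‖WithLp.toLp 2 x‖ ^ 2 := by
  rw [EuclideanSpace.norm_sq_eq]; simp [sqNorm]

theorem sqNorm_add_le (x y : Fin N → ℝ) : sqNorm (x + y) ≤ 2 * sqNorm x + 2 * sqNorm y := by
  simp only [sqNorm, Finset.mul_sum, ← Finset.sum_add_distrib]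
  exact Finset.sum_le_sum fun i _ => by
    simp only [Pi.add_apply]; nlinarith [sq_nonneg (x i - y i)]

theorem sqNorm_smul (r : ℝ) (x : Fin N → ℝ) : sqNorm (r • x) = r ^ 2 * sqNorm x := by
  simp only [sqNorm, Finset.mul_sum, Pi.smul_apply, smul_eq_mul, mul_pow]

/-! #### The consensus error -/

/-- The average of a state vector. -/
noncomputable def mean (x : Fin N → ℝ) : ℝ := (1 / (N : ℝ)) * ∑ j, x j

theorem consErr_apply (x : Fin N → ℝ) (i : Fin N) : consErr x i = x i - mean x := by
  rw [consErr, Matrix.sub_mulVec, Matrix.one_mulVec, Matrix.smul_mulVec]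
  simp [Matrix.mulVec, dotProduct, mean]

theorem consErr_sub (x y : Fin N → ℝ) : consErr (x - y) = consErr x - consErr y := by
  simp [consErr, Matrix.mulVec_sub]

theorem sum_eq_mul_mean (hN : 0 < N) (x : Fin N → ℝ) : ∑ i, x i = N * mean x := by
  have : (N : ℝ) ≠ 0 := by positivity
  simp only [mean]; field_simp

theorem sum_consErr (hN : 0 < N) (x : Fin N → ℝ) : ∑ i, consErr x i = 0 := by
  simp_rw [consErr_apply]
  rw [Finset.sum_sub_distrib, sum_eq_mul_mean hN]
  simp

theorem energy_nonneg (x : Fin N → ℝ) : 0 ≤ energy x := sqNorm_nonneg _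

theorem energy_le_sqNorm (hN : 0 < N) (x : Fin N → ℝ) : energy x ≤ sqNorm x := by
  have : energy x = sqNorm x - N * mean x ^ 2 := by
    have h1 : ∀ i, consErr x i ^ 2 = x i ^ 2 - 2 * mean x * x i + mean x ^ 2 := fun i => by
      rw [consErr_apply]; ring
    simp_rw [energy, sqNorm, h1]
    rw [Finset.sum_add_distrib, Finset.sum_sub_distrib, ← Finset.mul_sum, sum_eq_mul_mean hN x]
    simp only [Finset.sum_const, Finset.card_univ, Fintype.card_fin, nsmul_eq_mul]
    ring
  rw [this]
  have : (0:ℝ) ≤ N * mean x ^ 2 := by positivity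
  linarith

theorem mean_add_const (hN : 0 < N) (x : Fin N → ℝ) (r : ℝ) : mean (fun i => x i + r) = mean x + r := by
  have : (N : ℝ) ≠ 0 := by positivity
  simp only [mean, Finset.sum_add_distrib, Finset.sum_const, Finset.card_univ, Fintype.card_fin,
    nsmul_eq_mul]
  field_simp

theorem energy_add_const (hN : 0 < N) (x : Fin N → ℝ) (r : ℝ) :
    energy (fun i => x i + r) = energy x := by
  simp [energy, sqNorm, consErr_apply, mean_add_const hN]

theorem energy_consErr (hN : 0 < N) (x : Fin N → ℝ) : energy (consErr x) = energy x := by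
  have : consErr x = fun i => x i + -mean x := by
    funext i; rw [consErr_apply]; ring
  rw [this, energy_add_const hN]

theorem sqNorm_consErr (x : Fin N → ℝ) : sqNorm (consErr x) = energy x := rfl

/-! #### The Laplacian -/

/-- The action of the Laplacian on a vector. -/
def lapMul (A : Fin N → Fin N → ℝ) (y : Fin N → ℝ) (i : Fin N) : ℝ := ∑ j, A i j * (y i - y j)

theorem lap_mulVec (A : Fin N → Fin N → ℝ) (y : Fin N → ℝ) : (lap A).mulVec y = lapMul A y := by
  funext i
  simp only [lap, Matrix.sub_mulVec, Pi.sub_apply, Matrix.mulVec_diagonal, lapMul, degIn,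
    mul_sub, Finset.sum_sub_distrib, Finset.sum_mul]
  rfl

theorem sqNorm_mulVec_le (M : Matrix (Fin N) (Fin N) ℝ) (y : Fin N → ℝ) :
    sqNorm (M.mulVec y) ≤ norm2 M ^ 2 * sqNorm y := by
  rw [sqNorm_eq_norm_sq, sqNorm_eq_norm_sq, ← Matrix.toEuclideanCLM_toLp, ← mul_pow]
  exact pow_le_pow_left₀ (norm_nonneg _) (ContinuousLinearMap.le_opNorm _ _) 2

theorem sqNorm_lapMul_le (A : Fin N → Fin N → ℝ) (y : Fin N → ℝ) :
    sqNorm (lapMul A y) ≤ norm2 (lap A) ^ 2 * sqNorm y := by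
  rw [← lap_mulVec]; exact sqNorm_mulVec_le _ _

theorem entry_sq_le (M : Matrix (Fin N) (Fin N) ℝ) (i j : Fin N) : M i j ^ 2 ≤ norm2 M ^ 2 := by
  have h := (sq_le_sqNorm _ i).trans (sqNorm_mulVec_le M (Pi.single j 1))
  have h1 : sqNorm (Pi.single j 1 : Fin N → ℝ) = 1 := by
    simp [sqNorm, Pi.single_apply]
  simpa [h1] using h

theorem weight_sq_le {A : Fin N → Fin N → ℝ} (h0 : ∀ i, A i i = 0) (i j : Fin N) :
    A i j ^ 2 ≤ norm2 (lap A) ^ 2 := by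
  by_cases h : i = j
  · subst h; rw [h0]; simpa using sq_nonneg (norm2 (lap A))
  · have := entry_sq_le (lap A) i j
    simpa [lap, Matrix.diagonal_apply_ne _ h] using this

/-- The quadratic form of the Laplacian. -/
def lapForm (A : Fin N → Fin N → ℝ) (y : Fin N → ℝ) : ℝ := ∑ i, y i * lapMul A y i

theorem lapForm_eq_sum (A : Fin N → Fin N → ℝ) (y : Fin N → ℝ) :
    lapForm A y = ∑ i, ∑ j, y i * (y i - y j) * A i j := by
  simp only [lapForm, lapMul, Finset.mul_sum]
  exact Finset.sum_congr rfl fun i _ => Finset.sum_congr rfl fun j _ => by ring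

/-- Balance makes the two diagonal sums `∑ aᵢⱼ yᵢ²` and `∑ aᵢⱼ yⱼ²` equal, so that twice the form is
`∑ aᵢⱼ (yᵢ - yⱼ)²`. It will be applied to conditional weights only. -/
theorem lapForm_nonneg {A : Fin N → Fin N → ℝ} (h0 : ∀ i j, 0 ≤ A i j) (hb : IsBalanced A)
    (y : Fin N → ℝ) : 0 ≤ lapForm A y := by
  have h1 : ∑ i, ∑ j, A i j * y i ^ 2 = ∑ i, ∑ j, A i j * y j ^ 2 := by
    rw [Finset.sum_comm (f := fun i j => A i j * y j ^ 2)]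
    simp_rw [← Finset.sum_mul]
    exact Finset.sum_congr rfl fun i _ => by rw [show ∑ j, A i j = ∑ j, A j i from hb i]
  have h2 : 2 * lapForm A y = ∑ i, ∑ j, A i j * (y i - y j) ^ 2 := by
    have : ∀ i j, A i j * (y i - y j) ^ 2 =
        2 * (y i * (y i - y j) * A i j) + (A i j * y j ^ 2 - A i j * y i ^ 2) := fun i j => by ring
    simp_rw [this, Finset.sum_add_distrib, Finset.sum_sub_distrib, h1, ← Finset.mul_sum,
      lapForm_eq_sum]
    ring
  have h3 : 0 ≤ ∑ i, ∑ j, A i j * (y i - y j) ^ 2 :=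
    Finset.sum_nonneg fun i _ => Finset.sum_nonneg fun j _ => mul_nonneg (h0 i j) (sq_nonneg _)
  linarith

theorem symLap_apply (A : Fin N → Fin N → ℝ) (i j : Fin N) :
    symLap A i j = (1 / 2) * (lap A i j + lap A j i) := by
  simp [symLap]

theorem lapForm_eq_symLap (A : Fin N → Fin N → ℝ) (y : Fin N → ℝ) :
    lapForm A y = ∑ i, ∑ j, y i * y j * symLap A i j := by
  have h1 : lapForm A y = ∑ i, ∑ j, y i * y j * lap A i j := by
    simp only [lapForm, ← lap_mulVec, Matrix.mulVec, dotProduct, Finset.mul_sum]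
    exact Finset.sum_congr rfl fun i _ => Finset.sum_congr rfl fun j _ => by ring
  have h2 : lapForm A y = ∑ i, ∑ j, y i * y j * lap A j i := by
    rw [h1, Finset.sum_comm]
    exact Finset.sum_congr rfl fun i _ => Finset.sum_congr rfl fun j _ => by ring
  have h3 : ∑ i, ∑ j, y i * y j * symLap A i j
      = (1 / 2) * (∑ i, ∑ j, y i * y j * lap A i j + ∑ i, ∑ j, y i * y j * lap A j i) := by
    simp only [symLap_apply, mul_add, Finset.mul_sum, ← Finset.sum_add_distrib]
    exact Finset.sum_congr rfl fun i _ => Finset.sum_congr rfl fun j _ => by ring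
  rw [h3, ← h1, ← h2]; ring

theorem abs_lapForm_le (A : Fin N → Fin N → ℝ) (y : Fin N → ℝ) :
    |lapForm A y| ≤ (1 + norm2 (lap A) ^ 2) * sqNorm y := by
  have h1 : |lapForm A y| ≤ sqNorm y + sqNorm (lapMul A y) := by
    simp only [lapForm, sqNorm, ← Finset.sum_add_distrib]
    refine (Finset.abs_sum_le_sum_abs _ _).trans (Finset.sum_le_sum fun i _ => ?_)
    rw [abs_le]
    constructor <;> nlinarith [sq_nonneg (y i - lapMul A y i), sq_nonneg (y i + lapMul A y i)]
  have := sqNorm_lapMul_le A y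
  linarith

theorem lapMul_sub (A : Fin N → Fin N → ℝ) (u v : Fin N → ℝ) (i : Fin N) :
    lapMul A (u - v) i = lapMul A u i - lapMul A v i := by
  simp only [lapMul, Pi.sub_apply, ← Finset.sum_sub_distrib]
  exact Finset.sum_congr rfl fun j _ => by ring

theorem lapMul_add (A : Fin N → Fin N → ℝ) (u v : Fin N → ℝ) (i : Fin N) :
    lapMul A (u + v) i = lapMul A u i + lapMul A v i := by
  simp only [lapMul, Pi.add_apply, ← Finset.sum_add_distrib]
  exact Finset.sum_congr rfl fun j _ => by ring

/-- An identity is needed here because a single form may be indefinite; signs are used only after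
integration. -/
theorem lapForm_parallelogram (A : Fin N → Fin N → ℝ) (u v : Fin N → ℝ) :
    lapForm A (u + v) + lapForm A (u - v) = 2 * lapForm A u + 2 * lapForm A v := by
  simp only [lapForm, lapMul_add, lapMul_sub, Pi.add_apply, Pi.sub_apply, Finset.mul_sum,
    ← Finset.sum_add_distrib]
  exact Finset.sum_congr rfl fun i _ => by ring

/-- The source of the drift of the average: it vanishes for a balanced digraph. -/
theorem sum_lapMul (A : Fin N → Fin N → ℝ) (y : Fin N → ℝ) :
    ∑ i, lapMul A y i = ∑ i, y i * (degIn A i - degOut A i) := by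
  simp only [lapMul, mul_sub, Finset.sum_sub_distrib, degIn, degOut, Finset.mul_sum]
  rw [Finset.sum_comm (f := fun i j => A i j * y j)]
  simp only [mul_comm]

theorem sum_lap_col (A : Fin N → Fin N → ℝ) (i : Fin N) :
    ∑ j, lap A j i = degIn A i - degOut A i := by
  simp [lap, Matrix.diagonal_apply, Finset.sum_sub_distrib, degOut]

theorem sum_lap_row (A : Fin N → Fin N → ℝ) (i : Fin N) : ∑ j, lap A i j = 0 := by
  simp [lap, Matrix.diagonal_apply, Finset.sum_sub_distrib, degIn]

theorem sum_symLap_row (A : Fin N → Fin N → ℝ) (i : Fin N) :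
    ∑ j, symLap A i j = (1 / 2) * (degIn A i - degOut A i) := by
  simp only [symLap_apply, ← Finset.mul_sum, Finset.sum_add_distrib, sum_lap_col, sum_lap_row]
  ring

theorem imbalance_sq_le (A : Fin N → Fin N → ℝ) (i : Fin N) :
    (degIn A i - degOut A i) ^ 2 ≤ (N : ℝ) ^ 2 * norm2 (lap A) ^ 2 := by
  rw [← sum_lap_col]
  calc (∑ j, lap A j i) ^ 2 ≤ N * ∑ j, lap A j i ^ 2 := by
        simpa using sq_sum_le_card_mul_sum_sq (s := Finset.univ) (f := fun j => lap A j i)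
    _ ≤ N * ∑ _j : Fin N, norm2 (lap A) ^ 2 := by
        exact mul_le_mul_of_nonneg_left (Finset.sum_le_sum fun _ _ => entry_sq_le _ _ _)
          N.cast_nonneg
    _ = _ := by simp; ring

/-! #### Edge weights -/

/-- The number of edges times the largest squared weight. -/
noncomputable def edgeWeight (A : Fin N → Fin N → ℝ) : ℝ := edgeCount A * ⨆ p : Fin N × Fin N, A p.1 p.2 ^ 2

theorem edgeCount_eq_sum (A : Fin N → Fin N → ℝ) :
    (edgeCount A : ℝ) = ∑ p : Fin N × Fin N, if A p.1 p.2 = 0 then 0 else 1 := by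
  classical
  rw [edgeCount, Nat.card_eq_fintype_card, Fintype.card_subtype, Finset.card_filter]
  push_cast
  exact Finset.sum_congr rfl fun p _ => by by_cases h : A p.1 p.2 = 0 <;> simp [h]

/-- Only edges contribute to the sum, each by at most the largest squared weight. Through this bound
`ρ₁` enters all noise estimates. -/
theorem sum_sq_le_edgeWeight (A : Fin N → Fin N → ℝ) :
    ∑ i, ∑ j, A i j ^ 2 ≤ edgeWeight A := by
  rw [edgeWeight, edgeCount_eq_sum, Finset.sum_mul,
    ← Fintype.sum_prod_type' (f := fun i j => A i j ^ 2)]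
  refine Finset.sum_le_sum fun p _ => ?_
  by_cases h : A p.1 p.2 = 0
  · simp [h]
  · rw [if_neg h, one_mul]
    exact le_ciSup (f := fun p : Fin N × Fin N => A p.1 p.2 ^ 2) (Set.finite_range _).bddAbove p

theorem edgeWeight_nonneg (A : Fin N → Fin N → ℝ) : 0 ≤ edgeWeight A :=
  (Finset.sum_nonneg fun _ _ => Finset.sum_nonneg fun _ _ => sq_nonneg _).trans
    (sum_sq_le_edgeWeight A)

theorem weight_sq_le_edgeWeight (A : Fin N → Fin N → ℝ) (i j : Fin N) :
    A i j ^ 2 ≤ edgeWeight A := by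
  refine le_trans ?_ (sum_sq_le_edgeWeight A)
  refine (Finset.single_le_sum (f := fun j => A i j ^ 2) (fun _ _ => sq_nonneg _)
    (Finset.mem_univ j)).trans ?_
  exact Finset.single_le_sum (f := fun i => ∑ j, A i j ^ 2)
    (fun _ _ => Finset.sum_nonneg fun _ _ => sq_nonneg _) (Finset.mem_univ i)

theorem edgeWeight_le {A : Fin N → Fin N → ℝ} (h0 : ∀ i, A i i = 0) :
    edgeWeight A ≤ (N : ℝ) ^ 2 * norm2 (lap A) ^ 2 := by
  refine mul_le_mul ?_ (Real.iSup_le (fun p => weight_sq_le h0 _ _) (sq_nonneg _))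
    (Real.iSup_nonneg fun p => sq_nonneg _) (by positivity)
  rw [edgeCount_eq_sum]
  calc _ ≤ ∑ _p : Fin N × Fin N, (1:ℝ) := Finset.sum_le_sum fun p _ => by split_ifs <;> norm_num
    _ = _ := by simp; ring

/-! #### One step of the algorithm -/

/-- The sum of all squared noises. -/
def noiseSq (ξ : Fin N → Fin N → ℝ) : ℝ := ∑ j, ∑ i, ξ j i ^ 2

theorem noiseSq_nonneg (ξ : Fin N → Fin N → ℝ) : 0 ≤ noiseSq ξ :=
  Finset.sum_nonneg fun _ _ => Finset.sum_nonneg fun _ _ => sq_nonneg _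

theorem sq_le_noiseSq (ξ : Fin N → Fin N → ℝ) (j i : Fin N) : ξ j i ^ 2 ≤ noiseSq ξ := by
  refine (Finset.single_le_sum (f := fun i => ξ j i ^ 2) (fun _ _ => sq_nonneg _)
    (Finset.mem_univ i)).trans ?_
  exact Finset.single_le_sum (f := fun j => ∑ i, ξ j i ^ 2)
    (fun _ _ => Finset.sum_nonneg fun _ _ => sq_nonneg _) (Finset.mem_univ j)

/-- The contribution of the measurement noises to a step. -/
def noiseVec (f : Fin N → Fin N → ℝ → ℝ) (A ξ : Fin N → Fin N → ℝ) (y : Fin N → ℝ)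
    (i : Fin N) : ℝ := ∑ j, A i j * f j i (y j - y i) * ξ j i

/-- One step of the algorithm. -/
def step (c : ℝ) (f : Fin N → Fin N → ℝ → ℝ) (A ξ : Fin N → Fin N → ℝ) (y : Fin N → ℝ)
    (i : Fin N) : ℝ := y i - c * lapMul A y i + c * noiseVec f A ξ y i

theorem state_succ {Ω : Type*} (c : ℕ → ℝ) (f : Fin N → Fin N → ℝ → ℝ)
    (A ξ : ℕ → Ω → Fin N → Fin N → ℝ) (x0 : Fin N → ℝ) (k : ℕ) (ω : Ω) :
    state c f A ξ x0 (k + 1) ω = step (c k) f (A k ω) (ξ k ω) (state c f A ξ x0 k ω) := by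
  funext i
  rw [state]
  have h : ∀ g : Fin N → ℝ, ∑ j ∈ nbhd (A k ω) i, A k ω i j * g j = ∑ j, A k ω i j * g j := by
    intro g
    refine Finset.sum_subset (Finset.subset_univ _) fun j _ hj => ?_
    have : A k ω i j = 0 := by simpa [nbhd] using hj
    rw [this, zero_mul]
  rw [h, step, lapMul, noiseVec, sub_add, ← mul_sub, sub_eq_add_neg, ← mul_neg, neg_sub,
    ← Finset.sum_sub_distrib]
  congr 2
  exact Finset.sum_congr rfl fun j _ => by rw [meas]; ring

/-- The dynamics depend on differences of states only, so a step commutes with translations along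
`𝟏`. The energy can therefore be studied as if the step started at the consensus error. -/
theorem step_consErr (c : ℝ) (f : Fin N → Fin N → ℝ → ℝ) (A ξ : Fin N → Fin N → ℝ)
    (y : Fin N → ℝ) : step c f A ξ y = fun i => step c f A ξ (consErr y) i + mean y := by
  funext i
  simp only [step, lapMul, noiseVec, consErr_apply, sub_sub_sub_cancel_right]
  ring

theorem energy_step_le (hN : 0 < N) (c : ℝ) (f : Fin N → Fin N → ℝ → ℝ) (A ξ : Fin N → Fin N → ℝ)
    (y : Fin N → ℝ) : energy (step c f A ξ y) ≤ sqNorm (step c f A ξ (consErr y)) := by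
  rw [step_consErr, energy_add_const hN]; exact energy_le_sqNorm hN _

theorem sqNorm_step (c : ℝ) (f : Fin N → Fin N → ℝ → ℝ) (A ξ : Fin N → Fin N → ℝ)
    (y : Fin N → ℝ) : sqNorm (step c f A ξ y) = sqNorm y - 2 * c * lapForm A y
      + c ^ 2 * sqNorm (lapMul A y) + c ^ 2 * sqNorm (noiseVec f A ξ y)
      + 2 * c * ∑ i, (y i - c * lapMul A y i) * noiseVec f A ξ y i := by
  simp only [sqNorm, lapForm, Finset.mul_sum, ← Finset.sum_add_distrib, ← Finset.sum_sub_distrib]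
  exact Finset.sum_congr rfl fun i _ => by rw [step]; ring

theorem energy_step_sub_le (hN : 0 < N) (c : ℝ) (f : Fin N → Fin N → ℝ → ℝ)
    (A ξ : Fin N → Fin N → ℝ) (y : Fin N → ℝ) :
    energy (step c f A ξ y - y) ≤
      2 * c ^ 2 * (norm2 (lap A) ^ 2 * energy y) + 2 * c ^ 2 * sqNorm (noiseVec f A ξ y) := by
  have h1 : step c f A ξ y - y = (-c) • lapMul A (consErr y) + c • noiseVec f A ξ y := by
    funext i
    simp only [step, lapMul, consErr_apply, sub_sub_sub_cancel_right, Pi.sub_apply, Pi.add_apply,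
      Pi.smul_apply, smul_eq_mul]
    ring
  rw [h1]
  refine (energy_le_sqNorm hN _).trans ((sqNorm_add_le _ _).trans ?_)
  rw [sqNorm_smul, sqNorm_smul, neg_sq]
  have := mul_le_mul_of_nonneg_left (sqNorm_lapMul_le A (consErr y)) (sq_nonneg c)
  rw [sqNorm_consErr] at this
  linarith

theorem mean_step (c : ℝ) (f : Fin N → Fin N → ℝ → ℝ)
    (A ξ : Fin N → Fin N → ℝ) (y : Fin N → ℝ) :
    mean (step c f A ξ y) - mean y = (c / N) *
      (∑ i, noiseVec f A ξ y i - ∑ i, y i * (degIn A i - degOut A i)) := by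
  rw [← sum_lapMul]
  simp only [mean, step, Finset.sum_add_distrib, Finset.sum_sub_distrib, ← Finset.mul_sum]
  ring

theorem mean_step_sq_le (c : ℝ) (f : Fin N → Fin N → ℝ → ℝ)
    (A ξ : Fin N → Fin N → ℝ) (y : Fin N → ℝ) :
    (mean (step c f A ξ y) - mean y) ^ 2 ≤ 2 * c ^ 2 / (N : ℝ) ^ 2 *
      ((∑ i, noiseVec f A ξ y i) ^ 2 + sqNorm y * ∑ i, (degIn A i - degOut A i) ^ 2) := by
  have h1 := Finset.sum_mul_sq_le_sq_mul_sq Finset.univ y fun i => degIn A i - degOut A i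
  have h2 := add_sq_le (a := ∑ i, noiseVec f A ξ y i)
    (b := -∑ i, y i * (degIn A i - degOut A i))
  rw [neg_sq, ← sub_eq_add_neg] at h2
  rw [mean_step, mul_pow, div_pow]
  calc c ^ 2 / (N:ℝ) ^ 2 * _ ≤ c ^ 2 / (N:ℝ) ^ 2 * (2 * ((∑ i, noiseVec f A ξ y i) ^ 2
        + sqNorm y * ∑ i, (degIn A i - degOut A i) ^ 2)) := by
        gcongr
        refine h2.trans ?_
        rw [sqNorm]
        linarith
    _ = _ := by ring

/-- A bound on the squared noise intensities. -/
noncomputable def intensity (s b : ℝ) (y : Fin N → ℝ) : ℝ := 4 * s ^ 2 * energy y + 2 * b ^ 2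

theorem intensity_nonneg (s b : ℝ) (y : Fin N → ℝ) : 0 ≤ intensity s b y := by
  have := energy_nonneg y
  unfold intensity; positivity

theorem le_maxEntry (s : Fin N → Fin N → ℝ) (j i : Fin N) : s j i ≤ maxEntry s :=
  le_ciSup (f := fun p : Fin N × Fin N => s p.1 p.2) (Set.finite_range _).bddAbove (j, i)

/-- A difference of two distinct coordinates satisfies `(yⱼ - yᵢ)² ≤ 2 (δⱼ² + δᵢ²) ≤ 2 V`. A second
factor 2 comes from squaring the sum in the growth bound, whence the constants 4 and 2 in
`intensity`. -/
theorem A1.sq_le {f : Fin N → Fin N → ℝ → ℝ} {σ b : Fin N → Fin N → ℝ} (h : A1 f σ b)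
    (y : Fin N → ℝ) (j i : Fin N) :
    f j i (y j - y i) ^ 2 ≤ intensity (maxEntry σ) (maxEntry b) y := by
  obtain ⟨-, hσ, hb, hf⟩ := h j i
  have h1 : |f j i (y j - y i)| ≤ maxEntry σ * |y j - y i| + maxEntry b :=
    (hf _).trans (add_le_add (mul_le_mul_of_nonneg_right (le_maxEntry σ j i) (abs_nonneg _))
      (le_maxEntry b j i))
  have h2 : (y j - y i) ^ 2 ≤ 2 * energy y := by
    by_cases hij : j = i
    · subst hij; simpa using energy_nonneg y
    have e : y j - y i = consErr y j - consErr y i := by simp [consErr_apply]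
    have h3 : consErr y j ^ 2 + consErr y i ^ 2 ≤ energy y := by
      rw [energy, sqNorm, ← Finset.sum_pair (f := fun i => consErr y i ^ 2) hij]
      exact Finset.sum_le_sum_of_subset_of_nonneg (Finset.subset_univ _)
        fun _ _ _ => sq_nonneg _
    rw [e]
    nlinarith [sq_nonneg (consErr y j + consErr y i)]
  have h3 : f j i (y j - y i) ^ 2 ≤ (maxEntry σ * |y j - y i| + maxEntry b) ^ 2 := by
    rw [← sq_abs (f j i _)]; exact pow_le_pow_left₀ (abs_nonneg _) h1 2
  calc _ ≤ 2 * ((maxEntry σ * |y j - y i|) ^ 2 + maxEntry b ^ 2) := h3.trans add_sq_le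
    _ = 2 * maxEntry σ ^ 2 * (y j - y i) ^ 2 + 2 * maxEntry b ^ 2 := by rw [mul_pow, sq_abs]; ring
    _ ≤ 2 * maxEntry σ ^ 2 * (2 * energy y) + 2 * maxEntry b ^ 2 := by gcongr
    _ = _ := by rw [intensity]; ring

section NoiseBounds

variable {f : Fin N → Fin N → ℝ → ℝ} {y : Fin N → ℝ} {B : ℝ}

theorem noise_term_sq_le (hB : ∀ j i, f j i (y j - y i) ^ 2 ≤ B)
    (A ξ : Fin N → Fin N → ℝ) (i j : Fin N) :
    (A i j * f j i (y j - y i) * ξ j i) ^ 2 ≤ B * edgeWeight A * noiseSq ξ := by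
  have hB0 := (sq_nonneg _).trans (hB j i)
  rw [mul_pow, mul_pow, mul_comm (A i j ^ 2)]
  exact mul_le_mul (mul_le_mul (hB j i) (weight_sq_le_edgeWeight A i j) (sq_nonneg _) hB0)
    (sq_le_noiseSq ξ j i) (sq_nonneg _) (mul_nonneg hB0 (edgeWeight_nonneg A))

/-- Cauchy–Schwarz in each row; the noises of a row are bounded by all noises. -/
theorem sqNorm_noiseVec_le (hB : ∀ j i, f j i (y j - y i) ^ 2 ≤ B)
    (A ξ : Fin N → Fin N → ℝ) : sqNorm (noiseVec f A ξ y) ≤ B * edgeWeight A * noiseSq ξ := by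
  rcases isEmpty_or_nonempty (Fin N) with he | ⟨⟨i0⟩⟩
  · simp [sqNorm, noiseSq]
  have hB0 := (sq_nonneg _).trans (hB i0 i0)
  have h1 : ∀ i, noiseVec f A ξ y i ^ 2 ≤ (B * ∑ j, A i j ^ 2) * noiseSq ξ := by
    intro i
    refine (Finset.sum_mul_sq_le_sq_mul_sq _ _ _).trans ?_
    refine mul_le_mul ?_ ?_ (Finset.sum_nonneg fun _ _ => sq_nonneg _)
      (mul_nonneg hB0 (Finset.sum_nonneg fun _ _ => sq_nonneg _))
    · rw [Finset.mul_sum]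
      refine Finset.sum_le_sum fun j _ => ?_
      rw [mul_pow, mul_comm]
      exact mul_le_mul_of_nonneg_right (hB j i) (sq_nonneg _)
    · refine Finset.sum_le_sum fun j _ => ?_
      exact Finset.single_le_sum (f := fun i => ξ j i ^ 2) (fun _ _ => sq_nonneg _)
        (Finset.mem_univ i)
  calc sqNorm (noiseVec f A ξ y) ≤ ∑ i, (B * ∑ j, A i j ^ 2) * noiseSq ξ :=
        Finset.sum_le_sum fun i _ => h1 i
    _ = B * (∑ i, ∑ j, A i j ^ 2) * noiseSq ξ := by rw [← Finset.sum_mul, ← Finset.mul_sum]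
    _ ≤ _ := by
        have := noiseSq_nonneg ξ
        gcongr
        exact sum_sq_le_edgeWeight A

/-- Cauchy–Schwarz over all pairs at once, rather than row by row, avoids a factor `N`. This yields
the `1 / N²` in the noise part of the variance bound. -/
theorem sum_noiseVec_sq_le (hB : ∀ j i, f j i (y j - y i) ^ 2 ≤ B)
    (A ξ : Fin N → Fin N → ℝ) : (∑ i, noiseVec f A ξ y i) ^ 2 ≤ B * edgeWeight A * noiseSq ξ := by
  rcases isEmpty_or_nonempty (Fin N) with he | ⟨⟨i0⟩⟩
  · simp [noiseSq]
  have hB0 := (sq_nonneg _).trans (hB i0 i0)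
  simp only [noiseVec]
  rw [← Fintype.sum_prod_type' (f := fun i j => A i j * f j i (y j - y i) * ξ j i)]
  refine (Finset.sum_mul_sq_le_sq_mul_sq _ _ _).trans ?_
  refine mul_le_mul ?_ ?_ (Finset.sum_nonneg fun _ _ => sq_nonneg _)
      (mul_nonneg hB0 (edgeWeight_nonneg _))
  · rw [Fintype.sum_prod_type (f := fun p : Fin N × Fin N =>
      (A p.1 p.2 * f p.2 p.1 (y p.2 - y p.1)) ^ 2)]
    refine le_trans ?_ (mul_le_mul_of_nonneg_left (sum_sq_le_edgeWeight A) hB0)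
    simp only [Finset.mul_sum]
    refine Finset.sum_le_sum fun i _ => Finset.sum_le_sum fun j _ => ?_
    rw [mul_pow, mul_comm]
    exact mul_le_mul_of_nonneg_right (hB j i) (sq_nonneg _)
  · rw [Fintype.sum_prod_type (f := fun p : Fin N × Fin N => ξ p.2 p.1 ^ 2), Finset.sum_comm]
    rfl

end NoiseBounds

/-! #### The second smallest eigenvalue -/

/-- All eigenvalues but the last are at least `θ > 0`, while `𝟏` lies in the kernel. Hence `𝟏` is
orthogonal to all the other eigenvectors and spans the last eigenline, so a vector orthogonal to `𝟏`
expands in eigenvectors with eigenvalue at least `θ`. No sign of the last eigenvalue has to be known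
beforehand. -/
theorem mul_sqNorm_le_of_le_lambda2 (hN : 2 ≤ N) {M : Matrix (Fin N) (Fin N) ℝ} {θ : ℝ}
    (hθ : 0 < θ) (hM : θ ≤ lambda2 M) (hrow : ∀ i, ∑ j, M i j = 0) {x : Fin N → ℝ}
    (hx : ∑ i, x i = 0) : θ * sqNorm x ≤ ∑ i, ∑ j, x i * x j * M i j := by
  by_cases hc : M.IsHermitian ∧ 2 ≤ N
  swap
  -- The default value 0 contradicts `0 < θ ≤ lambda2 M`, so symmetry of `M` comes for free.
  · rw [lambda2, dif_neg hc] at hM; linarith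
  rw [lambda2, dif_pos hc] at hM
  have H := hc.1
  set v := H.eigenvectorBasis with hv
  have hT : ∀ i (z : Fin N → ℝ), inner ℝ (v i) (WithLp.toLp 2 (M.mulVec z))
      = H.eigenvalues i * inner ℝ (v i) (WithLp.toLp 2 z) := by
    intro i z
    rw [← Matrix.toEuclideanCLM_toLp, Matrix.inner_toEuclideanCLM, Matrix.dotProduct_mulVec,
      ← Matrix.mulVec_transpose]
    have h1 : M.transpose = M := by simpa using H.eq
    rw [h1, hv, H.mulVec_eigenvectorBasis i, smul_dotProduct, smul_eq_mul,
      EuclideanSpace.inner_eq_star_dotProduct]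
    simp [dotProduct_comm]
  set e := (Fintype.equivOfCardEq (Fintype.card_fin _) : Fin (Fintype.card (Fin N)) ≃ Fin N)
    with he
  have hcard : Fintype.card (Fin N) = N := Fintype.card_fin N
  -- Eigenvalues are listed in decreasing order: position `N - 1` holds the smallest and `N - 2` is
  -- the one in `lambda2`.
  set i0 : Fin N := e ⟨N - 1, by omega⟩ with hi0
  have hlam : ∀ i, i ≠ i0 → θ ≤ H.eigenvalues i := by
    intro i hi
    refine hM.trans (H.eigenvalues₀_antitone ?_)
    have h1 : e.symm i ≠ ⟨N - 1, by omega⟩ := fun h => hi (by rw [hi0, ← h, e.apply_symm_apply])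
    have h2 := (e.symm i).2
    have h3 : ((e.symm i : Fin _) : ℕ) ≠ N - 1 := fun h => h1 (Fin.ext h)
    rw [Fin.le_def]
    change (e.symm i : ℕ) ≤ N - 2
    omega
  set one : EuclideanSpace ℝ (Fin N) := WithLp.toLp 2 fun _ => (1:ℝ) with hone
  have hM1 : M.mulVec (fun _ => (1:ℝ)) = 0 := by
    funext i; simp [Matrix.mulVec, dotProduct, hrow]
  have hv1 : ∀ i, i ≠ i0 → inner ℝ (v i) one = 0 := by
    intro i hi
    have h1 := hT i fun _ => 1
    rw [hM1] at h1
    simp only [WithLp.toLp_zero, inner_zero_right] at h1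
    exact (mul_eq_zero.1 h1.symm).resolve_left (by linarith [hlam i hi])
  have hsum : ∀ z w : EuclideanSpace ℝ (Fin N), ∑ i, inner ℝ z (v i) * inner ℝ (v i) w
      = inner ℝ z w := v.sum_inner_mul_inner
  have hone0 : inner ℝ (v i0) one ≠ 0 := by
    intro h0
    have h1 := hsum one one
    rw [Finset.sum_eq_zero fun i _ => by
      by_cases hi : i = i0
      · rw [hi, h0, mul_zero]
      · rw [hv1 i hi, mul_zero]] at h1
    have h2 : one = 0 := inner_self_eq_zero.1 h1.symm
    have h3 : one i0 = 1 := rfl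
    rw [h2] at h3
    simp at h3
  set xe : EuclideanSpace ℝ (Fin N) := WithLp.toLp 2 x with hxe
  have hx0 : inner ℝ xe (v i0) = 0 := by
    have h1 := hsum xe one
    rw [Finset.sum_eq_single i0 (fun i _ hi => by rw [hv1 i hi, mul_zero]) (by simp)] at h1
    have h2 : inner ℝ xe one = 0 := by
      rw [EuclideanSpace.inner_eq_star_dotProduct]
      simp [hxe, hone, dotProduct, hx]
    rw [h2] at h1
    exact (mul_eq_zero.1 h1).resolve_right hone0
  have hquad : ∑ i, ∑ j, x i * x j * M i j = ∑ i, H.eigenvalues i * (inner ℝ xe (v i)) ^ 2 := by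
    have h1 : ∑ i, ∑ j, x i * x j * M i j = inner ℝ xe (WithLp.toLp 2 (M.mulVec x)) := by
      rw [← Matrix.toEuclideanCLM_toLp, Matrix.inner_toEuclideanCLM]
      simp only [hxe, dotProduct, Matrix.mulVec, Finset.mul_sum]
      exact Finset.sum_congr rfl fun i _ => Finset.sum_congr rfl fun j _ => by ring
    rw [h1, ← hsum]
    refine Finset.sum_congr rfl fun i _ => ?_
    rw [hT, ← hxe, real_inner_comm]; ring
  have hnorm : sqNorm x = ∑ i, (inner ℝ xe (v i)) ^ 2 := by
    rw [sqNorm_eq_norm_sq, ← hxe, ← real_inner_self_eq_norm_sq, ← hsum]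
    refine Finset.sum_congr rfl fun i _ => ?_
    rw [real_inner_comm]; ring
  rw [hquad, hnorm, Finset.mul_sum]
  refine Finset.sum_le_sum fun i _ => ?_
  by_cases hi : i = i0
  · rw [hi, hx0]; simp
  · exact mul_le_mul_of_nonneg_right (hlam i hi) (sq_nonneg _)

end Algebra

/-! ### Measurability of the pathwise quantities. -/

section Measurability

theorem measurable_coord {Ω ι : Type*} {E : ι → Type*} [∀ i, MeasurableSpace (E i)]
    {m : MeasurableSpace Ω} {y : Ω → ∀ i, E i} (hy : Measurable[m] y) (i : ι) :
    Measurable[m] fun ω => y ω i := (measurable_pi_apply i).comp hy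

variable {Ω : Type*} {m : MeasurableSpace Ω} {N : ℕ} {A ξ : Ω → Fin N → Fin N → ℝ}
  {y : Ω → Fin N → ℝ} {f : Fin N → Fin N → ℝ → ℝ}

theorem measurable_sqNorm (hy : Measurable y) : Measurable fun ω => sqNorm (y ω) := by
  unfold sqNorm; fun_prop

theorem measurable_mean (hy : Measurable y) : Measurable fun ω => mean (y ω) := by
  unfold mean; fun_prop

theorem measurable_consErr (hy : Measurable y) : Measurable fun ω => consErr (y ω) := by
  refine measurable_pi_iff.2 fun i => ?_
  simp_rw [consErr_apply]
  exact (measurable_pi_iff.1 hy i).sub (measurable_mean hy)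

theorem measurable_energy (hy : Measurable y) : Measurable fun ω => energy (y ω) :=
  measurable_sqNorm (measurable_consErr hy)

theorem measurable_intensity (s b : ℝ) (hy : Measurable y) :
    Measurable fun ω => intensity s b (y ω) :=
  ((measurable_energy hy).const_mul _).add_const _

theorem measurable_lapMul (hA : Measurable A) (hy : Measurable y) :
    Measurable fun ω => lapMul (A ω) (y ω) := by
  refine measurable_pi_iff.2 fun i => ?_
  unfold lapMul; fun_prop

theorem measurable_lapForm (hA : Measurable A) (hy : Measurable y) :
    Measurable fun ω => lapForm (A ω) (y ω) := by
  unfold lapForm lapMul; fun_prop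

theorem measurable_noiseVec (hf : ∀ j i, Measurable (f j i)) (hA : Measurable A)
    (hξ : Measurable ξ) (hy : Measurable y) :
    Measurable fun ω => noiseVec f (A ω) (ξ ω) (y ω) := by
  refine measurable_pi_iff.2 fun i => ?_
  unfold noiseVec; fun_prop

theorem measurable_step (c : ℝ) (hf : ∀ j i, Measurable (f j i)) (hA : Measurable A)
    (hξ : Measurable ξ) (hy : Measurable y) :
    Measurable fun ω => step c f (A ω) (ξ ω) (y ω) := by
  refine measurable_pi_iff.2 fun i => ?_
  have h1 := measurable_pi_iff.1 (measurable_lapMul hA hy) i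
  have h2 := measurable_pi_iff.1 (measurable_noiseVec hf hA hξ hy) i
  unfold step; fun_prop

theorem measurable_noiseSq (hξ : Measurable ξ) : Measurable fun ω => noiseSq (ξ ω) := by
  unfold noiseSq; fun_prop

theorem measurable_edgeWeight (hA : Measurable A) : Measurable fun ω => edgeWeight (A ω) := by
  have hA' : ∀ i j, Measurable fun ω => A ω i j := fun i j => by fun_prop
  unfold edgeWeight
  simp_rw [edgeCount_eq_sum]
  refine Measurable.mul ?_ (Measurable.iSup fun p => (hA' _ _).pow_const 2)
  refine Finset.measurable_sum _ fun p _ => Measurable.ite ?_ measurable_const measurable_const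
  exact hA' p.1 p.2 (measurableSet_singleton 0)

theorem measurable_lap_apply (hA : Measurable A) (i j : Fin N) :
    Measurable fun ω => lap (A ω) i j := by
  simp only [lap, Matrix.sub_apply, Matrix.diagonal_apply, degIn, Matrix.of_apply]
  split_ifs <;> fun_prop

theorem measurable_norm2_lap (hA : Measurable A) : Measurable fun ω => norm2 (lap (A ω)) := by
  have h1 : Continuous fun M : Fin N → Fin N → ℝ => norm2 (Matrix.of M) := by
    let T : (Fin N → Fin N → ℝ) →ₗ[ℝ] (EuclideanSpace ℝ (Fin N) →L[ℝ] EuclideanSpace ℝ (Fin N)) :=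
      { toFun := fun M => Matrix.toEuclideanCLM (n := Fin N) (𝕜 := ℝ) (Matrix.of M)
        map_add' := fun M M' => map_add (Matrix.toEuclideanCLM (n := Fin N) (𝕜 := ℝ)) _ _
        map_smul' := fun r M => map_smul (Matrix.toEuclideanCLM (n := Fin N) (𝕜 := ℝ)) _ _ }
    exact T.continuous_of_finiteDimensional.norm
  exact h1.measurable.comp (measurable_pi_iff.2 fun i => measurable_pi_iff.2 fun j =>
    measurable_lap_apply hA i j)

end Measurability

/-- The data of one step of the algorithm: a random weight matrix `A` and noises `ξ`, where `m` is
the history before the step, and `m'` contains moreover the information on `A`. -/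
structure StepModel {Ω : Type*} (m m' : MeasurableSpace Ω) [m0 : MeasurableSpace Ω]
    (μ : Measure Ω) {N : ℕ} (A ξ : Ω → Fin N → Fin N → ℝ) (β ρ₀ ρ₁ : ℝ) : Prop where
  le : m ≤ m'
  le' : m' ≤ m0
  measA : Measurable[m'] A
  measNoise : Measurable ξ
  diag : ∀ ω i, A ω i i = 0
  intA : ∀ i j, Integrable (fun ω => A ω i j) μ
  balanced : ∀ᵐ ω ∂μ, (∀ i j, 0 ≤ condMat μ m A ω i j) ∧ IsBalanced (condMat μ m A ω)
  lapBound : CondBound μ m (fun ω => norm2 (lap (A ω)) ^ 2) (ρ₀ ^ 2)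
  edgeBound : CondBound μ m (fun ω => edgeWeight (A ω)) ρ₁
  noise_int : ∀ j i, Integrable (fun ω => ξ ω j i) μ
  noise_cond : ∀ j i, μ[fun ω => ξ ω j i | m'] =ᵐ[μ] 0
  noiseBound : CondBound μ m' (fun ω => noiseSq (ξ ω)) β

theorem CondBound.nonneg {Ω : Type*} {m : MeasurableSpace Ω} [m0 : MeasurableSpace Ω]
    {μ : Measure Ω} [IsProbabilityMeasure μ] {B : Ω → ℝ} {r : ℝ} (hB : CondBound μ m B r)
    (h0 : ∀ ω, 0 ≤ B ω) : 0 ≤ r := by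
  have h : 0 ≤ᵐ[μ] μ[B | m] := condExp_nonneg (ae_of_all _ h0)
  obtain ⟨ω, h1, h2⟩ := (h.and hB.2).exists
  exact h1.trans h2

theorem memLp_two_coord {Ω : Type*} [MeasurableSpace Ω] {μ : Measure Ω} {N : ℕ}
    {y : Ω → Fin N → ℝ} (hy : Measurable y) (hyi : Integrable (fun ω => sqNorm (y ω)) μ)
    (i : Fin N) : MemLp (fun ω => y ω i) 2 μ := by
  have hm : Measurable fun ω => y ω i := measurable_pi_iff.1 hy i
  refine (memLp_two_iff_integrable_sq hm.aestronglyMeasurable).2 ?_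
  refine hyi.mono' (hm.pow_const 2).aestronglyMeasurable (ae_of_all _ fun ω => ?_)
  rw [Real.norm_eq_abs, abs_of_nonneg (sq_nonneg _)]
  exact sq_le_sqNorm _ _

theorem memLp_mean {Ω : Type*} [MeasurableSpace Ω] {μ : Measure Ω} {N : ℕ}
    {y : Ω → Fin N → ℝ} (hy : Measurable y) (hyi : Integrable (fun ω => sqNorm (y ω)) μ) :
    MemLp (fun ω => mean (y ω)) 2 μ := by
  unfold mean
  exact (memLp_finsetSum _ fun i _ => memLp_two_coord hy hyi i).const_mul _

theorem integrable_energy {Ω : Type*} [MeasurableSpace Ω] {μ : Measure Ω} {N : ℕ} (hN : 0 < N)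
    {y : Ω → Fin N → ℝ} (hy : Measurable y) (hyi : Integrable (fun ω => sqNorm (y ω)) μ) :
    Integrable (fun ω => energy (y ω)) μ := by
  refine hyi.mono' (measurable_energy hy).aestronglyMeasurable (ae_of_all _ fun ω => ?_)
  rw [Real.norm_eq_abs, abs_of_nonneg (energy_nonneg _)]
  exact energy_le_sqNorm hN _

theorem integrable_mul_of_unit {Ω : Type*} [MeasurableSpace Ω] {μ : Measure Ω} {Z g : Ω → ℝ}
    (hZ : Measurable Z) (hZ0 : ∀ ω, 0 ≤ Z ω) (hZ1 : ∀ ω, Z ω ≤ 1) (hg : Integrable g μ) :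
    Integrable (fun ω => Z ω * g ω) μ :=
  hg.bdd_mul (c := 1) hZ.aestronglyMeasurable (ae_of_all _ fun ω => by
    rw [Real.norm_eq_abs, abs_of_nonneg (hZ0 ω)]; exact hZ1 ω)

/-! ### Mean-square estimates for one step. -/

namespace StepModel

variable {Ω : Type*} {m m' : MeasurableSpace Ω} [m0 : MeasurableSpace Ω]
  {μ : Measure Ω} {N : ℕ} {A ξ : Ω → Fin N → Fin N → ℝ} {β ρ₀ ρ₁ : ℝ}
  {y : Ω → Fin N → ℝ} {Z : Ω → ℝ}
  {f : Fin N → Fin N → ℝ → ℝ} {σ b : Fin N → Fin N → ℝ}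

theorem condExp_imbalance (S : StepModel m m' μ A ξ β ρ₀ ρ₁) (i : Fin N) :
    μ[fun ω => degIn (A ω) i - degOut (A ω) i | m] =ᵐ[μ] 0 := by
  have e : (fun ω => degIn (A ω) i - degOut (A ω) i)
      = (∑ j, fun ω => A ω i j) - ∑ j, fun ω => A ω j i := by
    funext ω; simp [degIn, degOut]
  rw [e]
  have h1 := condExp_sub (m := m) (integrable_finsetSum' Finset.univ fun j _ => S.intA i j)
    (integrable_finsetSum' Finset.univ fun j _ => S.intA j i)
  have h2 := condExp_finsetSum (s := Finset.univ) (fun j _ => S.intA i j) m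
  have h3 := condExp_finsetSum (s := Finset.univ) (fun j _ => S.intA j i) m
  filter_upwards [h1, h2, h3, S.balanced] with ω h1 h2 h3 h4
  rw [h1, Pi.sub_apply, h2, h3]
  have := h4.2 i
  simp only [degIn, degOut, condMat, Matrix.of_apply] at this
  simp [Finset.sum_apply, this]

variable [IsProbabilityMeasure μ]

theorem lapMoment (S : StepModel m m' μ A ξ β ρ₀ ρ₁) {g : Ω → ℝ} (hg0 : ∀ ω, 0 ≤ g ω)
    (hg : Measurable[m] g) (hgi : Integrable g μ) :
    Integrable (fun ω => g ω * norm2 (lap (A ω)) ^ 2) μ ∧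
      ∫ ω, g ω * norm2 (lap (A ω)) ^ 2 ∂μ ≤ ρ₀ ^ 2 * ∫ ω, g ω ∂μ :=
  S.lapBound.mul (S.le.trans S.le') (fun _ => sq_nonneg _) hg0 hg.stronglyMeasurable hgi

/-- Condition twice: first on `m'`, where the weights are known and the noise costs `β`, then on
`m`, where the weights cost `ρ₁`. -/
theorem noiseMoment (S : StepModel m m' μ A ξ β ρ₀ ρ₁) {g : Ω → ℝ} (hg0 : ∀ ω, 0 ≤ g ω)
    (hg : Measurable[m] g) (hgi : Integrable g μ) :
    Integrable (fun ω => g ω * edgeWeight (A ω) * noiseSq (ξ ω)) μ ∧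
      ∫ ω, g ω * edgeWeight (A ω) * noiseSq (ξ ω) ∂μ ≤ β * (ρ₁ * ∫ ω, g ω ∂μ) := by
  obtain ⟨h1, h2⟩ := S.edgeBound.mul (S.le.trans S.le') (fun _ => edgeWeight_nonneg _) hg0
    hg.stronglyMeasurable hgi
  obtain ⟨h3, h4⟩ := S.noiseBound.mul S.le' (fun _ => noiseSq_nonneg _)
    (fun ω => mul_nonneg (hg0 ω) (edgeWeight_nonneg _))
    ((hg.mono S.le le_rfl).mul (measurable_edgeWeight S.measA)).stronglyMeasurable h1
  exact ⟨h3, h4.trans (mul_le_mul_of_nonneg_left h2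
    (S.noiseBound.nonneg fun _ => noiseSq_nonneg _))⟩

theorem integrable_mul_lapForm (S : StepModel m m' μ A ξ β ρ₀ ρ₁) (hy : Measurable[m] y)
    (hyi : Integrable (fun ω => sqNorm (y ω)) μ) (hZ : Measurable[m] Z) (hZ0 : ∀ ω, 0 ≤ Z ω)
    (hZ1 : ∀ ω, Z ω ≤ 1) : Integrable (fun ω => Z ω * lapForm (A ω) (y ω)) μ := by
  have hm := S.le.trans S.le'
  have hA := S.measA.mono S.le' le_rfl
  have h1 := integrable_mul_of_unit (hZ.mono hm le_rfl) hZ0 hZ1 hyi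
  have h2 := (S.lapMoment (g := fun ω => Z ω * sqNorm (y ω))
    (fun ω => mul_nonneg (hZ0 ω) (sqNorm_nonneg _)) (hZ.mul (measurable_sqNorm hy)) h1).1
  refine (h1.add h2).mono' ((hZ.mono hm le_rfl).mul
    (measurable_lapForm hA (hy.mono hm le_rfl))).aestronglyMeasurable (ae_of_all _ fun ω => ?_)
  rw [Real.norm_eq_abs, abs_mul, abs_of_nonneg (hZ0 ω), Pi.add_apply]
  have := mul_le_mul_of_nonneg_left (abs_lapForm_le (A ω) (y ω)) (hZ0 ω)
  linarith

/-- Since `Z` and `y` are known in `m`, the weights may be replaced by their conditional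
expectations, which form a nonnegative balanced digraph. -/
theorem integral_mul_lapForm_nonneg (S : StepModel m m' μ A ξ β ρ₀ ρ₁) (hy : Measurable[m] y)
    (hyi : Integrable (fun ω => sqNorm (y ω)) μ) (hZ : Measurable[m] Z) (hZ0 : ∀ ω, 0 ≤ Z ω)
    (hZ1 : ∀ ω, Z ω ≤ 1) : 0 ≤ ∫ ω, Z ω * lapForm (A ω) (y ω) ∂μ := by
  have hm := S.le.trans S.le'
  have hA := S.measA.mono S.le' le_rfl
  have hyc : ∀ i, Measurable[m] fun ω => y ω i := fun i => measurable_coord hy i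
  have h1 := integrable_mul_of_unit (hZ.mono hm le_rfl) hZ0 hZ1 hyi
  have h2 := (S.lapMoment (g := fun ω => Z ω * sqNorm (y ω))
    (fun ω => mul_nonneg (hZ0 ω) (sqNorm_nonneg _)) (hZ.mul (measurable_sqNorm hy)) h1).1
  have hgm : ∀ i j, Measurable[m] fun ω => Z ω * (y ω i * (y ω i - y ω j)) := fun i j =>
    hZ.mul ((hyc i).mul ((hyc i).sub (hyc j)))
  have hint : ∀ i j, Integrable (fun ω => Z ω * (y ω i * (y ω i - y ω j)) * A ω i j) μ := by
    intro i j
    have hAm : Measurable fun ω => A ω i j := by fun_prop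
    refine ((h1.add h2).const_mul 2).mono' (((hgm i j).mono hm le_rfl).mul
      hAm).aestronglyMeasurable (ae_of_all _ fun ω => ?_)
    rw [Real.norm_eq_abs, abs_mul, abs_mul, abs_of_nonneg (hZ0 ω), Pi.add_apply]
    have e1 : |y ω i * (y ω i - y ω j)| ≤ 2 * sqNorm (y ω) := by
      have a1 := sq_le_sqNorm (y ω) i
      have a2 := sq_le_sqNorm (y ω) j
      rw [abs_le]
      constructor <;> nlinarith [sq_nonneg (y ω i - y ω j), sq_nonneg (y ω i + y ω j)]
    have e2 : |A ω i j| ≤ 1 + norm2 (lap (A ω)) ^ 2 := by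
      have a1 := weight_sq_le (S.diag ω) i j
      rw [← sq_abs] at a1
      nlinarith [sq_nonneg (|A ω i j| - 1), abs_nonneg (A ω i j)]
    calc Z ω * |y ω i * (y ω i - y ω j)| * |A ω i j|
        ≤ Z ω * (2 * sqNorm (y ω)) * (1 + norm2 (lap (A ω)) ^ 2) :=
          mul_le_mul (mul_le_mul_of_nonneg_left e1 (hZ0 ω)) e2 (abs_nonneg _)
            (mul_nonneg (hZ0 ω) (mul_nonneg zero_le_two (sqNorm_nonneg _)))
      _ = _ := by ring
  have e : ∫ ω, Z ω * lapForm (A ω) (y ω) ∂μ = ∫ ω, Z ω * lapForm (condMat μ m A ω) (y ω) ∂μ := by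
    have e1 : ∀ B : Ω → Fin N → Fin N → ℝ, ∀ ω, Z ω * lapForm (B ω) (y ω)
        = ∑ i, ∑ j, Z ω * (y ω i * (y ω i - y ω j)) * B ω i j := fun B ω => by
      rw [lapForm_eq_sum, Finset.mul_sum]
      refine Finset.sum_congr rfl fun i _ => ?_
      rw [Finset.mul_sum]
      exact Finset.sum_congr rfl fun j _ => by ring
    have hint' : ∀ i j, Integrable (fun ω => Z ω * (y ω i * (y ω i - y ω j))
        * condMat μ m A ω i j) μ := fun i j =>
      integrable_mul_condExp (hgm i j).stronglyMeasurable (S.intA i j) (hint i j)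
    rw [integral_congr_ae (ae_of_all _ (e1 A)),
      integral_congr_ae (ae_of_all _ (e1 (condMat μ m A))),
      integral_finsetSum _ fun i _ => integrable_finsetSum _ fun j _ => hint i j,
      integral_finsetSum _ fun i _ => integrable_finsetSum _ fun j _ => hint' i j]
    refine Finset.sum_congr rfl fun i _ => ?_
    rw [integral_finsetSum _ fun j _ => hint i j, integral_finsetSum _ fun j _ => hint' i j]
    exact Finset.sum_congr rfl fun j _ =>
      integral_mul_condExp hm (hgm i j).stronglyMeasurable (S.intA i j) (hint i j)
  rw [e]
  refine integral_nonneg_of_ae ?_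
  filter_upwards [S.balanced] with ω h
  exact mul_nonneg (hZ0 ω) (lapForm_nonneg h.1 h.2 _)

theorem integrable_lapForm (S : StepModel m m' μ A ξ β ρ₀ ρ₁) (hy : Measurable[m] y)
    (hyi : Integrable (fun ω => sqNorm (y ω)) μ) :
    Integrable (fun ω => lapForm (A ω) (y ω)) μ := by
  simpa using S.integrable_mul_lapForm (Z := fun _ => 1) hy hyi measurable_const
    (fun _ => zero_le_one) (fun _ => le_rfl)

theorem integral_lapForm_nonneg (S : StepModel m m' μ A ξ β ρ₀ ρ₁) (hy : Measurable[m] y)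
    (hyi : Integrable (fun ω => sqNorm (y ω)) μ) : 0 ≤ ∫ ω, lapForm (A ω) (y ω) ∂μ := by
  simpa using S.integral_mul_lapForm_nonneg (Z := fun _ => 1) hy hyi measurable_const
    (fun _ => zero_le_one) (fun _ => le_rfl)

theorem integral_lapForm_le (S : StepModel m m' μ A ξ β ρ₀ ρ₁) (hy : Measurable[m] y)
    (hyi : Integrable (fun ω => sqNorm (y ω)) μ) :
    ∫ ω, lapForm (A ω) (y ω) ∂μ ≤ (1 + ρ₀ ^ 2) * ∫ ω, sqNorm (y ω) ∂μ := by
  obtain ⟨h1, h2⟩ := S.lapMoment (fun ω => sqNorm_nonneg (y ω)) (measurable_sqNorm hy) hyi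
  calc ∫ ω, lapForm (A ω) (y ω) ∂μ
      ≤ ∫ ω, (sqNorm (y ω) + sqNorm (y ω) * norm2 (lap (A ω)) ^ 2) ∂μ := by
        refine integral_mono (S.integrable_lapForm hy hyi) (hyi.add h1) fun ω => ?_
        have := (le_abs_self _).trans (abs_lapForm_le (A ω) (y ω))
        change lapForm (A ω) (y ω) ≤ sqNorm (y ω) + sqNorm (y ω) * norm2 (lap (A ω)) ^ 2
        linarith
    _ ≤ _ := by rw [integral_add hyi h1]; linarith

/-- Comparison of the expected Laplacian forms of two random vectors. -/
theorem integral_lapForm_le_two_mul (S : StepModel m m' μ A ξ β ρ₀ ρ₁) {u v : Ω → Fin N → ℝ}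
    (hu : Measurable[m] u) (hui : Integrable (fun ω => sqNorm (u ω)) μ)
    (hv : Measurable[m] v) (hvi : Integrable (fun ω => sqNorm (v ω)) μ) :
    ∫ ω, lapForm (A ω) (u ω) ∂μ ≤ 2 * ∫ ω, lapForm (A ω) (v ω) ∂μ
      + 2 * (1 + ρ₀ ^ 2) * ∫ ω, sqNorm (u ω - v ω) ∂μ := by
  have hm := S.le.trans S.le'
  have comb : ∀ u v : Ω → Fin N → ℝ, Measurable[m] u → Integrable (fun ω => sqNorm (u ω)) μ →
      Measurable[m] v → Integrable (fun ω => sqNorm (v ω)) μ →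
      Integrable (fun ω => sqNorm (u ω - v ω)) μ := by
    intro u v hu hui hv hvi
    refine ((hui.const_mul 2).add (hvi.const_mul 2)).mono'
      (measurable_sqNorm ((hu.sub hv).mono hm le_rfl)).aestronglyMeasurable
      (ae_of_all _ fun ω => ?_)
    rw [Real.norm_eq_abs, abs_of_nonneg (sqNorm_nonneg _), sub_eq_add_neg]
    have := sqNorm_add_le (u ω) (-v ω)
    have h1 : sqNorm (-v ω) = sqNorm (v ω) := by simp [sqNorm]
    rw [h1] at this
    exact this
  have hw := comb u v hu hui hv hvi
  have hwm : Measurable[m] fun ω => u ω - v ω := hu.sub hv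
  have hvw := comb v _ hv hvi hwm hw
  have i1 := S.integrable_lapForm hu hui
  have i2 := S.integrable_lapForm hv hvi
  have i3 := S.integrable_lapForm hwm hw
  have i4 := S.integrable_lapForm (hv.sub hwm) hvw
  have h0 := S.integral_lapForm_nonneg (hv.sub hwm) hvw
  -- The parallelogram law for `v` and `u - v`. The subtracted form has nonnegative expectation and
  -- is dropped.
  have e : ∀ ω, lapForm (A ω) (u ω) = 2 * lapForm (A ω) (v ω) + 2 * lapForm (A ω) (u ω - v ω)
      - lapForm (A ω) (v ω - (u ω - v ω)) := fun ω => by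
    have := lapForm_parallelogram (A ω) (v ω) (u ω - v ω)
    rw [add_sub_cancel] at this
    linarith
  have e2 : ∫ ω, lapForm (A ω) (u ω) ∂μ = 2 * ∫ ω, lapForm (A ω) (v ω) ∂μ
      + 2 * ∫ ω, lapForm (A ω) (u ω - v ω) ∂μ - ∫ ω, lapForm (A ω) (v ω - (u ω - v ω)) ∂μ := by
    rw [integral_congr_ae (ae_of_all _ e),
      integral_sub (by exact (i2.const_mul 2).add (i3.const_mul 2)) (by exact i4),
      integral_add (i2.const_mul 2) (i3.const_mul 2), integral_const_mul, integral_const_mul]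
  have h3 := S.integral_lapForm_le hwm hw
  have h0' : 0 ≤ ∫ ω, lapForm (A ω) (v ω - (u ω - v ω)) ∂μ := h0
  rw [e2]
  linarith

theorem intensity_integrable (hN : 0 < N) (s b : ℝ) (hy : Measurable y)
    (hyi : Integrable (fun ω => sqNorm (y ω)) μ) :
    Integrable (fun ω => intensity s b (y ω)) μ :=
  ((integrable_energy hN hy hyi).const_mul _).add (integrable_const _)

theorem integral_intensity (hN : 0 < N) (s b : ℝ) (hy : Measurable y)
    (hyi : Integrable (fun ω => sqNorm (y ω)) μ) :
    ∫ ω, intensity s b (y ω) ∂μ = 4 * s ^ 2 * ∫ ω, energy (y ω) ∂μ + 2 * b ^ 2 := by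
  simp only [intensity]
  rw [integral_add ((integrable_energy hN hy hyi).const_mul _) (integrable_const _),
    integral_const_mul]
  simp

theorem noise_majorant (S : StepModel m m' μ A ξ β ρ₀ ρ₁) (hN : 0 < N) (s b : ℝ)
    (hy : Measurable[m] y) (hyi : Integrable (fun ω => sqNorm (y ω)) μ) (hZ : Measurable[m] Z)
    (hZ0 : ∀ ω, 0 ≤ Z ω) (hZ1 : ∀ ω, Z ω ≤ 1) :
    Integrable (fun ω => Z ω * (intensity s b (y ω) * edgeWeight (A ω) * noiseSq (ξ ω))) μ ∧
      ∫ ω, Z ω * (intensity s b (y ω) * edgeWeight (A ω) * noiseSq (ξ ω)) ∂μ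
        ≤ β * (ρ₁ * ∫ ω, Z ω * intensity s b (y ω) ∂μ) := by
  have hm := S.le.trans S.le'
  have := S.noiseMoment (g := fun ω => Z ω * intensity s b (y ω))
    (fun ω => mul_nonneg (hZ0 ω) (intensity_nonneg _ _ _)) (hZ.mul (measurable_intensity s b hy))
    (integrable_mul_of_unit (hZ.mono hm le_rfl) hZ0 hZ1
      (intensity_integrable hN s b (hy.mono hm le_rfl) hyi))
  simpa only [mul_assoc] using this

theorem noise_majorant_one (S : StepModel m m' μ A ξ β ρ₀ ρ₁) (hN : 0 < N) (s b : ℝ)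
    (hy : Measurable[m] y) (hyi : Integrable (fun ω => sqNorm (y ω)) μ) :
    Integrable (fun ω => intensity s b (y ω) * edgeWeight (A ω) * noiseSq (ξ ω)) μ ∧
      ∫ ω, intensity s b (y ω) * edgeWeight (A ω) * noiseSq (ξ ω) ∂μ
        ≤ β * (ρ₁ * (4 * s ^ 2 * ∫ ω, energy (y ω) ∂μ + 2 * b ^ 2)) := by
  have := S.noise_majorant hN s b (Z := fun _ => 1) hy hyi measurable_const
    (fun _ => zero_le_one) (fun _ => le_rfl)
  simp only [one_mul] at this
  rwa [integral_intensity hN s b (hy.mono (S.le.trans S.le') le_rfl) hyi] at this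

/-- The noise contribution is uncorrelated with the past. -/
theorem integral_mul_noiseVec (S : StepModel m m' μ A ξ β ρ₀ ρ₁) (hN : 0 < N) (h1 : A1 f σ b)
    (hy : Measurable[m] y) (hyi : Integrable (fun ω => sqNorm (y ω)) μ) {U : Ω → ℝ}
    (hU : Measurable[m'] U) (hU2 : MemLp U 2 μ) (i : Fin N) :
    Integrable (fun ω => U ω * noiseVec f (A ω) (ξ ω) (y ω) i) μ ∧
      ∫ ω, U ω * noiseVec f (A ω) (ξ ω) (y ω) i ∂μ = 0 := by
  have hm := S.le.trans S.le'
  have hf : ∀ j i, Measurable (f j i) := fun j i => (h1 j i).1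
  have hyc : ∀ i, Measurable[m'] fun ω => y ω i := fun i =>
    (measurable_coord hy i).mono S.le le_rfl
  have hAc : ∀ i j, Measurable[m'] fun ω => A ω i j := fun i j =>
    measurable_coord (measurable_coord S.measA i) j
  have hξc : ∀ j i, Measurable fun ω => ξ ω j i := fun j i =>
    measurable_coord (measurable_coord S.measNoise j) i
  have hgm : ∀ j, Measurable[m'] fun ω => U ω * (A ω i j * f j i (y ω j - y ω i)) := fun j =>
    hU.mul ((hAc i j).mul ((hf j i).comp ((hyc j).sub (hyc i))))
  -- Majorized through `|U w| ≤ U² + w²`, where `w` is the noise term.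
  have hint : ∀ j, Integrable (fun ω => U ω * (A ω i j * f j i (y ω j - y ω i)) * ξ ω j i) μ := by
    intro j
    refine (hU2.integrable_sq.add (S.noise_majorant_one hN (maxEntry σ) (maxEntry b)
      hy hyi).1).mono' (((hgm j).mono S.le' le_rfl).mul (hξc j i)).aestronglyMeasurable
      (ae_of_all _ fun ω => ?_)
    have e := noise_term_sq_le (f := f) (y := y ω) (h1.sq_le (y ω)) (A ω) (ξ ω) i j
    rw [Real.norm_eq_abs, Pi.add_apply, mul_assoc]
    set w := A ω i j * f j i (y ω j - y ω i) * ξ ω j i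
    refine le_trans ?_ (add_le_add_right e _)
    rw [abs_le]
    constructor <;> nlinarith [sq_nonneg (U ω - w), sq_nonneg (U ω + w)]
  have e : ∀ ω, U ω * noiseVec f (A ω) (ξ ω) (y ω) i
      = ∑ j, U ω * (A ω i j * f j i (y ω j - y ω i)) * ξ ω j i := fun ω => by
    simp only [noiseVec, Finset.mul_sum, mul_assoc]
  simp_rw [e]
  refine ⟨integrable_finsetSum _ fun j _ => hint j, ?_⟩
  rw [integral_finsetSum _ fun j _ => hint j]
  exact Finset.sum_eq_zero fun j _ => integral_mul_eq_zero_of_condExp S.le'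
    (hgm j).stronglyMeasurable (S.noise_int j i) (hint j) (S.noise_cond j i)

/-- The weighted mean-square inequality for one step. -/
theorem integral_sqNorm_step_le (S : StepModel m m' μ A ξ β ρ₀ ρ₁) (hN : 0 < N) (h1 : A1 f σ b)
    (c : ℝ) (hy : Measurable[m] y) (hyi : Integrable (fun ω => sqNorm (y ω)) μ)
    (hZ : Measurable[m] Z) (hZ0 : ∀ ω, 0 ≤ Z ω) (hZ1 : ∀ ω, Z ω ≤ 1) :
    Integrable (fun ω => Z ω * sqNorm (step c f (A ω) (ξ ω) (y ω))) μ ∧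
    ∫ ω, Z ω * sqNorm (step c f (A ω) (ξ ω) (y ω)) ∂μ ≤
      (1 + c ^ 2 * ρ₀ ^ 2) * ∫ ω, Z ω * sqNorm (y ω) ∂μ
      - 2 * c * ∫ ω, Z ω * lapForm (A ω) (y ω) ∂μ
      + c ^ 2 * (β * (ρ₁ * ∫ ω, Z ω * intensity (maxEntry σ) (maxEntry b) (y ω) ∂μ)) := by
  have hm := S.le.trans S.le'
  have hf : ∀ j i, Measurable (f j i) := fun j i => (h1 j i).1
  have hA := S.measA.mono S.le' le_rfl
  have hy0 := hy.mono hm le_rfl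
  have hZm := hZ.mono hm le_rfl
  have hWm := measurable_noiseVec hf hA S.measNoise hy0
  have iy := integrable_mul_of_unit hZm hZ0 hZ1 hyi
  have iL := S.integrable_mul_lapForm hy hyi hZ hZ0 hZ1
  obtain ⟨iM, bM⟩ := S.lapMoment (g := fun ω => Z ω * sqNorm (y ω))
    (fun ω => mul_nonneg (hZ0 ω) (sqNorm_nonneg _)) (hZ.mul (measurable_sqNorm hy)) iy
  obtain ⟨iW, bW⟩ := S.noise_majorant hN (maxEntry σ) (maxEntry b) hy hyi hZ hZ0 hZ1
  have hLy : ∀ ω, Z ω * sqNorm (lapMul (A ω) (y ω))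
      ≤ Z ω * sqNorm (y ω) * norm2 (lap (A ω)) ^ 2 := fun ω => by
    have := mul_le_mul_of_nonneg_left (sqNorm_lapMul_le (A ω) (y ω)) (hZ0 ω)
    linarith
  have hWy : ∀ ω, Z ω * sqNorm (noiseVec f (A ω) (ξ ω) (y ω))
      ≤ Z ω * (intensity (maxEntry σ) (maxEntry b) (y ω) * edgeWeight (A ω) * noiseSq (ξ ω)) :=
    fun ω => mul_le_mul_of_nonneg_left (sqNorm_noiseVec_le (h1.sq_le (y ω)) _ _) (hZ0 ω)
  have iLy : Integrable (fun ω => Z ω * sqNorm (lapMul (A ω) (y ω))) μ :=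
    iM.mono' (hZm.mul (measurable_sqNorm (measurable_lapMul hA hy0))).aestronglyMeasurable
      (ae_of_all _ fun ω => by
        rw [Real.norm_eq_abs, abs_of_nonneg (mul_nonneg (hZ0 ω) (sqNorm_nonneg _))]
        exact hLy ω)
  have iWy : Integrable (fun ω => Z ω * sqNorm (noiseVec f (A ω) (ξ ω) (y ω))) μ :=
    iW.mono' (hZm.mul (measurable_sqNorm hWm)).aestronglyMeasurable
      (ae_of_all _ fun ω => by
        rw [Real.norm_eq_abs, abs_of_nonneg (mul_nonneg (hZ0 ω) (sqNorm_nonneg _))]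
        exact hWy ω)
  have iLy1 : Integrable (fun ω => sqNorm (lapMul (A ω) (y ω))) μ := by
    refine (S.lapMoment (fun ω => sqNorm_nonneg (y ω)) (measurable_sqNorm hy) hyi).1.mono'
      (measurable_sqNorm (measurable_lapMul hA hy0)).aestronglyMeasurable (ae_of_all _ fun ω => ?_)
    rw [Real.norm_eq_abs, abs_of_nonneg (sqNorm_nonneg _), mul_comm]
    exact sqNorm_lapMul_le _ _
  -- The factor of the noise in the cross term involves the current weights, so it is known only in
  -- `m'`; this is why the noises must be centred given `m'`.
  have hUm : ∀ i, Measurable[m'] fun ω => Z ω * (y ω i - c * lapMul (A ω) (y ω) i) := fun i =>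
    (hZ.mono S.le le_rfl).mul (((measurable_coord hy i).mono S.le le_rfl).sub
      ((measurable_coord (measurable_lapMul S.measA (hy.mono S.le le_rfl)) i).const_mul c))
  have hU2 : ∀ i, MemLp (fun ω => Z ω * (y ω i - c * lapMul (A ω) (y ω) i)) 2 μ := fun i => by
    refine MemLp.of_le ((memLp_two_coord hy0 hyi i).sub
      ((memLp_two_coord (measurable_lapMul hA hy0) iLy1 i).const_mul c))
      ((hUm i).mono S.le' le_rfl).aestronglyMeasurable (ae_of_all _ fun ω => ?_)
    rw [norm_mul]
    refine mul_le_of_le_one_left (norm_nonneg _) ?_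
    rw [Real.norm_eq_abs, abs_of_nonneg (hZ0 ω)]; exact hZ1 ω
  have hX := fun i => S.integral_mul_noiseVec hN h1 hy hyi (hUm i) (hU2 i) i
  have iX : Integrable (fun ω => ∑ i, Z ω * (y ω i - c * lapMul (A ω) (y ω) i)
      * noiseVec f (A ω) (ξ ω) (y ω) i) μ := integrable_finsetSum _ fun i _ => (hX i).1
  have zX : ∫ ω, ∑ i, Z ω * (y ω i - c * lapMul (A ω) (y ω) i)
      * noiseVec f (A ω) (ξ ω) (y ω) i ∂μ = 0 := by
    rw [integral_finsetSum _ fun i _ => (hX i).1]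
    exact Finset.sum_eq_zero fun i _ => (hX i).2
  have e : ∀ ω, Z ω * sqNorm (step c f (A ω) (ξ ω) (y ω)) =
      Z ω * sqNorm (y ω) - 2 * c * (Z ω * lapForm (A ω) (y ω))
      + c ^ 2 * (Z ω * sqNorm (lapMul (A ω) (y ω)))
      + c ^ 2 * (Z ω * sqNorm (noiseVec f (A ω) (ξ ω) (y ω)))
      + 2 * c * ∑ i, Z ω * (y ω i - c * lapMul (A ω) (y ω) i)
        * noiseVec f (A ω) (ξ ω) (y ω) i := fun ω => by
    rw [sqNorm_step]
    simp_rw [mul_assoc (Z ω)]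
    rw [← Finset.mul_sum]
    ring
  have j1 := iy.sub (iL.const_mul (2 * c))
  have j2 := j1.add (iLy.const_mul (c ^ 2))
  have j3 := j2.add (iWy.const_mul (c ^ 2))
  have j4 := j3.add (iX.const_mul (2 * c))
  simp_rw [e]
  refine ⟨j4, ?_⟩
  rw [integral_add (by exact j3) (by exact iX.const_mul (2 * c)),
    integral_add (by exact j2) (by exact iWy.const_mul (c ^ 2)),
    integral_add (by exact j1) (by exact iLy.const_mul (c ^ 2)),
    integral_sub (by exact iy) (by exact iL.const_mul (2 * c))]
  simp only [integral_const_mul]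
  rw [zX]
  have b1 := (integral_mono iLy iM hLy).trans bM
  have b2 := (integral_mono iWy iW hWy).trans bW
  have b3 := mul_le_mul_of_nonneg_left b1 (sq_nonneg c)
  have b4 := mul_le_mul_of_nonneg_left b2 (sq_nonneg c)
  linarith

/-- The mean square of the displacement of the consensus error in one step. -/
theorem integral_energy_step_sub_le (S : StepModel m m' μ A ξ β ρ₀ ρ₁) (hN : 0 < N)
    (h1 : A1 f σ b) (c : ℝ) (hy : Measurable[m] y)
    (hyi : Integrable (fun ω => sqNorm (y ω)) μ) :
    Integrable (fun ω => energy (step c f (A ω) (ξ ω) (y ω) - y ω)) μ ∧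
    ∫ ω, energy (step c f (A ω) (ξ ω) (y ω) - y ω) ∂μ ≤ 2 * c ^ 2 *
      (ρ₀ ^ 2 * ∫ ω, energy (y ω) ∂μ + β * (ρ₁ * (4 * maxEntry σ ^ 2 * ∫ ω, energy (y ω) ∂μ
        + 2 * maxEntry b ^ 2))) := by
  have hm := S.le.trans S.le'
  have hf : ∀ j i, Measurable (f j i) := fun j i => (h1 j i).1
  have hA := S.measA.mono S.le' le_rfl
  have hy0 := hy.mono hm le_rfl
  obtain ⟨i1, b1⟩ := S.lapMoment (fun ω => energy_nonneg (y ω)) (measurable_energy hy)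
    (integrable_energy hN hy0 hyi)
  obtain ⟨i2, b2⟩ := S.noise_majorant_one hN (maxEntry σ) (maxEntry b) hy hyi
  have i3 := ((i1.add i2).const_mul (2 * c ^ 2))
  have hle : ∀ ω, energy (step c f (A ω) (ξ ω) (y ω) - y ω) ≤ 2 * c ^ 2 *
      (energy (y ω) * norm2 (lap (A ω)) ^ 2 +
        intensity (maxEntry σ) (maxEntry b) (y ω) * edgeWeight (A ω) * noiseSq (ξ ω)) := fun ω => by
    refine (energy_step_sub_le hN c f (A ω) (ξ ω) (y ω)).trans ?_
    rw [mul_add, mul_comm (energy (y ω))]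
    exact add_le_add le_rfl (mul_le_mul_of_nonneg_left
      (sqNorm_noiseVec_le (h1.sq_le (y ω)) _ _) (by positivity))
  have hmeas : Measurable fun ω => energy (step c f (A ω) (ξ ω) (y ω) - y ω) :=
    measurable_energy ((measurable_step c hf hA S.measNoise hy0).sub hy0)
  have i4 : Integrable (fun ω => energy (step c f (A ω) (ξ ω) (y ω) - y ω)) μ :=
    i3.mono' hmeas.aestronglyMeasurable (ae_of_all _ fun ω => by
      rw [Real.norm_eq_abs, abs_of_nonneg (energy_nonneg _)]; exact hle ω)
  refine ⟨i4, (integral_mono i4 i3 hle).trans ?_⟩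
  rw [integral_const_mul]
  simp only [Pi.add_apply]
  rw [integral_add i1 i2]
  exact mul_le_mul_of_nonneg_left (add_le_add b1 b2) (by positivity)

/-- The average of the states is a martingale. -/
theorem integral_mul_mean_step_sub (S : StepModel m m' μ A ξ β ρ₀ ρ₁) (hN : 0 < N)
    (h1 : A1 f σ b) (c : ℝ) (hy : Measurable[m] y)
    (hyi : Integrable (fun ω => sqNorm (y ω)) μ) {U : Ω → ℝ} (hU : Measurable[m] U)
    (hU2 : MemLp U 2 μ) :
    ∫ ω, U ω * (mean (step c f (A ω) (ξ ω) (y ω)) - mean (y ω)) ∂μ = 0 := by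
  have hm := S.le.trans S.le'
  have hA := S.measA.mono S.le' le_rfl
  have hy0 := hy.mono hm le_rfl
  have hN2 := fun i => S.integral_mul_noiseVec hN h1 hy hyi (hU.mono S.le le_rfl) hU2 i
  have hdm : ∀ i, Measurable fun ω => degIn (A ω) i - degOut (A ω) i := fun i => by
    unfold degIn degOut; fun_prop
  have hdi : ∀ i, Integrable (fun ω => degIn (A ω) i - degOut (A ω) i) μ := fun i =>
    (integrable_finsetSum _ fun j _ => S.intA i j).sub
      (integrable_finsetSum _ fun j _ => S.intA j i)
  have hgm : ∀ i, Measurable[m] fun ω => U ω * y ω i := fun i =>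
    hU.mul (measurable_coord hy i)
  have iM := (S.lapMoment (fun ω => sqNorm_nonneg (y ω)) (measurable_sqNorm hy) hyi).1
  have hint : ∀ i, Integrable (fun ω => U ω * y ω i * (degIn (A ω) i - degOut (A ω) i)) μ := by
    intro i
    refine (hU2.integrable_sq.add (iM.const_mul ((N : ℝ) ^ 2))).mono'
      (((hgm i).mono hm le_rfl).mul (hdm i)).aestronglyMeasurable (ae_of_all _ fun ω => ?_)
    rw [Real.norm_eq_abs, Pi.add_apply, mul_assoc]
    have e1 := mul_le_mul (sq_le_sqNorm (y ω) i) (imbalance_sq_le (A ω) i) (sq_nonneg _)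
      (sqNorm_nonneg _)
    rw [← mul_pow] at e1
    set w := y ω i * (degIn (A ω) i - degOut (A ω) i)
    refine le_trans ?_ (add_le_add_right (e1.trans_eq (by ring)) _)
    rw [abs_le]
    constructor <;> nlinarith [sq_nonneg (U ω - w), sq_nonneg (U ω + w)]
  have e : ∀ ω, U ω * (mean (step c f (A ω) (ξ ω) (y ω)) - mean (y ω)) = (c / N) *
      (∑ i, U ω * noiseVec f (A ω) (ξ ω) (y ω) i
        - ∑ i, U ω * y ω i * (degIn (A ω) i - degOut (A ω) i)) := fun ω => by
    rw [mean_step]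
    simp only [mul_assoc (U ω), ← Finset.mul_sum]
    ring
  simp_rw [e]
  rw [integral_const_mul, integral_sub (integrable_finsetSum _ fun i _ => (hN2 i).1)
    (integrable_finsetSum _ fun i _ => hint i), integral_finsetSum _ fun i _ => (hN2 i).1,
    integral_finsetSum _ fun i _ => hint i, Finset.sum_eq_zero fun i _ => (hN2 i).2,
    Finset.sum_eq_zero fun i _ => integral_mul_eq_zero_of_condExp hm (hgm i).stronglyMeasurable
      (hdi i) (hint i) (S.condExp_imbalance i)]
  simp

/-- The mean square of the increment of the average. -/
theorem integral_mean_step_sq_le (S : StepModel m m' μ A ξ β ρ₀ ρ₁) (hN : 0 < N)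
    (h1 : A1 f σ b) (c : ℝ) (hy : Measurable[m] y)
    (hyi : Integrable (fun ω => sqNorm (y ω)) μ) {ρ₂ : ℝ}
    (h2 : ∀ i, CondBound μ m (fun ω => (degIn (A ω) i - degOut (A ω) i) ^ 2) ρ₂) :
    ∫ ω, (mean (step c f (A ω) (ξ ω) (y ω)) - mean (y ω)) ^ 2 ∂μ ≤ 2 * c ^ 2 / (N : ℝ) ^ 2 *
      (β * (ρ₁ * (4 * maxEntry σ ^ 2 * ∫ ω, energy (y ω) ∂μ + 2 * maxEntry b ^ 2))
        + N * (ρ₂ * ∫ ω, sqNorm (y ω) ∂μ)) := by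
  have hm := S.le.trans S.le'
  obtain ⟨i2, b2⟩ := S.noise_majorant_one hN (maxEntry σ) (maxEntry b) hy hyi
  have h3 := fun i => (h2 i).mul hm (fun _ => sq_nonneg _) (fun ω => sqNorm_nonneg (y ω))
    (measurable_sqNorm hy).stronglyMeasurable hyi
  have i4 := i2.add (integrable_finsetSum Finset.univ fun i _ => (h3 i).1)
  have hle : ∀ ω, (mean (step c f (A ω) (ξ ω) (y ω)) - mean (y ω)) ^ 2 ≤ 2 * c ^ 2 / (N : ℝ) ^ 2 *
      (intensity (maxEntry σ) (maxEntry b) (y ω) * edgeWeight (A ω) * noiseSq (ξ ω)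
        + ∑ i, sqNorm (y ω) * (degIn (A ω) i - degOut (A ω) i) ^ 2) := fun ω => by
    refine (mean_step_sq_le c f (A ω) (ξ ω) (y ω)).trans ?_
    rw [Finset.mul_sum]
    exact mul_le_mul_of_nonneg_left (add_le_add
      (sum_noiseVec_sq_le (h1.sq_le (y ω)) _ _) le_rfl) (by positivity)
  refine (integral_mono_of_nonneg (ae_of_all _ fun ω => sq_nonneg _)
    (i4.const_mul (2 * c ^ 2 / (N : ℝ) ^ 2)) (ae_of_all _ hle)).trans ?_
  rw [integral_const_mul]
  simp only [Pi.add_apply]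
  rw [integral_add i2 (integrable_finsetSum Finset.univ fun i _ => (h3 i).1),
    integral_finsetSum _ fun i _ => (h3 i).1]
  refine mul_le_mul_of_nonneg_left (add_le_add b2 ?_) (by positivity)
  calc _ ≤ ∑ _i : Fin N, ρ₂ * ∫ ω, sqNorm (y ω) ∂μ := Finset.sum_le_sum fun i _ => (h3 i).2
    _ = _ := by simp

end StepModel

/-! ### Energy estimates and forms conditioned at an earlier time. -/

namespace StepModel

variable {Ω : Type*} {m₁ m m' : MeasurableSpace Ω} [m0 : MeasurableSpace Ω]
  {μ : Measure Ω} [IsProbabilityMeasure μ] {N : ℕ} {A ξ : Ω → Fin N → Fin N → ℝ} {β ρ₀ ρ₁ : ℝ}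
  {y : Ω → Fin N → ℝ} {Z : Ω → ℝ}
  {f : Fin N → Fin N → ℝ → ℝ} {σ b : Fin N → Fin N → ℝ}

theorem integrable_sqNorm_step (S : StepModel m m' μ A ξ β ρ₀ ρ₁) (hN : 0 < N) (h1 : A1 f σ b)
    (c : ℝ) (hy : Measurable[m] y) (hyi : Integrable (fun ω => sqNorm (y ω)) μ) :
    Integrable (fun ω => sqNorm (step c f (A ω) (ξ ω) (y ω))) μ := by
  simpa using (S.integral_sqNorm_step_le hN h1 c (Z := fun _ => 1) hy hyi measurable_const
    (fun _ => zero_le_one) (fun _ => le_rfl)).1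

theorem integral_sqNorm_step_le_of_past (S : StepModel m m' μ A ξ β ρ₀ ρ₁) (hN : 0 < N)
    (h1 : A1 f σ b) {c : ℝ} (hc : 0 ≤ c) (hy : Measurable[m] y)
    (hyi : Integrable (fun ω => sqNorm (y ω)) μ) :
    ∫ ω, sqNorm (step c f (A ω) (ξ ω) (y ω)) ∂μ ≤ (1 + c ^ 2 * ρ₀ ^ 2) * ∫ ω, sqNorm (y ω) ∂μ
      + c ^ 2 * (β * (ρ₁ * (4 * maxEntry σ ^ 2 * ∫ ω, energy (y ω) ∂μ + 2 * maxEntry b ^ 2))) := by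
  have h := (S.integral_sqNorm_step_le hN h1 c (Z := fun _ => 1) hy hyi measurable_const
    (fun _ => zero_le_one) (fun _ => le_rfl)).2
  simp only [one_mul] at h
  rw [integral_intensity hN _ _ (hy.mono (S.le.trans S.le') le_rfl) hyi] at h
  have := mul_nonneg hc (S.integral_lapForm_nonneg hy hyi)
  linarith

/-- The weighted energy inequality for one step. -/
theorem integral_mul_energy_step_le (S : StepModel m m' μ A ξ β ρ₀ ρ₁) (hN : 0 < N)
    (h1 : A1 f σ b) (c : ℝ) (hy : Measurable[m] y)
    (hyi : Integrable (fun ω => sqNorm (y ω)) μ)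
    (hZ : Measurable[m] Z) (hZ0 : ∀ ω, 0 ≤ Z ω) (hZ1 : ∀ ω, Z ω ≤ 1) :
    ∫ ω, Z ω * energy (step c f (A ω) (ξ ω) (y ω)) ∂μ ≤
      (1 + c ^ 2 * ρ₀ ^ 2) * ∫ ω, Z ω * energy (y ω) ∂μ
      - 2 * c * ∫ ω, Z ω * lapForm (A ω) (consErr (y ω)) ∂μ
      + c ^ 2 * (β * (ρ₁ * ∫ ω, Z ω * intensity (maxEntry σ) (maxEntry b) (y ω) ∂μ)) := by
  have hm := S.le.trans S.le'
  have hδ := measurable_consErr hy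
  have hδi : Integrable (fun ω => sqNorm (consErr (y ω))) μ :=
    integrable_energy hN (hy.mono hm le_rfl) hyi
  obtain ⟨i1, b1⟩ := S.integral_sqNorm_step_le hN h1 c hδ hδi hZ hZ0 hZ1
  have e : ∀ ω, intensity (maxEntry σ) (maxEntry b) (consErr (y ω))
      = intensity (maxEntry σ) (maxEntry b) (y ω) := fun ω => by
    rw [intensity, intensity, energy_consErr hN]
  simp_rw [e] at b1
  refine le_trans (integral_mono_of_nonneg (ae_of_all _ fun ω =>
    mul_nonneg (hZ0 ω) (energy_nonneg _)) i1 (ae_of_all _ fun ω => ?_)) b1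
  exact mul_le_mul_of_nonneg_left (energy_step_le hN _ _ _ _ _) (hZ0 ω)

theorem integral_energy_step_le (S : StepModel m m' μ A ξ β ρ₀ ρ₁) (hN : 0 < N)
    (h1 : A1 f σ b) (c : ℝ) (hy : Measurable[m] y)
    (hyi : Integrable (fun ω => sqNorm (y ω)) μ) :
    ∫ ω, energy (step c f (A ω) (ξ ω) (y ω)) ∂μ ≤
      (1 + c ^ 2 * ρ₀ ^ 2) * ∫ ω, energy (y ω) ∂μ
      - 2 * c * ∫ ω, lapForm (A ω) (consErr (y ω)) ∂μ
      + c ^ 2 * (β * (ρ₁ * (4 * maxEntry σ ^ 2 * ∫ ω, energy (y ω) ∂μ + 2 * maxEntry b ^ 2))) := by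
  have h := S.integral_mul_energy_step_le hN h1 c (Z := fun _ => 1) hy hyi measurable_const
    (fun _ => zero_le_one) (fun _ => le_rfl)
  simp only [one_mul] at h
  rwa [integral_intensity hN _ _ (hy.mono (S.le.trans S.le') le_rfl) hyi] at h

theorem rho1_nonneg (S : StepModel m m' μ A ξ β ρ₀ ρ₁) : 0 ≤ ρ₁ :=
  S.edgeBound.nonneg fun _ => edgeWeight_nonneg _

theorem beta_nonneg (S : StepModel m m' μ A ξ β ρ₀ ρ₁) : 0 ≤ β :=
  S.noiseBound.nonneg fun _ => noiseSq_nonneg _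

theorem integrable_symLap (S : StepModel m m' μ A ξ β ρ₀ ρ₁) (i j : Fin N) :
    Integrable (fun ω => symLap (A ω) i j) μ := by
  have hl : ∀ i j, Integrable (fun ω => lap (A ω) i j) μ := fun i j => by
    simp only [lap, Matrix.sub_apply, Matrix.of_apply, Matrix.diagonal_apply]
    refine Integrable.sub ?_ (S.intA i j)
    split_ifs
    · exact integrable_finsetSum _ fun k _ => S.intA i k
    · exact integrable_const _
  simp_rw [symLap_apply]
  exact ((hl i j).add (hl j i)).const_mul _

/-- The expected Laplacian form at a vector known at an earlier time. -/
theorem integral_lapForm_eq_condMat (S : StepModel m m' μ A ξ β ρ₀ ρ₁)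
    (hm₁ : m₁ ≤ m) (hy : Measurable[m₁] y) (hyi : Integrable (fun ω => sqNorm (y ω)) μ) :
    Integrable (fun ω => ∑ i, ∑ j, y ω i * y ω j *
      condMat μ m₁ (fun ω' => symLap (A ω')) ω i j) μ ∧
    ∫ ω, lapForm (A ω) (y ω) ∂μ = ∫ ω, ∑ i, ∑ j, y ω i * y ω j *
      condMat μ m₁ (fun ω' => symLap (A ω')) ω i j ∂μ := by
  have hm := S.le.trans S.le'
  have hA := S.measA.mono S.le' le_rfl
  have h2 := (S.lapMoment (fun ω => sqNorm_nonneg (y ω))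
    (measurable_sqNorm (hy.mono hm₁ le_rfl)) hyi).1
  have hgm : ∀ i j, Measurable[m₁] fun ω => y ω i * y ω j := fun i j =>
    (measurable_coord hy i).mul (measurable_coord hy j)
  have hint : ∀ i j, Integrable (fun ω => y ω i * y ω j * symLap (A ω) i j) μ := by
    intro i j
    refine (hyi.add h2).mono' (((hgm i j).mono (hm₁.trans hm) le_rfl).aestronglyMeasurable.mul
      (S.integrable_symLap i j).aestronglyMeasurable) (ae_of_all _ fun ω => ?_)
    rw [Real.norm_eq_abs, abs_mul, Pi.add_apply]
    have e1 : |y ω i * y ω j| ≤ sqNorm (y ω) := by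
      have a1 := sq_le_sqNorm (y ω) i
      have a2 := sq_le_sqNorm (y ω) j
      rw [abs_le]
      constructor <;> nlinarith [sq_nonneg (y ω i - y ω j), sq_nonneg (y ω i + y ω j)]
    have e2 : |symLap (A ω) i j| ≤ 1 + norm2 (lap (A ω)) ^ 2 := by
      have a1 := entry_sq_le (lap (A ω)) i j
      have a2 := entry_sq_le (lap (A ω)) j i
      rw [symLap_apply, abs_le]
      constructor <;> nlinarith [sq_nonneg (lap (A ω) i j - 1), sq_nonneg (lap (A ω) j i - 1),
        sq_nonneg (lap (A ω) i j + 1), sq_nonneg (lap (A ω) j i + 1)]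
    calc |y ω i * y ω j| * |symLap (A ω) i j|
        ≤ sqNorm (y ω) * (1 + norm2 (lap (A ω)) ^ 2) :=
          mul_le_mul e1 e2 (abs_nonneg _) (sqNorm_nonneg _)
      _ = _ := by ring
  have hint' : ∀ i j, Integrable (fun ω => y ω i * y ω j *
      condMat μ m₁ (fun ω' => symLap (A ω')) ω i j) μ := fun i j =>
    integrable_mul_condExp (hgm i j).stronglyMeasurable (S.integrable_symLap i j) (hint i j)
  refine ⟨integrable_finsetSum _ fun i _ => integrable_finsetSum _ fun j _ => hint' i j, ?_⟩
  rw [integral_congr_ae (ae_of_all _ fun ω => lapForm_eq_symLap (A ω) (y ω)),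
    integral_finsetSum _ fun i _ => integrable_finsetSum _ fun j _ => hint i j,
    integral_finsetSum _ fun i _ => integrable_finsetSum _ fun j _ => hint' i j]
  refine Finset.sum_congr rfl fun i _ => ?_
  rw [integral_finsetSum _ fun j _ => hint i j, integral_finsetSum _ fun j _ => hint' i j]
  exact Finset.sum_congr rfl fun j _ => integral_mul_condExp (hm₁.trans hm)
    (hgm i j).stronglyMeasurable (S.integrable_symLap i j) (hint i j)

/-- A row sum of the symmetrized Laplacian is half the imbalance of the node. The latter is centred
given `m`, hence by the tower property given any earlier `m₁`. -/
theorem sum_condMat_symLap_row (S : StepModel m m' μ A ξ β ρ₀ ρ₁)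
    (hm₁ : m₁ ≤ m) (i : Fin N) :
    ∀ᵐ ω ∂μ, ∑ j, condMat μ m₁ (fun ω' => symLap (A ω')) ω i j = 0 := by
  have h1 := condExp_finsetSum (s := Finset.univ) (fun j _ => S.integrable_symLap i j) m₁
  have h2 : (∑ j, fun ω => symLap (A ω) i j)
      = (1 / 2 : ℝ) • fun ω => degIn (A ω) i - degOut (A ω) i := by
    funext ω
    simp only [Finset.sum_apply, sum_symLap_row, Pi.smul_apply, smul_eq_mul]
  have h3 := condExp_smul (μ := μ) (1 / 2 : ℝ) (fun ω => degIn (A ω) i - degOut (A ω) i) m₁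
  have h4 := condExp_condExp_of_le (μ := μ) (f := fun ω => degIn (A ω) i - degOut (A ω) i) hm₁
    (S.le.trans S.le')
  have h5 := (condExp_congr_ae (m := m₁) (S.condExp_imbalance i)).trans
    (by rw [condExp_zero])
  rw [h2] at h1
  filter_upwards [h1, h3, h4, h5] with ω h1 h3 h4 h5
  simp only [condMat, Matrix.of_apply]
  rw [h3, Finset.sum_apply, Pi.smul_apply, ← h4, h5] at h1
  rw [← h1]
  simp

end StepModel

/-! ### Uniform moment bounds and decay over a block. -/

section Dynamics

variable {Ω : Type*} {F F' : ℕ → MeasurableSpace Ω} [m0 : MeasurableSpace Ω]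
  {μ : Measure Ω} [IsProbabilityMeasure μ] {N : ℕ} {A ξ : ℕ → Ω → Fin N → Fin N → ℝ}
  {β ρ₀ ρ₁ : ℝ} {f : Fin N → Fin N → ℝ → ℝ} {σ b : Fin N → Fin N → ℝ} {c : ℕ → ℝ}
  {x0 : Fin N → ℝ}

theorem integrable_sqNorm_state (hN : 0 < N) (h1 : A1 f σ b)
    (S : ∀ k, StepModel (F k) (F' k) μ (A k) (ξ k) β ρ₀ ρ₁)
    (hX : ∀ k, Measurable[F k] (state c f A ξ x0 k)) (k : ℕ) :
    Integrable (fun ω => sqNorm (state c f A ξ x0 k ω)) μ := by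
  induction k with
  | zero => exact integrable_const (sqNorm x0)
  | succ k ih =>
    simp_rw [state_succ]
    exact (S k).integrable_sqNorm_step hN h1 (c k) (hX k) ih

theorem integrable_energy_state (hN : 0 < N) (h1 : A1 f σ b)
    (S : ∀ k, StepModel (F k) (F' k) μ (A k) (ξ k) β ρ₀ ρ₁)
    (hX : ∀ k, Measurable[F k] (state c f A ξ x0 k)) (k : ℕ) :
    Integrable (fun ω => energy (state c f A ξ x0 k ω)) μ :=
  integrable_energy hN ((hX k).mono ((S k).le.trans (S k).le') le_rfl)
    (integrable_sqNorm_state hN h1 S hX k)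

/-- Grönwall, after discarding the nonnegative expected Laplacian form. The energy part of the noise
intensity goes into the rate, the constant part into the source. -/
theorem integral_energy_le_qv (hN : 0 < N) (h1 : A1 f σ b) (hc : ∀ k, 0 ≤ c k)
    (hcs : Summable fun k => c k ^ 2)
    (S : ∀ k, StepModel (F k) (F' k) μ (A k) (ξ k) β ρ₀ ρ₁)
    (hX : ∀ k, Measurable[F k] (state c f A ξ x0 k)) (k : ℕ) :
    ∫ ω, energy (state c f A ξ x0 k ω) ∂μ
      ≤ qv (∑' k, c k ^ 2) ρ₀ ρ₁ β (maxEntry σ) (maxEntry b) (energy x0) := by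
  have hρ := (S 0).rho1_nonneg
  have hβ := (S 0).beta_nonneg
  have e0 : ∫ ω, energy (state c f A ξ x0 0 ω) ∂μ = energy x0 := by simp [state]
  have h := discrete_gronwall (u := fun k => ∫ ω, energy (state c f A ξ x0 k ω) ∂μ)
    (g := fun k => c k ^ 2) (p := ρ₀ ^ 2 + 4 * ρ₁ * β * maxEntry σ ^ 2)
    (q := 2 * β * ρ₁ * maxEntry b ^ 2) (fun k => sq_nonneg _) hcs (by positivity) (by positivity)
    (integral_nonneg fun ω => energy_nonneg _) (fun k => ?_) k
  · rw [e0] at h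
    refine h.trans_eq ?_
    rw [qv]; ring
  · simp_rw [state_succ]
    have h2 := (S k).integral_energy_step_le hN h1 (c k) (hX k)
      (integrable_sqNorm_state hN h1 S hX k)
    have hδi : Integrable (fun ω => sqNorm (consErr (state c f A ξ x0 k ω))) μ :=
      integrable_energy_state hN h1 S hX k
    have h3 := mul_nonneg (hc k) ((S k).integral_lapForm_nonneg (measurable_consErr (hX k)) hδi)
    linarith

theorem integral_sqNorm_le_qx (hN : 0 < N) (h1 : A1 f σ b) (hc : ∀ k, 0 ≤ c k)
    (hcs : Summable fun k => c k ^ 2)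
    (S : ∀ k, StepModel (F k) (F' k) μ (A k) (ξ k) β ρ₀ ρ₁)
    (hX : ∀ k, Measurable[F k] (state c f A ξ x0 k)) (k : ℕ) :
    ∫ ω, sqNorm (state c f A ξ x0 k ω) ∂μ
      ≤ qx (∑' k, c k ^ 2) ρ₀ ρ₁ β (maxEntry σ) (maxEntry b) (energy x0) (sqNorm x0) := by
  have hρ := (S 0).rho1_nonneg
  have hβ := (S 0).beta_nonneg
  have hqv := integral_energy_le_qv hN h1 hc hcs S hX
  set q := qv (∑' k, c k ^ 2) ρ₀ ρ₁ β (maxEntry σ) (maxEntry b) (energy x0) with hq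
  have hq0 : 0 ≤ q := (integral_nonneg fun ω => energy_nonneg _).trans (hqv 0)
  have e0 : ∫ ω, sqNorm (state c f A ξ x0 0 ω) ∂μ = sqNorm x0 := by simp [state]
  have h := discrete_gronwall (u := fun k => ∫ ω, sqNorm (state c f A ξ x0 k ω) ∂μ)
    (g := fun k => c k ^ 2) (p := ρ₀ ^ 2)
    (q := 2 * β * ρ₁ * (2 * maxEntry σ ^ 2 * q + maxEntry b ^ 2)) (fun k => sq_nonneg _) hcs
    (by positivity) (by positivity)
    (integral_nonneg fun ω => sqNorm_nonneg _) (fun k => ?_) k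
  · rw [e0] at h
    refine h.trans_eq ?_
    rw [qx, ← hq]; ring
  · simp_rw [state_succ]
    refine ((S k).integral_sqNorm_step_le_of_past hN h1 (hc k) (hX k)
      (integrable_sqNorm_state hN h1 S hX k)).trans ?_
    have h3 : c k ^ 2 * (β * (ρ₁ * (4 * maxEntry σ ^ 2 * ∫ ω, energy (state c f A ξ x0 k ω) ∂μ
        + 2 * maxEntry b ^ 2))) ≤ c k ^ 2 * (β * (ρ₁ * (4 * maxEntry σ ^ 2 * q
        + 2 * maxEntry b ^ 2))) := by
      have := hqv k
      gcongr
    linarith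

/-- The decay of the expected energy over a block of `h` steps on which the expected Laplacian
forms at the initial consensus error are jointly coercive. -/
theorem integral_energy_block_le (hN : 0 < N) (h1 : A1 f σ b) (hc : ∀ k, 0 ≤ c k)
    (hanti : Antitone c) (hF : Monotone F)
    (S : ∀ k, StepModel (F k) (F' k) μ (A k) (ξ k) β ρ₀ ρ₁)
    (hX : ∀ k, Measurable[F k] (state c f A ξ x0 k)) {M : ℝ}
    (hM : ∀ k, ∫ ω, energy (state c f A ξ x0 k ω) ∂μ ≤ M) {h t : ℕ} {θ : ℝ}
    (hconn : θ * ∫ ω, energy (state c f A ξ x0 t ω) ∂μ ≤ ∑ n ∈ Finset.range h,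
      ∫ ω, lapForm (A (t + n) ω) (consErr (state c f A ξ x0 t ω)) ∂μ) :
    ∫ ω, energy (state c f A ξ x0 (t + h) ω) ∂μ ≤ ∫ ω, energy (state c f A ξ x0 t ω) ∂μ
      - c (t + h) * θ * ∫ ω, energy (state c f A ξ x0 t ω) ∂μ
      + h * ((ρ₀ ^ 2 * M + β * (ρ₁ * (4 * maxEntry σ ^ 2 * M + 2 * maxEntry b ^ 2)))
        * (1 + 2 * c 0 * (1 + ρ₀ ^ 2) * 4 ^ h)) * c t ^ 2 := by
  have hρ := (S 0).rho1_nonneg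
  have hβ := (S 0).beta_nonneg
  have hm : ∀ k, F k ≤ m0 := fun k => (S k).le.trans (S k).le'
  have hM0 : 0 ≤ M := (integral_nonneg fun ω => energy_nonneg _).trans (hM 0)
  set X := state c f A ξ x0 with hXdef
  set D := ρ₀ ^ 2 * M + β * (ρ₁ * (4 * maxEntry σ ^ 2 * M + 2 * maxEntry b ^ 2)) with hD
  have hD0 : 0 ≤ D := by positivity
  have hDk : ∀ k, ρ₀ ^ 2 * ∫ ω, energy (X k ω) ∂μ + β * (ρ₁ * (4 * maxEntry σ ^ 2 *
      ∫ ω, energy (X k ω) ∂μ + 2 * maxEntry b ^ 2)) ≤ D := fun k => by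
    have := hM k
    rw [hD]; gcongr
  have hXi := integrable_sqNorm_state (c := c) (x0 := x0) hN h1 S hX
  have hδ : ∀ k, Measurable[F k] fun ω => consErr (X k ω) := fun k => measurable_consErr (hX k)
  have hδi : ∀ k, Integrable (fun ω => sqNorm (consErr (X k ω))) μ :=
    integrable_energy_state hN h1 S hX
  set B : ℕ → ℝ := fun n => ∫ ω, lapForm (A (t + n) ω) (consErr (X t ω)) ∂μ with hB
  have hδt : ∀ n, Measurable[F (t + n)] fun ω => consErr (X t ω) := fun n =>
    (hδ t).mono (hF (Nat.le_add_right _ _)) le_rfl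
  have hB0 : ∀ n, 0 ≤ B n := fun n => (S (t + n)).integral_lapForm_nonneg (hδt n) (hδi t)
  have hct : ∀ n, c (t + n) ^ 2 ≤ c t ^ 2 := fun n =>
    pow_le_pow_left₀ (hc _) (hanti (Nat.le_add_right _ _)) 2
  -- Drift of the consensus error within the block. One step gives `Δₙ₊₁ ≤ 2 Δₙ + 4 c(t)² D`, which
  -- the crude growth rate 4 absorbs.
  have hΔ : ∀ n, Integrable (fun ω => energy (X t ω - X (t + n) ω)) μ ∧
      ∫ ω, energy (X t ω - X (t + n) ω) ∂μ ≤ 4 ^ (n + 1) * (c t ^ 2 * D) := by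
    intro n
    induction n with
    | zero =>
      have : ∀ ω, energy (X t ω - X (t + 0) ω) = 0 := fun ω => by
        simp [energy, sqNorm, consErr]
      simp_rw [this]
      exact ⟨integrable_zero _ _ _, by simp only [integral_zero]; positivity⟩
    | succ n ih =>
      obtain ⟨i1, b1⟩ := ih
      obtain ⟨i2, b2⟩ := (S (t + n)).integral_energy_step_sub_le hN h1 (c (t + n)) (hX (t + n))
        (hXi (t + n))
      have hle : ∀ ω, energy (X t ω - X (t + (n + 1)) ω) ≤ 2 * energy (X t ω - X (t + n) ω)
          + 2 * energy (step (c (t + n)) f (A (t + n) ω) (ξ (t + n) ω) (X (t + n) ω)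
            - X (t + n) ω) := fun ω => by
        rw [← add_assoc, hXdef, state_succ, ← hXdef]
        set w := step (c (t + n)) f (A (t + n) ω) (ξ (t + n) ω) (X (t + n) ω)
        have e1 : consErr (X t ω - w) = consErr (X t ω - X (t + n) ω) +
            (-consErr (w - X (t + n) ω)) := by
          simp only [consErr_sub]; abel
        have e2 : sqNorm (-consErr (w - X (t + n) ω)) = energy (w - X (t + n) ω) := by
          simp [energy, sqNorm]
        rw [energy, e1, ← e2]
        exact sqNorm_add_le _ _
      have i3 := (i1.const_mul 2).add (i2.const_mul 2)
      have hmeas : Measurable fun ω => energy (X t ω - X (t + (n + 1)) ω) :=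
        measurable_energy (((hX t).mono (hm _) le_rfl).sub ((hX _).mono (hm _) le_rfl))
      have i4 : Integrable (fun ω => energy (X t ω - X (t + (n + 1)) ω)) μ :=
        i3.mono' hmeas.aestronglyMeasurable (ae_of_all _ fun ω => by
          rw [Real.norm_eq_abs, abs_of_nonneg (energy_nonneg _)]; exact hle ω)
      refine ⟨i4, (integral_mono i4 i3 hle).trans ?_⟩
      simp only [Pi.add_apply]
      rw [integral_add (i1.const_mul 2) (i2.const_mul 2), integral_const_mul, integral_const_mul]
      have b3 : 2 * c (t + n) ^ 2 * (ρ₀ ^ 2 * ∫ ω, energy (X (t + n) ω) ∂μ + β * (ρ₁ *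
          (4 * maxEntry σ ^ 2 * ∫ ω, energy (X (t + n) ω) ∂μ + 2 * maxEntry b ^ 2)))
          ≤ 2 * c t ^ 2 * D := by
        refine mul_le_mul (mul_le_mul_of_nonneg_left (hct n) zero_le_two) (hDk _) ?_
          (by positivity)
        have : 0 ≤ ∫ ω, energy (X (t + n) ω) ∂μ := integral_nonneg fun ω => energy_nonneg _
        positivity
      have b4 : (1:ℝ) ≤ 4 ^ n := one_le_pow₀ (by norm_num)
      have b5 : 0 ≤ c t ^ 2 * D := by positivity
      have b6 := mul_le_mul_of_nonneg_right b4 b5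
      have b7 : (4:ℝ) ^ (n + 1 + 1) * (c t ^ 2 * D) = 16 * (4 ^ n * (c t ^ 2 * D)) := by ring
      have b8 : (4:ℝ) ^ (n + 1) * (c t ^ 2 * D) = 4 * (4 ^ n * (c t ^ 2 * D)) := by ring
      rw [b7]; rw [b8] at b1
      linarith [b2.trans b3]
  -- Comparing the current form with the one at the frozen vector costs half of the coefficient
  -- `2c`. Since `B n` is nonnegative, the gain may then be lowered to its value at the end of the
  -- block, uniformly in `n`.
  have hstep : ∀ n < h, ∫ ω, energy (X (t + (n + 1)) ω) ∂μ ≤ ∫ ω, energy (X (t + n) ω) ∂μ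
      - c (t + h) * B n + (D * (1 + 2 * c 0 * (1 + ρ₀ ^ 2) * 4 ^ h)) * c t ^ 2 := by
    intro n hn
    have b1 := (S (t + n)).integral_energy_step_le hN h1 (c (t + n)) (hX (t + n)) (hXi (t + n))
    have b2 := (S (t + n)).integral_lapForm_le_two_mul (hδt n) (hδi t) (hδ (t + n)) (hδi (t + n))
    have e1 : ∀ ω, sqNorm (consErr (X t ω) - consErr (X (t + n) ω)) = energy (X t ω - X (t + n) ω) :=
      fun ω => by rw [energy, consErr_sub]
    simp_rw [e1] at b2
    have b3 := mul_le_mul_of_nonneg_left b2 (hc (t + n))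
    have b4 : c (t + h) * B n ≤ c (t + n) * B n :=
      mul_le_mul_of_nonneg_right (hanti (Nat.add_le_add_left hn.le _)) (hB0 n)
    have b5 : c (t + n) * (2 * (1 + ρ₀ ^ 2) * ∫ ω, energy (X t ω - X (t + n) ω) ∂μ)
        ≤ c 0 * (2 * (1 + ρ₀ ^ 2) * (4 ^ h * (c t ^ 2 * D))) := by
      have b6 : ∫ ω, energy (X t ω - X (t + n) ω) ∂μ ≤ 4 ^ h * (c t ^ 2 * D) := by
        refine (hΔ n).2.trans (mul_le_mul_of_nonneg_right ?_ (by positivity))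
        exact pow_le_pow_right₀ (by norm_num) hn
      have b7 : c (t + n) ≤ c 0 := hanti (Nat.zero_le _)
      refine mul_le_mul b7 (mul_le_mul_of_nonneg_left b6 (by positivity)) ?_ (hc 0)
      exact mul_nonneg (by positivity) (integral_nonneg fun ω => energy_nonneg _)
    have b8 := mul_le_mul (hct n) (hDk (t + n)) (by
      have : 0 ≤ ∫ ω, energy (X (t + n) ω) ∂μ := integral_nonneg fun ω => energy_nonneg _
      positivity) (sq_nonneg _)
    rw [← add_assoc]
    simp_rw [hXdef, state_succ, ← hXdef]
    simp only [hXdef] at b1 b3 b4 b5 b8 ⊢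
    simp only [hB, hXdef] at b4 ⊢
    linarith
  have hsum : ∀ n ≤ h, ∫ ω, energy (X (t + n) ω) ∂μ ≤ ∫ ω, energy (X t ω) ∂μ
      - c (t + h) * ∑ j ∈ Finset.range n, B j
      + n * (D * (1 + 2 * c 0 * (1 + ρ₀ ^ 2) * 4 ^ h)) * c t ^ 2 := by
    intro n
    induction n with
    | zero => intro _; simp
    | succ n ih =>
      intro hn
      have := hstep n hn
      rw [Finset.sum_range_succ, Nat.cast_succ]
      linarith [ih (Nat.le_of_succ_le hn)]
  have h2 := hsum h le_rfl
  have h3 := mul_le_mul_of_nonneg_left hconn (hc (t + h))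
  linarith

end Dynamics

/-! ### Histories of the flow and of the noises. -/

section Past

variable {Ω E : Type*} [MeasurableSpace E] {Z : ℕ → Ω → E}

theorem measurable_past {j k : ℕ} (h : j < k) : Measurable[past Z k] (Z j) :=
  Measurable.mono (comap_measurable (Z j))
    (le_iSup (fun j : Fin k => MeasurableSpace.comap (Z j) inferInstance) ⟨j, h⟩) le_rfl

theorem past_mono : Monotone (past Z) := fun k l hkl => by
  refine iSup_le fun j => ?_
  exact (measurable_past (lt_of_lt_of_le j.2 hkl)).comap_le

theorem past_le_of_measurable {m : MeasurableSpace Ω} (hZ : ∀ k, Measurable[m] (Z k)) (k : ℕ) :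
    past Z k ≤ m := iSup_le fun j => (hZ j).comap_le

/-- The σ-algebra generated by a whole process. -/
@[reducible] def whole (Z : ℕ → Ω → E) : MeasurableSpace Ω :=
  MeasurableSpace.comap (fun ω k => Z k ω) inferInstance

theorem measurable_whole (k : ℕ) : Measurable[whole Z] (Z k) :=
  measurable_coord (m := whole Z) (y := fun ω k => Z k ω) (comap_measurable _) k

theorem past_le_whole (k : ℕ) : past Z k ≤ whole Z := past_le_of_measurable measurable_whole k

theorem whole_le {m : MeasurableSpace Ω} (hZ : ∀ k, Measurable[m] (Z k)) : whole Z ≤ m :=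
  (measurable_pi_lambda (fun ω k => Z k ω) hZ).comap_le

end Past

/-- The joint history of two processes before time `k`. -/
@[reducible] def history {Ω E E' : Type*} [MeasurableSpace E] [MeasurableSpace E']
    (Z : ℕ → Ω → E) (Z' : ℕ → Ω → E') (k : ℕ) : MeasurableSpace Ω := past Z k ⊔ past Z' k

theorem history_mono {Ω E E' : Type*} [MeasurableSpace E] [MeasurableSpace E']
    (Z : ℕ → Ω → E) (Z' : ℕ → Ω → E') : Monotone (history Z Z') := fun _ _ h =>
  sup_le_sup (past_mono h) (past_mono h)

theorem measurable_state {Ω : Type*} {N : ℕ} (c : ℕ → ℝ) {f : Fin N → Fin N → ℝ → ℝ}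
    (hf : ∀ j i, Measurable (f j i)) (A ξ : ℕ → Ω → Fin N → Fin N → ℝ) (x0 : Fin N → ℝ) (k : ℕ) :
    Measurable[history A ξ k] (state c f A ξ x0 k) := by
  induction k with
  | zero => exact measurable_const (a := x0)
  | succ k ih =>
    have e : state c f A ξ x0 (k + 1)
        = fun ω => step (c k) f (A k ω) (ξ k ω) (state c f A ξ x0 k ω) := by
      funext ω; exact state_succ _ _ _ _ _ _ _
    rw [e]
    exact measurable_step (m := history A ξ (k + 1)) (c k) hf
      ((measurable_past k.lt_succ_self).mono le_sup_left le_rfl)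
      ((measurable_past k.lt_succ_self).mono le_sup_right le_rfl)
      (ih.mono (history_mono A ξ k.le_succ) le_rfl)

/-! ### From high conditional moments to second ones. -/

section Moments

variable {Ω : Type*} {m : MeasurableSpace Ω} [m0 : MeasurableSpace Ω] {μ : Measure Ω}

theorem CondBound.of_le {g B : Ω → ℝ} {r : ℝ} [IsFiniteMeasure μ] (hB : CondBound μ m B r)
    (hg : AEStronglyMeasurable g μ) (hg0 : ∀ ω, 0 ≤ g ω) (hgB : ∀ ω, g ω ≤ B ω) :
    CondBound μ m g r := by
  have hi : Integrable g μ := hB.1.mono' hg (ae_of_all _ fun ω => by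
    rw [Real.norm_eq_abs, abs_of_nonneg (hg0 ω)]; exact hgB ω)
  refine ⟨hi, ?_⟩
  filter_upwards [condExp_mono (m := m) hi hB.1 (ae_of_all _ hgB), hB.2] with ω h1 h2
  exact h1.trans h2

theorem CondBound.const_mul {B : Ω → ℝ} {r : ℝ} (hB : CondBound μ m B r) {a : ℝ} (ha : 0 ≤ a) :
    CondBound μ m (fun ω => a * B ω) (a * r) := by
  refine ⟨hB.1.const_mul a, ?_⟩
  filter_upwards [condExp_smul (μ := μ) a B m, hB.2] with ω h1 h2
  have e : (fun ω => a * B ω) = a • B := rfl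
  rw [e, h1, Pi.smul_apply, smul_eq_mul]
  exact mul_le_mul_of_nonneg_left h2 ha

/-- Bounds on conditional moments pass to the square root. -/
theorem CondBound.of_sq [IsFiniteMeasure μ] (hm : m ≤ m0) {g : Ω → ℝ} {r : ℝ} (hr : 0 < r)
    (hg : Measurable g) (hB : CondBound μ m (fun ω => g ω ^ 2) (r ^ 2)) (hg0 : ∀ ω, 0 ≤ g ω) :
    CondBound μ m g r := by
  -- The tangent line to the square root at `r²`, which takes the place of conditional Jensen; its
  -- conditional expectation is at most `r`.
  have hle : ∀ ω, g ω ≤ (2 * r)⁻¹ * (g ω ^ 2 + r ^ 2) := fun ω => by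
    rw [inv_mul_eq_div, le_div_iff₀ (by positivity)]
    nlinarith [sq_nonneg (g ω - r)]
  have h1 : CondBound μ m (fun ω => g ω ^ 2 + r ^ 2) (2 * r ^ 2) := by
    refine ⟨hB.1.add (integrable_const _), ?_⟩
    have e : (fun ω => g ω ^ 2 + r ^ 2) = (fun ω => g ω ^ 2) + fun _ => r ^ 2 := rfl
    filter_upwards [condExp_add hB.1 (integrable_const (μ := μ) (r ^ 2)) m, hB.2] with ω h1 h2
    rw [e, h1, Pi.add_apply, condExp_const hm]
    linarith
  have h2 := (h1.const_mul (a := (2 * r)⁻¹) (by positivity)).of_le hg.aestronglyMeasurable hg0 hle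
  have e : (2 * r)⁻¹ * (2 * r ^ 2) = r := by field_simp
  rwa [e] at h2

theorem CondBound.of_two_pow [IsFiniteMeasure μ] (hm : m ≤ m0) {g : Ω → ℝ} {r : ℝ} (hr : 0 < r)
    (hg : Measurable g) (hg0 : ∀ ω, 0 ≤ g ω) (n : ℕ)
    (hB : CondBound μ m (fun ω => g ω ^ 2 ^ (n + 1)) (r ^ 2 ^ (n + 1))) :
    CondBound μ m (fun ω => g ω ^ 2) (r ^ 2) := by
  induction n with
  | zero => simpa using hB
  | succ n ih =>
    refine ih (CondBound.of_sq hm (pow_pos hr _) (hg.pow_const _) ?_ fun ω => pow_nonneg (hg0 ω) _)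
    have e : ∀ x : ℝ, (x ^ 2 ^ (n + 1)) ^ 2 = x ^ 2 ^ (n + 1 + 1) := fun x => by
      rw [← pow_mul, ← pow_succ]
    simpa only [e] using hB

/-- The exponent is a power of 2, so repeated square roots lead down to the second moment, the one
that the one-step estimates use. -/
theorem MomentBound.lapBound [IsFiniteMeasure μ] {N : ℕ} {A : ℕ → Ω → Fin N → Fin N → ℝ} {h : ℕ}
    {ρ₀ : ℝ} (hρ : 0 < ρ₀) (hA : ∀ k, Measurable (A k)) (hb : MomentBound μ A h ρ₀) (k : ℕ) :
    CondBound μ (past A k) (fun ω => norm2 (lap (A k ω)) ^ 2) (ρ₀ ^ 2) := by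
  obtain ⟨n, hn⟩ : ∃ n, max h 2 = n + 1 := ⟨max h 2 - 1, by omega⟩
  obtain ⟨hi, hle⟩ := hb k
  rw [hn] at hi hle
  have hn0 : ∀ ω, 0 ≤ norm2 (lap (A k ω)) := fun ω => norm_nonneg _
  refine CondBound.of_two_pow (past_le_of_measurable hA k) hρ (measurable_norm2_lap (hA k))
    hn0 n ⟨hi, ?_⟩
  have h0 : 0 ≤ᵐ[μ] μ[fun ω => norm2 (lap (A k ω)) ^ 2 ^ (n + 1) | past A k] :=
    condExp_nonneg (ae_of_all _ fun ω => pow_nonneg (hn0 ω) _)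
  filter_upwards [hle, h0] with ω h1 h2
  -- Undoing the real root requires the conditional moment to be nonnegative, which holds only
  -- almost surely.
  have h3 : ∀ x : ℝ, 0 ≤ x → (x ^ (1 / (2:ℝ) ^ (n + 1))) ^ 2 ^ (n + 1) = x := fun x hx => by
    have := Real.rpow_inv_natCast_pow hx (n := 2 ^ (n + 1)) (by positivity)
    simpa using this
  rw [← h3 _ h2]
  exact pow_le_pow_left₀ (Real.rpow_nonneg h2 _) h1 _

end Moments

theorem measurable_symLap {Ω : Type*} {m : MeasurableSpace Ω} {N : ℕ}
    {A : Ω → Fin N → Fin N → ℝ} (hA : Measurable A) :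
    Measurable fun ω i j => symLap (A ω) i j :=
  measurable_pi_lambda _ fun i => measurable_pi_lambda _ fun j => by
    simp_rw [symLap_apply]
    exact ((measurable_lap_apply hA i j).add (measurable_lap_apply hA j i)).const_mul _

theorem sum_quadratic {N : ℕ} (s : Finset ℕ) (M : ℕ → Matrix (Fin N) (Fin N) ℝ) (x : Fin N → ℝ) :
    ∑ i, ∑ j, x i * x j * (∑ n ∈ s, M n) i j = ∑ n ∈ s, ∑ i, ∑ j, x i * x j * M n i j := by
  symm
  rw [Finset.sum_comm]
  refine Finset.sum_congr rfl fun i _ => ?_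
  rw [Finset.sum_comm]
  exact Finset.sum_congr rfl fun j _ => by rw [Matrix.sum_apply, Finset.mul_sum]

/-! ### Verification of the one-step model from the assumptions. -/

section Setup

variable {Ω : Type*} [m0 : MeasurableSpace Ω] {μ : Measure Ω} [IsProbabilityMeasure μ] {N : ℕ}
  {A ξ : ℕ → Ω → Fin N → Fin N → ℝ} {β ρ₀ ρ₁ : ℝ}

theorem condExp_history (hA : ∀ k, Measurable (A k)) (hξ : ∀ k, Measurable (ξ k))
    (h5 : A5 μ A ξ) (k : ℕ) {B : Ω → ℝ} (hB : Measurable[whole A] B) (hBi : Integrable B μ) :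
    μ[B | history A ξ k] =ᵐ[μ] μ[B | past A k] := by
  have hind : Indep (whole A) (whole ξ) μ := h5
  exact condExp_sup_of_indep (past_le_whole k) (whole_le hA) (past_le_of_measurable hξ k)
    (indep_of_indep_of_le_right hind (past_le_whole k)) hB.stronglyMeasurable hBi

/-- The noises keep their conditional law when the entire flow, including its future, is revealed.
This permits `whole A ⊔ past ξ k` as the σ-algebra that knows the current weights. -/
theorem condExp_whole_sup_past (hA : ∀ k, Measurable (A k)) (hξ : ∀ k, Measurable (ξ k))
    (h5 : A5 μ A ξ) (k : ℕ) {B : Ω → ℝ} (hB : Measurable[whole ξ] B) (hBi : Integrable B μ) :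
    μ[B | whole A ⊔ past ξ k] =ᵐ[μ] μ[B | past ξ k] := by
  have hind : Indep (whole A) (whole ξ) μ := h5
  rw [sup_comm]
  exact condExp_sup_of_indep (past_le_whole k) (whole_le hξ) (whole_le hA)
    hind.symm hB.stronglyMeasurable hBi

theorem CondBound.to_history (hA : ∀ k, Measurable (A k)) (hξ : ∀ k, Measurable (ξ k))
    (h5 : A5 μ A ξ) {k : ℕ} {B : Ω → ℝ} {r : ℝ} (hB : Measurable[whole A] B)
    (h : CondBound μ (past A k) B r) : CondBound μ (history A ξ k) B r := by
  refine ⟨h.1, ?_⟩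
  filter_upwards [condExp_history hA hξ h5 k hB h.1, h.2] with ω h1 h2
  rwa [h1]

theorem condMat_history (hA : ∀ k, Measurable (A k)) (hξ : ∀ k, Measurable (ξ k))
    (h5 : A5 μ A ξ) (k : ℕ) {M : Ω → Fin N → Fin N → ℝ} (hM : Measurable[whole A] M)
    (hMi : ∀ i j, Integrable (fun ω => M ω i j) μ) :
    ∀ᵐ ω ∂μ, condMat μ (history A ξ k) M ω = condMat μ (past A k) M ω := by
  have : ∀ᵐ ω ∂μ, ∀ i j, (μ[fun ω' => M ω' i j | history A ξ k]) ω
      = (μ[fun ω' => M ω' i j | past A k]) ω :=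
    ae_all_iff.2 fun i => ae_all_iff.2 fun j =>
      condExp_history hA hξ h5 k (measurable_coord (measurable_coord hM i) j) (hMi i j)
  filter_upwards [this] with ω h
  ext i j
  exact h i j

theorem stepModel (hΓ : Gamma1 μ A) (h2 : A2 μ ξ β) (h5 : A5 μ A ξ) {h : ℕ} (hρ₀ : 0 < ρ₀)
    (hb2 : MomentBound μ A h ρ₀) (hρ₁ : IsRho1 μ A ρ₁) (k : ℕ) :
    StepModel (history A ξ k) (whole A ⊔ past ξ k) μ (A k) (ξ k) β ρ₀ ρ₁ := by
  have hA : ∀ k, Measurable (A k) := fun k => (hΓ k).1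
  have hξ : ∀ k, Measurable (ξ k) := fun k => (h2 k).1
  have hξw : ∀ j i, Measurable[whole ξ] fun ω => ξ k ω j i := fun j i =>
    measurable_coord (measurable_coord (measurable_whole k) j) i
  exact
  { le := sup_le_sup (past_le_whole k) le_rfl
    le' := sup_le (whole_le hA) (past_le_of_measurable hξ k)
    measA := (measurable_whole k).mono le_sup_left le_rfl
    measNoise := hξ k
    diag := (hΓ k).2.1
    intA := (hΓ k).2.2.1
    balanced := by
      filter_upwards [condMat_history hA hξ h5 k (measurable_whole k) (hΓ k).2.2.1,
        (hΓ k).2.2.2] with ω e hω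
      rwa [e]
    lapBound := CondBound.to_history hA hξ h5
      ((measurable_norm2_lap (measurable_whole k)).pow_const 2) (hb2.lapBound hρ₀ hA k)
    edgeBound := CondBound.to_history hA hξ h5 (measurable_edgeWeight (measurable_whole k)) (hρ₁ k)
    noise_int := fun j i => ((h2 k).2.1 j i).1
    noise_cond := fun j i => (condExp_whole_sup_past hA hξ h5 k (hξw j i)
      ((h2 k).2.1 j i).1).trans ((h2 k).2.1 j i).2
    noiseBound := by
      refine ⟨(h2 k).2.2.1, ?_⟩
      filter_upwards [condExp_whole_sup_past hA hξ h5 k (measurable_noiseSq (measurable_whole k))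
        (h2 k).2.2.1, (h2 k).2.2.2] with ω e hω
      rw [e]
      exact hω }

theorem isRho1_of_momentBound (hΓ : Gamma1 μ A) {h : ℕ} (hρ₀ : 0 < ρ₀) (hb2 : MomentBound μ A h ρ₀) :
    IsRho1 μ A ((N : ℝ) ^ 2 * ρ₀ ^ 2) := fun k => by
  have hA : ∀ k, Measurable (A k) := fun k => (hΓ k).1
  exact ((hb2.lapBound hρ₀ hA k).const_mul (by positivity)).of_le
    (measurable_edgeWeight (hA k)).aestronglyMeasurable (fun ω => edgeWeight_nonneg _)
    fun ω => edgeWeight_le ((hΓ k).2.1 ω)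

theorem isRho2_of_momentBound (hΓ : Gamma1 μ A) {h : ℕ} (hρ₀ : 0 < ρ₀) (hb2 : MomentBound μ A h ρ₀) :
    IsRho2 μ A ((N : ℝ) ^ 2 * ρ₀ ^ 2) := fun i k => by
  have hA : ∀ k, Measurable (A k) := fun k => (hΓ k).1
  have hAk := hA k
  have hd : Measurable fun ω => (degIn (A k ω) i - degOut (A k ω) i) ^ 2 := by
    unfold degIn degOut; fun_prop
  exact ((hb2.lapBound hρ₀ hA k).const_mul (by positivity)).of_le
    hd.aestronglyMeasurable (fun ω => sq_nonneg _) fun ω => imbalance_sq_le _ _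

/-- Joint coercivity of the expected Laplacian forms over a block on which the conditional flow is
connected. -/
theorem mul_integral_energy_le_sum (hN : 2 ≤ N) (hΓ : Gamma1 μ A) (h2 : A2 μ ξ β)
    (h5 : A5 μ A ξ) (S : ∀ k, StepModel (history A ξ k) (whole A ⊔ past ξ k) μ (A k) (ξ k) β ρ₀ ρ₁)
    {h t : ℕ} {θ : ℝ} (hθ : 0 < θ) (hconn : ∀ᵐ ω ∂μ, θ ≤ condConn μ A h t ω)
    {x : Ω → Fin N → ℝ} (hx : Measurable[history A ξ t] x)
    (hxi : Integrable (fun ω => energy (x ω)) μ) :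
    θ * ∫ ω, energy (x ω) ∂μ ≤ ∑ n ∈ Finset.range h,
      ∫ ω, lapForm (A (t + n) ω) (consErr (x ω)) ∂μ := by
  have hA : ∀ k, Measurable (A k) := fun k => (hΓ k).1
  have hξ : ∀ k, Measurable (ξ k) := fun k => (h2 k).1
  have hle : ∀ n, history A ξ t ≤ history A ξ (t + n) := fun n =>
    history_mono A ξ (Nat.le_add_right _ _)
  have hδ := measurable_consErr hx
  have hC := fun n => (S (t + n)).integral_lapForm_eq_condMat (hle n) hδ hxi
  have hsymm : ∀ n, Measurable[whole A] fun ω i j => symLap (A (t + n) ω) i j :=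
    fun n => measurable_symLap (measurable_whole (Z := A) (t + n))
  have hrow : ∀ᵐ ω ∂μ, ∀ n i, ∑ j, condMat μ (history A ξ t)
      (fun ω' => symLap (A (t + n) ω')) ω i j = 0 :=
    ae_all_iff.2 fun n => ae_all_iff.2 fun i => (S (t + n)).sum_condMat_symLap_row (hle n) i
  have hpast : ∀ᵐ ω ∂μ, ∀ n, condMat μ (history A ξ t) (fun ω' => symLap (A (t + n) ω')) ω
      = condMat μ (past A t) (fun ω' => symLap (A (t + n) ω')) ω :=
    ae_all_iff.2 fun n => condMat_history hA hξ h5 t (hsymm n) (S (t + n)).integrable_symLap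
  simp_rw [fun n => (hC n).2]
  rw [← integral_finsetSum _ fun n _ => (hC n).1, ← integral_const_mul]
  refine integral_mono_ae (hxi.const_mul θ) (integrable_finsetSum _ fun n _ => (hC n).1) ?_
  filter_upwards [hconn, hrow, hpast] with ω h1 h2 h3
  rw [condConn, Finset.sum_Ico_eq_sum_range, Nat.add_sub_cancel_left] at h1
  -- Connectivity is given relative to the past of the flow, whereas `x` depends on past noises too;
  -- by independence both conditionings agree.
  rw [Finset.sum_congr rfl fun n _ => (h3 n).symm] at h1
  have h4 := mul_sqNorm_le_of_le_lambda2 hN hθ h1 (fun i => by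
    simp_rw [Matrix.sum_apply]
    rw [Finset.sum_comm]
    exact Finset.sum_eq_zero fun n _ => h2 n i) (sum_consErr (by omega) (x ω))
  rw [sum_quadratic] at h4
  exact h4

end Setup

/-! ### Convergence of the energy and of the average. -/

section Limits

variable {Ω : Type*} {F F' : ℕ → MeasurableSpace Ω} [m0 : MeasurableSpace Ω]
  {μ : Measure Ω} [IsProbabilityMeasure μ] {N : ℕ} {A ξ : ℕ → Ω → Fin N → Fin N → ℝ}
  {β ρ₀ ρ₁ : ℝ} {f : Fin N → Fin N → ℝ → ℝ} {σ b : Fin N → Fin N → ℝ} {c : ℕ → ℝ}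
  {x0 : Fin N → ℝ}

/-- The block estimate fits `tendsto_zero_of_block_decay` with rates `c((m+1)h) θ`, not summable,
and errors of order `c(mh)²`, summable. -/
theorem tendsto_integral_energy (hN : 0 < N) (h1 : A1 f σ b) (h3 : A3 c) (hanti : Antitone c)
    (hF : Monotone F) (S : ∀ k, StepModel (F k) (F' k) μ (A k) (ξ k) β ρ₀ ρ₁)
    (hX : ∀ k, Measurable[F k] (state c f A ξ x0 k)) {h : ℕ} (hh : 0 < h) {θ : ℝ} (hθ : 0 < θ)
    (hconn : ∀ m, θ * ∫ ω, energy (state c f A ξ x0 (m * h) ω) ∂μ ≤ ∑ n ∈ Finset.range h,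
      ∫ ω, lapForm (A (m * h + n) ω) (consErr (state c f A ξ x0 (m * h) ω)) ∂μ) :
    Tendsto (fun k => ∫ ω, energy (state c f A ξ x0 k ω) ∂μ) atTop (𝓝 0) := by
  obtain ⟨hpos, hdiv, hcs⟩ := h3
  have hρ := (S 0).rho1_nonneg
  have hβ := (S 0).beta_nonneg
  have hc : ∀ k, 0 ≤ c k := fun k => (hpos k).le
  have hM := integral_energy_le_qv hN h1 hc hcs S hX
  set M := qv (∑' k, c k ^ 2) ρ₀ ρ₁ β (maxEntry σ) (maxEntry b) (energy x0)
  have hu : ∀ k, 0 ≤ ∫ ω, energy (state c f A ξ x0 k ω) ∂μ := fun k =>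
    integral_nonneg fun ω => energy_nonneg _
  have hM0 : 0 ≤ M := (hu 0).trans (hM 0)
  set D := ρ₀ ^ 2 * M + β * (ρ₁ * (4 * maxEntry σ ^ 2 * M + 2 * maxEntry b ^ 2)) with hD
  have hD0 : 0 ≤ D := by positivity
  have hc0 := hc 0
  refine tendsto_zero_of_block_decay (e := fun k => D * c k ^ 2)
    (a := fun m => c ((m + 1) * h) * θ)
    (e' := fun m => h * (D * (1 + 2 * c 0 * (1 + ρ₀ ^ 2) * 4 ^ h)) * c (m * h) ^ 2) hh hu
    (fun k => by positivity) (hcs.mul_left D) (fun k => ?_)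
    (fun m => mul_nonneg (hc _) hθ.le) (fun hs => ?_) (fun m => by positivity) ?_ (fun m => ?_)
  · simp_rw [state_succ]
    have h2 := (S k).integral_energy_step_le hN h1 (c k) (hX k)
      (integrable_sqNorm_state hN h1 S hX k)
    have hδi : Integrable (fun ω => sqNorm (consErr (state c f A ξ x0 k ω))) μ :=
      integrable_energy_state hN h1 S hX k
    have h3 := mul_nonneg (hc k) ((S k).integral_lapForm_nonneg (measurable_consErr (hX k)) hδi)
    have h4 : c k ^ 2 * (ρ₀ ^ 2 * ∫ ω, energy (state c f A ξ x0 k ω) ∂μ + β * (ρ₁ *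
        (4 * maxEntry σ ^ 2 * ∫ ω, energy (state c f A ξ x0 k ω) ∂μ + 2 * maxEntry b ^ 2)))
        ≤ c k ^ 2 * D := by
      have := hM k
      rw [hD]; gcongr
    linarith
  · refine not_summable_block hpos hanti hdiv hh ((hs.mul_right θ⁻¹).congr fun m => ?_)
    rw [mul_assoc, mul_inv_cancel₀ hθ.ne', mul_one]
  · exact (hcs.comp_injective (i := fun m => m * h)
      fun a b hab => Nat.eq_of_mul_eq_mul_right hh hab).mul_left _
  · have := integral_energy_block_le hN h1 hc hanti hF S hX hM (hconn m)
    rwa [← Nat.succ_mul] at this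

theorem ae_tendsto_energy (hN : 0 < N) (h1 : A1 f σ b) (hc : ∀ k, 0 ≤ c k)
    (hcs : Summable fun k => c k ^ 2)
    (hF : Monotone F) (S : ∀ k, StepModel (F k) (F' k) μ (A k) (ξ k) β ρ₀ ρ₁)
    (hX : ∀ k, Measurable[F k] (state c f A ξ x0 k))
    (hlim : Tendsto (fun k => ∫ ω, energy (state c f A ξ x0 k ω) ∂μ) atTop (𝓝 0)) :
    ∀ᵐ ω ∂μ, Tendsto (fun k => energy (state c f A ξ x0 k ω)) atTop (𝓝 0) := by
  have hρ := (S 0).rho1_nonneg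
  have hβ := (S 0).beta_nonneg
  have hm : ∀ k, F k ≤ m0 := fun k => (S k).le.trans (S k).le'
  have hXi := integrable_sqNorm_state (c := c) (x0 := x0) hN h1 S hX
  have hVi := integrable_energy_state (c := c) (x0 := x0) hN h1 S hX
  have hM := integral_energy_le_qv hN h1 hc hcs S hX
  set M := qv (∑' k, c k ^ 2) ρ₀ ρ₁ β (maxEntry σ) (maxEntry b) (energy x0)
  have hu : ∀ k, 0 ≤ ∫ ω, energy (state c f A ξ x0 k ω) ∂μ := fun k =>
    integral_nonneg fun ω => energy_nonneg _
  have hX0 : ∀ k, Measurable (state c f A ξ x0 k) := fun k => (hX k).mono (hm k) le_rfl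
  set X := state c f A ξ x0 with hXdef
  have hIi : ∀ k, Integrable (fun ω => intensity (maxEntry σ) (maxEntry b) (X k ω)) μ := fun k =>
    StepModel.intensity_integrable hN _ _ (hX0 k) (hXi k)
  have hri : ∀ k, Integrable (fun ω => c k ^ 2 * (ρ₀ ^ 2 * energy (X k ω)
      + β * (ρ₁ * intensity (maxEntry σ) (maxEntry b) (X k ω)))) μ := fun k =>
    (((hVi k).const_mul _).add (((hIi k).const_mul ρ₁).const_mul β)).const_mul _
  have hrint : ∀ k s, ∫ ω in s, c k ^ 2 * (ρ₀ ^ 2 * energy (X k ω)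
      + β * (ρ₁ * intensity (maxEntry σ) (maxEntry b) (X k ω))) ∂μ = c k ^ 2 * (ρ₀ ^ 2 *
      ∫ ω in s, energy (X k ω) ∂μ
      + β * (ρ₁ * ∫ ω in s, intensity (maxEntry σ) (maxEntry b) (X k ω) ∂μ)) := fun k s => by
    rw [integral_const_mul, integral_add ((hVi k).const_mul _).integrableOn
      (((hIi k).const_mul ρ₁).const_mul β).integrableOn, integral_const_mul, integral_const_mul,
      integral_const_mul]
  refine ae_tendsto_zero_of_almost_supermartingale ⟨F, hF, hm⟩ (V := fun k ω => energy (X k ω))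
    (r := fun k ω => c k ^ 2 * (ρ₀ ^ 2 * energy (X k ω)
      + β * (ρ₁ * intensity (maxEntry σ) (maxEntry b) (X k ω))))
    (fun k => (measurable_energy (hX k)).stronglyMeasurable) hVi (fun k ω => energy_nonneg _)
    (fun k => ?_) hri (fun k ω => ?_) ?_ (fun k s hs => ?_) hlim
  · exact ((((measurable_energy (hX k)).const_mul _).add
      (((measurable_intensity _ _ (hX k)).const_mul ρ₁).const_mul β)).const_mul _).stronglyMeasurable
  · have := energy_nonneg (X k ω)
    have := intensity_nonneg (maxEntry σ) (maxEntry b) (X k ω)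
    positivity
  · refine Summable.of_nonneg_of_le (fun k => integral_nonneg fun ω => ?_) (fun k => ?_)
      (hcs.mul_right (ρ₀ ^ 2 * M + β * (ρ₁ * (4 * maxEntry σ ^ 2 * M + 2 * maxEntry b ^ 2))))
    · have := energy_nonneg (X k ω)
      have := intensity_nonneg (maxEntry σ) (maxEntry b) (X k ω)
      positivity
    · have e := hrint k Set.univ
      simp only [Measure.restrict_univ] at e
      rw [e, StepModel.integral_intensity hN _ _ (hX0 k) (hXi k)]
      have := hM k
      gcongr
  · have hms := hm k s hs
    -- Taking the weight `Z` to be the indicator of a past event turns the weighted energy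
    -- inequality into the supermartingale inequality on that event.
    have hZ : ∀ g : Ω → ℝ, ∫ ω, s.indicator (fun _ => (1:ℝ)) ω * g ω ∂μ = ∫ ω in s, g ω ∂μ := by
      intro g
      rw [← integral_indicator hms]
      refine integral_congr_ae (ae_of_all _ fun ω => ?_)
      by_cases h : ω ∈ s <;> simp [h]
    have hZm : Measurable[F k] (s.indicator fun _ => (1:ℝ)) := measurable_const.indicator hs
    have hZ0 : ∀ ω, 0 ≤ s.indicator (fun _ => (1:ℝ)) ω :=
      Set.indicator_nonneg fun _ _ => zero_le_one
    have hZ1 : ∀ ω, s.indicator (fun _ => (1:ℝ)) ω ≤ 1 := fun ω =>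
      Set.indicator_le_self' (fun _ _ => zero_le_one) ω
    have b1 := (S k).integral_mul_energy_step_le hN h1 (c k) (hX k) (hXi k) hZm hZ0 hZ1
    have b2 := mul_nonneg (hc k) ((S k).integral_mul_lapForm_nonneg (measurable_consErr (hX k))
      (hVi k) hZm hZ0 hZ1)
    rw [hZ, hZ, hZ] at b1
    rw [hZ] at b2
    rw [hZ] at b1
    simp only [hrint]
    simp_rw [hXdef, state_succ, ← hXdef]
    linarith

theorem exists_limit_mean (hN : 0 < N) (h1 : A1 f σ b)
    (hF : Monotone F) (S : ∀ k, StepModel (F k) (F' k) μ (A k) (ξ k) β ρ₀ ρ₁)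
    (hX : ∀ k, Measurable[F k] (state c f A ξ x0 k))
    (hs : Summable fun k => ∫ ω,
      (mean (state c f A ξ x0 (k + 1) ω) - mean (state c f A ξ x0 k ω)) ^ 2 ∂μ) :
    ∃ X : Ω → ℝ, Measurable X ∧ MemLp X 2 μ ∧
      (∀ᵐ ω ∂μ, Tendsto (fun k => mean (state c f A ξ x0 k ω)) atTop (𝓝 (X ω))) ∧
      Tendsto (fun k => ∫ ω, (mean (state c f A ξ x0 k ω) - X ω) ^ 2 ∂μ) atTop (𝓝 0) ∧
      ∫ ω, X ω ∂μ = mean x0 ∧ variance X μ ≤ ∑' k, ∫ ω,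
        (mean (state c f A ξ x0 (k + 1) ω) - mean (state c f A ξ x0 k ω)) ^ 2 ∂μ := by
  have hm : ∀ k, F k ≤ m0 := fun k => (S k).le.trans (S k).le'
  have hXi := integrable_sqNorm_state (c := c) (x0 := x0) hN h1 S hX
  refine exists_limit_of_square_integrable_martingale ⟨F, hF, hm⟩
    (M := fun k ω => mean (state c f A ξ x0 k ω))
    (fun k => (measurable_mean (hX k)).stronglyMeasurable) (fun ω => rfl)
    (fun k => memLp_mean ((hX k).mono (hm k) le_rfl) (hXi k)) (fun k Z hZ hZ2 => ?_)
    (fun k => le_rfl) hs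
  simp_rw [state_succ]
  exact (S k).integral_mul_mean_step_sub hN h1 (c k) (hX k) (hXi k) hZ.measurable hZ2

theorem tsum_increments_le (hN : 0 < N) (h1 : A1 f σ b) (hc : ∀ k, 0 ≤ c k)
    (hcs : Summable fun k => c k ^ 2)
    (S : ∀ k, StepModel (F k) (F' k) μ (A k) (ξ k) β ρ₀ ρ₁)
    (hX : ∀ k, Measurable[F k] (state c f A ξ x0 k)) {ρ₂ : ℝ}
    (h2 : ∀ i k, CondBound μ (F k) (fun ω => (degIn (A k ω) i - degOut (A k ω) i) ^ 2) ρ₂) :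
    (Summable fun k => (∫ ω, energy (state c f A ξ x0 k ω) ∂μ) * c k ^ 2) ∧
    (Summable fun k => ∫ ω,
        (mean (state c f A ξ x0 (k + 1) ω) - mean (state c f A ξ x0 k ω)) ^ 2 ∂μ) ∧
    ∑' k, ∫ ω, (mean (state c f A ξ x0 (k + 1) ω) - mean (state c f A ξ x0 k ω)) ^ 2 ∂μ
      ≤ varBound N (∑' k, c k ^ 2)
          (∑' k, (∫ ω, energy (state c f A ξ x0 k ω) ∂μ) * c k ^ 2)
          ρ₀ ρ₁ ρ₂ β (maxEntry σ) (maxEntry b) (energy x0) (sqNorm x0) := by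
  have hρ := (S 0).rho1_nonneg
  have hβ := (S 0).beta_nonneg
  have hρ₂ : 0 ≤ ρ₂ := (h2 ⟨0, hN⟩ 0).nonneg fun _ => sq_nonneg _
  have hXi := integrable_sqNorm_state (c := c) (x0 := x0) hN h1 S hX
  have hM := integral_energy_le_qv hN h1 hc hcs S hX
  have hQ := integral_sqNorm_le_qx hN h1 hc hcs S hX
  set M := qv (∑' k, c k ^ 2) ρ₀ ρ₁ β (maxEntry σ) (maxEntry b) (energy x0)
  have hu : ∀ k, 0 ≤ ∫ ω, energy (state c f A ξ x0 k ω) ∂μ := fun k =>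
    integral_nonneg fun ω => energy_nonneg _
  have hE : Summable fun k => (∫ ω, energy (state c f A ξ x0 k ω) ∂μ) * c k ^ 2 :=
    Summable.of_nonneg_of_le (fun k => mul_nonneg (hu k) (sq_nonneg _))
      (fun k => mul_le_mul_of_nonneg_right (hM k) (sq_nonneg _)) (hcs.mul_left M)
  set X := state c f A ξ x0 with hXdef
  set Q := qx (∑' k, c k ^ 2) ρ₀ ρ₁ β (maxEntry σ) (maxEntry b) (energy x0) (sqNorm x0) with hQdef
  -- The three terms come from the constant part of the noise intensity, its energy part, and the
  -- imbalances; summed over `k` they are the three terms of `varBound`.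
  have hle : ∀ k, ∫ ω, (mean (X (k + 1) ω) - mean (X k ω)) ^ 2 ∂μ ≤
      4 * β * maxEntry b ^ 2 * ρ₁ / (N : ℝ) ^ 2 * c k ^ 2
      + 8 * β * maxEntry σ ^ 2 * ρ₁ / (N : ℝ) ^ 2 * ((∫ ω, energy (X k ω) ∂μ) * c k ^ 2)
      + 2 * ρ₂ * Q / N * c k ^ 2 := fun k => by
    simp_rw [hXdef, state_succ, ← hXdef]
    have hN' : (0:ℝ) < N := by exact_mod_cast hN
    calc _ ≤ 2 * c k ^ 2 / (N : ℝ) ^ 2 * (β * (ρ₁ * (4 * maxEntry σ ^ 2 * ∫ ω, energy (X k ω) ∂μ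
          + 2 * maxEntry b ^ 2)) + N * (ρ₂ * ∫ ω, sqNorm (X k ω) ∂μ)) :=
          (S k).integral_mean_step_sq_le hN h1 (c k) (hX k) (hXi k) fun i => h2 i k
      _ ≤ 2 * c k ^ 2 / (N : ℝ) ^ 2 * (β * (ρ₁ * (4 * maxEntry σ ^ 2 * ∫ ω, energy (X k ω) ∂μ
          + 2 * maxEntry b ^ 2)) + N * (ρ₂ * Q)) := by
          have := hQ k
          gcongr
      _ = _ := by field_simp; ring
  have s1 := hcs.mul_left (4 * β * maxEntry b ^ 2 * ρ₁ / (N : ℝ) ^ 2)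
  have s2 := hE.mul_left (8 * β * maxEntry σ ^ 2 * ρ₁ / (N : ℝ) ^ 2)
  have s3 := hcs.mul_left (2 * ρ₂ * Q / N)
  have hI : Summable fun k => ∫ ω, (mean (X (k + 1) ω) - mean (X k ω)) ^ 2 ∂μ :=
    Summable.of_nonneg_of_le (fun k => integral_nonneg fun ω => sq_nonneg _) hle
      ((s1.add s2).add s3)
  refine ⟨hE, hI, (hI.tsum_le_tsum hle ((s1.add s2).add s3)).trans_eq ?_⟩
  rw [(s1.add s2).tsum_add s3, s1.tsum_add s2, tsum_mul_left, tsum_mul_left, tsum_mul_left,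
    varBound, ← hQdef]
  ring

end Limits

end StochAvg

/-! ### The main theorem. -/

open StochAvg
theorem theorem1 {Ω : Type*} [MeasurableSpace Ω] (μ : Measure Ω) [IsProbabilityMeasure μ]
    (N : ℕ) (hN : 2 ≤ N)
    (A ξ : ℕ → Ω → Fin N → Fin N → ℝ) (f : Fin N → Fin N → ℝ → ℝ) (c : ℕ → ℝ)
    (x0 : Fin N → ℝ) (σ b : Fin N → Fin N → ℝ) (β : ℝ) (hβ : 0 < β)
    (hΓ : Gamma1 μ A) (h1 : A1 f σ b) (h2 : A2 μ ξ β) (h3 : A3 c) (h4 : A4 c) (h5 : A5 μ A ξ)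
    (h : ℕ) (hh : 0 < h) (θ ρ₀ : ℝ) (hθ : 0 < θ) (hρ₀ : 0 < ρ₀)
    (hb1 : ∀ᵐ ω ∂μ, ∀ m : ℕ, θ ≤ condConn μ A h (m * h) ω)
    (hb2 : MomentBound μ A h ρ₀) :
    -- the consensus error vanishes in mean square and almost surely
    (∀ k, Integrable (fun ω => energy (state c f A ξ x0 k ω)) μ) ∧
    Tendsto (fun k => ∫ ω, energy (state c f A ξ x0 k ω) ∂μ) atTop (𝓝 0) ∧
    (∀ᵐ ω ∂μ, Tendsto (fun k => energy (state c f A ξ x0 k ω)) atTop (𝓝 0)) ∧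
    -- the constants of the variance bound are well defined
    (Summable fun k => (∫ ω, energy (state c f A ξ x0 k ω) ∂μ) * c k ^ 2) ∧
    (∃ ρ₁, IsRho1 μ A ρ₁) ∧ (∃ ρ₂, IsRho2 μ A ρ₂) ∧
    -- the states converge to a common random variable
    ∃ xs : Ω → ℝ, Measurable xs ∧ MemLp xs 2 μ ∧
      (∀ i, (∀ k, Integrable (fun ω => (state c f A ξ x0 k ω i - xs ω) ^ 2) μ) ∧
        Tendsto (fun k => ∫ ω, (state c f A ξ x0 k ω i - xs ω) ^ 2 ∂μ) atTop (𝓝 0)) ∧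
      (∀ᵐ ω ∂μ, ∀ i, Tendsto (fun k => state c f A ξ x0 k ω i) atTop (𝓝 (xs ω))) ∧
      ∫ ω, xs ω ∂μ = (1 / (N : ℝ)) * ∑ j, x0 j ∧
      ∀ ρ₁ ρ₂ : ℝ, IsRho1 μ A ρ₁ → IsRho2 μ A ρ₂ →
        variance xs μ ≤ varBound N (∑' k, c k ^ 2)
          (∑' k, (∫ ω, energy (state c f A ξ x0 k ω) ∂μ) * c k ^ 2)
          ρ₀ ρ₁ ρ₂ β (maxEntry σ) (maxEntry b) (energy x0) (sqNorm x0) := by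

  have hN0 : 0 < N := by omega
  have hA : ∀ k, Measurable (A k) := fun k => (hΓ k).1
  have hξ : ∀ k, Measurable (ξ k) := fun k => (h2 k).1
  have hc : ∀ k, 0 ≤ c k := fun k => (h3.1 k).le
  have hcs : Summable fun k => c k ^ 2 := h3.2.2
  have hf : ∀ j i, Measurable (f j i) := fun j i => (h1 j i).1
  have hF := history_mono A ξ
  have hX := measurable_state c hf A ξ x0
  have hr1 := isRho1_of_momentBound hΓ hρ₀ hb2
  have hr2 := isRho2_of_momentBound hΓ hρ₀ hb2
  -- Kept general in `ρ₁`: the limit is built once with the explicit constants. Its variance is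
  -- bounded by the sum of mean squared increments, which does not involve them, so that sum can be
  -- re-estimated for any admissible `ρ₁` and `ρ₂`.
  have hS := fun (ρ₁ : ℝ) (hρ₁ : IsRho1 μ A ρ₁) (k : ℕ) => stepModel hΓ h2 h5 hρ₀ hb2 hρ₁ k
  have S := hS _ hr1
  have hm : ∀ k, history A ξ k ≤ _ := fun k => (S k).le.trans (S k).le'
  have hX0 : ∀ k, Measurable (state c f A ξ x0 k) := fun k => (hX k).mono (hm k) le_rfl
  have hhist : ∀ ρ₂, IsRho2 μ A ρ₂ → ∀ i k, CondBound μ (history A ξ k)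
      (fun ω => (degIn (A k ω) i - degOut (A k ω) i) ^ 2) ρ₂ := fun ρ₂ hρ₂ i k => by
    refine CondBound.to_history hA hξ h5 ?_ (hρ₂ i k)
    have hAk : ∀ i j, Measurable[whole A] fun ω => A k ω i j := fun i j =>
      measurable_coord (measurable_coord (measurable_whole k) i) j
    exact ((Finset.measurable_sum _ fun j _ => hAk i j).sub
      (Finset.measurable_sum _ fun j _ => hAk j i)).pow_const 2
  have hVi := integrable_energy_state (c := c) (x0 := x0) hN0 h1 S hX
  have hlim := tendsto_integral_energy hN0 h1 h3 h4.1 hF S hX hh hθ fun m =>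
    mul_integral_energy_le_sum hN hΓ h2 h5 S hθ (hb1.mono fun ω hω => hω m) (hX _) (hVi _)
  have hae := ae_tendsto_energy hN0 h1 hc hcs hF S hX hlim
  obtain ⟨hE, hI, -⟩ := tsum_increments_le hN0 h1 hc hcs S hX (hhist _ hr2)
  obtain ⟨xs, hxm, hx2, hxae, hxL2, hxE, hxV⟩ := exists_limit_mean hN0 h1 hF S hX hI
  refine ⟨hVi, hlim, hae, hE, ⟨_, hr1⟩, ⟨_, hr2⟩, xs, hxm, hx2, fun i => ?_, ?_, hxE,
    fun ρ₁ ρ₂ hρ₁ hρ₂ => hxV.trans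
      (tsum_increments_le hN0 h1 hc hcs (hS ρ₁ hρ₁) hX (hhist _ hρ₂)).2.2⟩
  · have hi : ∀ k, Integrable (fun ω => (state c f A ξ x0 k ω i - xs ω) ^ 2) μ := fun k =>
      ((memLp_two_coord (hX0 k) (integrable_sqNorm_state hN0 h1 S hX k) i).sub hx2).integrable_sq
    have hi' : ∀ k, Integrable (fun ω => (mean (state c f A ξ x0 k ω) - xs ω) ^ 2) μ := fun k =>
      ((memLp_mean (hX0 k) (integrable_sqNorm_state hN0 h1 S hX k)).sub hx2).integrable_sq
    -- Split `xᵢ - x*` at the average: its square is at most `2 V` plus twice the squared error of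
    -- the average.
    refine ⟨hi, squeeze_zero (fun k => integral_nonneg fun ω => sq_nonneg _) (fun k => ?_)
      (by simpa using (hlim.const_mul 2).add (hxL2.const_mul 2))⟩
    rw [← integral_const_mul, ← integral_const_mul,
      ← integral_add ((hVi k).const_mul 2) ((hi' k).const_mul 2)]
    refine integral_mono (hi k) (((hVi k).const_mul 2).add ((hi' k).const_mul 2)) fun ω => ?_
    have e := sq_le_sqNorm (consErr (state c f A ξ x0 k ω)) i
    rw [consErr_apply, sqNorm_consErr] at e
    have e2 := add_sq_le (a := state c f A ξ x0 k ω i - mean (state c f A ξ x0 k ω))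
      (b := mean (state c f A ξ x0 k ω) - xs ω)
    rw [sub_add_sub_cancel] at e2
    change _ ≤ 2 * energy (state c f A ξ x0 k ω) + 2 * (mean (state c f A ξ x0 k ω) - xs ω) ^ 2
    linarith
  · filter_upwards [hae, hxae] with ω h1 h2 i
    have h3 : Tendsto (fun k => consErr (state c f A ξ x0 k ω) i ^ 2) atTop (𝓝 0) :=
      squeeze_zero (fun k => sq_nonneg _) (fun k => sq_le_sqNorm _ i) h1
    have h4 : Tendsto (fun k => consErr (state c f A ξ x0 k ω) i) atTop (𝓝 0) := by
      have := h3.sqrt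
      simp only [Real.sqrt_sq_eq_abs, Real.sqrt_zero] at this
      exact (tendsto_zero_iff_abs_tendsto_zero _).2 this
    refine (zero_add (xs ω) ▸ h4.add h2).congr fun k => ?_
    rw [consErr_apply, sub_add_cancel]
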